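/- Let $k\ge 3$ be a fixed integer. For $n,R\ge 1$, an average-case zero-$k$-clique instance (ACZ$k$C) of size $n$ with range $R$ is the complete $k$-partite graph with $n$ vertices in each part, whose edge weights are chosen independently and uniformly from $\{0,1,\dots,R-1\}$. A $k$-clique of this graph is a zero $k$-clique if the sum of its $\binom k2$ edge weights is $0$ modulo $R$. The decision problem asks whether a zero $k$-clique exists; the counting problem asks for the number of zero $k$-cliques. Algorithms are randomized word-RAM programs with words of $O(\log n)$ bits that receive $n$, $R$ and the weighted adjacency matrix; $R$ may be any positive integer bounded by a polynomial in $n$. For $\delta>0$ we say that such an algorithm solves one of the two problems in time $O(n^{k-\delta})$ with probability at least $1-n^{-\omega(1)}$ if for every constant $c$ there are constants $C,b,N$ and a function $f$ with $f(n)\to\infty$ such that for all $n\ge N$ and all $1\le R\le n^c$: on every input of size $n$ and range $R$ and for all coin flips, the algorithm halts after at most $C n^{k-\delta}$ steps and only uses words with values below $n^b$; and with probability at least $1-n^{-f(n)}$, over both the random instance and the coin flips of the algorithm, its output is correct. Theorem. If for some $\varepsilon>0$ there is an algorithm that solves the decision version of ACZ$k$C in time $O(n^{k-\varepsilon})$ with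 probability at least $1-n^{-\omega(1)}$, then for some $\varepsilon'>0$ there is an algorithm that solves the counting version of ACZ$k$C in time $O(n^{k-\varepsilon'})$ with probability at least $1-n^{-\omega(1)}$. -/

import Mathlib

open Filter Topology

namespace ACZkC

/-! ### A randomized word RAM -/

/-- The binary word operations (subtraction is truncated at `0`, division is integer division). -/
inductive WordOp
  | add | sub | mul | div | mod | and | or | xor | shl | shr

/-- The value of a word operation. -/
def WordOp.eval : WordOp → ℕ → ℕ → ℕ
  | add, a, b => a + b
  | sub, a, b => a - b
  | mul, a, b => a * b
  | div, a, b => a / b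
  | mod, a, b => a % b
  | and, a, b => a &&& b
  | or, a, b => a ||| b
  | xor, a, b => a ^^^ b
  | shl, a, b => a <<< b
  | shr, a, b => a >>> b

/-- The instructions of the machine. Arguments `d`, `a`, `b` are names of registers. -/
inductive Instr
  /-- `reg d := c` -/
  | const (d c : ℕ)
  /-- `reg d := o (reg a) (reg b)` -/
  | op (o : WordOp) (d a b : ℕ)
  /-- `reg d := mem (reg a)` -/
  | load (d a : ℕ)
  /-- `mem (reg a) := reg b` -/
  | store (a b : ℕ)
  /-- `reg d :=` a fresh fair random bit -/
  | flip (d : ℕ)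
  /-- jump to instruction number `l` if `reg a = 0` -/
  | jumpZero (a l : ℕ)

/-- A program is a finite list of instructions. -/
abbrev Program := List Instr

/-- A configuration: program counter, registers, and random access memory. -/
structure Config where
  pc : ℕ
  reg : ℕ → ℕ
  mem : ℕ → ℕ

/-- Write `x` into register `d` and go to the next instruction. -/
def Config.setReg (s : Config) (d x : ℕ) : Config :=
  ⟨s.pc + 1, Function.update s.reg d x, s.mem⟩

/-- The (random) effect of one instruction. -/
noncomputable def Instr.exec (s : Config) : Instr → PMF Config
  | const d c => PMF.pure (s.setReg d c)
  | op o d a b => PMF.pure (s.setReg d (o.eval (s.reg a) (s.reg b)))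
  | load d a => PMF.pure (s.setReg d (s.mem (s.reg a)))
  | store a b => PMF.pure ⟨s.pc + 1, s.reg, Function.update s.mem (s.reg a) (s.reg b)⟩
  | flip d => (PMF.uniformOfFintype Bool).map fun c => s.setReg d c.toNat
  | jumpZero a l => PMF.pure ⟨if s.reg a = 0 then l else s.pc + 1, s.reg, s.mem⟩

/-- One step of the machine. The machine has halted when the program counter points outside the
program; a halted configuration does not change any more. -/
noncomputable def Program.step (P : Program) (s : Config) : PMF Config :=
  match P[s.pc]? with
  | some i => i.exec s
  | none => PMF.pure s

/-- The distribution of the configuration after `t` steps from `s`. -/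
noncomputable def Program.run (P : Program) (s : Config) : ℕ → PMF Config
  | 0 => PMF.pure s
  | t + 1 => (P.run s t).bind P.step

/-- Whatever the coin flips are, `P` started in `s` has halted after at most `t` steps. -/
def Program.HaltsWithin (P : Program) (s : Config) (t : ℕ) : Prop :=
  ∀ s' ∈ (P.run s t).support, P.length ≤ s'.pc

/-- Whatever the coin flips are, in the whole run of `P` from `s` the contents of all registers and
memory cells (hence also all addresses that are accessed) stay below `W`, i.e. fit into machine
words of `log₂ W` bits. -/
def Program.WordsBelow (P : Program) (s : Config) (W : ℕ) : Prop :=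
  ∀ t, ∀ s' ∈ (P.run s t).support, ∀ a, s'.reg a < W ∧ s'.mem a < W

/-! ### Average-case zero-`k`-clique -/

/-- The complete `k`-partite graph with `n` vertices in each part. -/
abbrev graph (k n : ℕ) : SimpleGraph (Fin k × Fin n) :=
  SimpleGraph.completeEquipartiteGraph k n

/-- An instance with range `R`: a weight in `{0, …, R - 1}` for every edge of the complete
`k`-partite graph with `n` vertices in each part. -/
abbrev Instance (k n R : ℕ) : Type := (graph k n).edgeSet → Fin R

variable {k n R : ℕ}

/-- The total weight of the edges inside the vertex set `s`. -/
def Instance.weight (w : Instance k n R) (s : Finset (Fin k × Fin n)) : ℕ :=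
  ∑ e : (graph k n).edgeSet, if e.1 ∈ s.sym2 then (w e : ℕ) else 0

/-- The zero `k`-cliques: the `k`-cliques whose edge weights sum to zero modulo `R`. -/
def Instance.zeroCliques (w : Instance k n R) : Finset (Finset (Fin k × Fin n)) :=
  {s ∈ (graph k n).cliqueFinset k | w.weight s ≡ 0 [MOD R]}

/-- The entry of the weighted adjacency matrix at `(x, y)`; it is `0` if `xy` is not an edge. -/
def Instance.entry (w : Instance k n R) (x y : Fin k × Fin n) : ℕ :=
  if h : (graph k n).Adj x y then w ⟨s(x, y), h⟩ else 0

/-- The vertices are numbered so that vertex `u` of part `i` has number `i * n + u`. The input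
memory holds the weighted `k * n` by `k * n` adjacency matrix, row by row, followed by zeros. -/
def Instance.memory (w : Instance k n R) (a : ℕ) : ℕ :=
  if h : a < (k * n) * (k * n) then
    w.entry (finProdFinEquiv.symm (finProdFinEquiv.symm ⟨a, h⟩).1)
      (finProdFinEquiv.symm (finProdFinEquiv.symm ⟨a, h⟩).2)
  else 0

/-- The initial configuration on input `w`: register `0` holds `n`, register `1` holds `R`, all
other registers are zero, and the memory holds the adjacency matrix. -/
def Instance.init (w : Instance k n R) : Config :=
  ⟨0, fun a => if a = 0 then n else if a = 1 then R else 0, w.memory⟩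

/-- The answer to the decision problem: `1` if there is a zero `k`-clique, else `0`. -/
def decision (k n R : ℕ) (w : Instance k n R) : ℕ :=
  if w.zeroCliques.Nonempty then 1 else 0

/-- The answer to the counting problem: the number of zero `k`-cliques. -/
def counting (k n R : ℕ) (w : Instance k n R) : ℕ :=
  w.zeroCliques.card

/-- The probability, over the input with iid uniform edge weights in `{0, …, R - 1}` and over the
coin flips of `P`, that register `0` holds the right answer after `t` steps. -/
noncomputable def successProb (P : Program) (k n R : ℕ) [NeZero R]
    (answer : Instance k n R → ℕ) (t : ℕ) : ENNReal :=
  ((PMF.uniformOfFintype (Instance k n R)).bind fun w =>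
    (P.run w.init t).map fun s => (w, s.reg 0)).toOuterMeasure {p | p.2 = answer p.1}

/-- `P` is an algorithm for the given average-case problem on complete `k`-partite graphs that runs
in time `O(n ^ (k - ε))` on a word RAM with `O(log n)`-bit words and succeeds with probability at
least `1 - n ^ (-ω(1))`. The range `R` is part of the input, and is polynomially bounded (so that a
weight fits into a word); the implied constants and the function `ω(1)` may depend only on the
polynomial bound `n ^ c` on `R`. -/
def SolvesOnAverage (k : ℕ) (answer : ∀ n R : ℕ, Instance k n R → ℕ) (P : Program) (ε : ℝ) :
    Prop :=
  ∀ c : ℕ, ∃ (C : ℝ) (b : ℕ) (f : ℕ → ℝ), Tendsto f atTop atTop ∧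
    ∀ᶠ n : ℕ in atTop, ∀ (R : ℕ) [NeZero R], R ≤ n ^ c →
      ∃ t : ℕ, (t : ℝ) ≤ C * (n : ℝ) ^ ((k : ℝ) - ε) ∧
        (∀ w : Instance k n R,
          P.HaltsWithin w.init t ∧ P.WordsBelow w.init (n ^ b)) ∧
        ENNReal.ofReal (1 - (n : ℝ) ^ (-f n)) ≤ successProb P k n R (answer n R) t

end ACZkC

/-! Write `k = κ + 3` and let `m` be the largest power of two with `m ^ q ≤ n`, where `q` is a large
constant. Then `m` and `n` are polynomially related, and it suffices to save a factor `m ^ e`, for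
some fixed `e > 0`, against the trivial time `n ^ k`. Two methods are used, according to the size of
`R`.

Large range, `R ≥ m ^ (k + 2)`. Every part is covered by `n / m + 1` groups of `m` vertices. One
group per part gives an instance of size `m` that is again uniform (`expect_sub`), so by a union
bound the decision algorithm is right on all `(n / m + 1) ^ k` of them except with negligible
probability. These calls cost about `n ^ k * m ^ (-ε)`. A choice of groups for which the answer is
"yes" is searched exhaustively in time `m ^ k`. There are at most `2 ^ k` times as many such choices
as zero cliques (`Instance.sum_decision_le`), and there are rarely many zero cliques. Indeed, fix
the vertices in all parts but two: the weights of the `n ^ 2` completions are independent and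
uniform because each involves its own edge, so `2 ^ (number of zeros)` has mean `(1 + 1 / R) ^ (n ^
2)` (`sum_two_pow_pairCount`). Markov's inequality and a union bound give `card_counting_gt`. The
running time must be bounded on every input, so the number of searches is capped by `budget`; the
searches then cost `O(n ^ k / m)`, and exceeding the cap is one of the two sources of error.

Small range, `R < m ^ (k + 2)`. The count is computed deterministically. Fix the vertices in the
parts from `3` on and the residues `p`, `q` of two of the three groups of weights: the number of
zero cliques is then the trace of a product of three 0/1 matrices
(`Instance.counting_eq_sum_trace`). The trace is evaluated by a tensor power of Strassen's algorithm
in trilinear form (`sum_block`). With `2 ^ L = m ^ Q` the gain `(8 / 7) ^ L` is a large power of `m`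
and outweighs the `R ^ 2` choices of residues (`seven_pow_mul_le`, `smallTime_mul_le`).

Both methods have to be realised on the word RAM. Programs are compiled from a small language whose
rules (`Run`) track time, word size and a budget for the error probability. Simulating `D`
(`Run.sim`) turns its error into the expectation of the remaining budget. The memories of the
simulated runs are interleaved with a stride equal to the number of runs, so every run finds
untouched zero cells. `largeCmd_spec` and `smallCmd_spec` verify the two methods, and
`solvesOnAverage_countProgram` combines them with the estimates of time and error. -/

namespace ACZkC

/-! ### Runs of the machine with time and error budgets -/

/-- All registers and memory cells are below `W`. -/
def Config.Below (s : Config) (W : ℕ) : Prop := ∀ a, s.reg a < W ∧ s.mem a < W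

/-- `Program.run` appends steps at the end, whereas programs are verified from their first
instruction on. -/
theorem Program.run_succ' (P : Program) (s : Config) (t : ℕ) :
    P.run s (t + 1) = (P.step s).bind fun s' => P.run s' t := by
  induction t with
  | zero =>
    change (PMF.pure s).bind P.step = (P.step s).bind PMF.pure
    simp
  | succ t ih =>
    change (P.run s (t + 1)).bind P.step = _
    rw [ih, PMF.bind_bind]
    rfl

theorem Program.step_of_length_le {P : Program} {s : Config} (h : P.length ≤ s.pc) :
    P.step s = PMF.pure s := by
  unfold Program.step
  rw [List.getElem?_eq_none h]

theorem Program.run_of_length_le {P : Program} {s : Config} (h : P.length ≤ s.pc) (t : ℕ) :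
    P.run s t = PMF.pure s := by
  induction t with
  | zero => rfl
  | succ t ih => rw [Program.run_succ', Program.step_of_length_le h, PMF.pure_bind, ih]

theorem Program.step_of_getElem? {P : Program} {s : Config} {i : Instr} (h : P[s.pc]? = some i) :
    P.step s = i.exec s := by
  unfold Program.step
  rw [h]

theorem Program.haltsWithin_succ {P : Program} {s : Config} {t : ℕ} :
    P.HaltsWithin s (t + 1) ↔ ∀ s' ∈ (P.step s).support, P.HaltsWithin s' t := by
  simp only [Program.HaltsWithin, Program.run_succ', PMF.mem_support_bind_iff]
  constructor
  · intro h s' hs' s'' hs''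
    exact h s'' ⟨s', hs', hs''⟩
  · rintro h s'' ⟨s', hs', hs''⟩
    exact h s' hs' s'' hs''

theorem Program.wordsBelow_iff {P : Program} {s : Config} {W : ℕ} :
    P.WordsBelow s W ↔ s.Below W ∧ ∀ s' ∈ (P.step s).support, P.WordsBelow s' W := by
  constructor
  · intro h
    refine ⟨h 0 s (by simp [Program.run]), fun s' hs' t s'' hs'' => h (t + 1) s'' ?_⟩
    rw [Program.run_succ', PMF.mem_support_bind_iff]
    exact ⟨s', hs', hs''⟩
  · rintro ⟨h0, h⟩ t
    cases t with
    | zero =>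
      intro s' hs'
      simp only [Program.run, PMF.support_pure, Set.mem_singleton_iff] at hs'
      exact hs' ▸ h0
    | succ t =>
      intro s'' hs''
      rw [Program.run_succ', PMF.mem_support_bind_iff] at hs''
      obtain ⟨s', hs', hs''⟩ := hs''
      exact h s' hs' t s'' hs''

/-- From `s`, the program `A` keeps all words below `W`, halts within `T` steps, and ends outside
`G` with probability at most `δ`. -/
def Ok (A : Program) (W : ℕ) (G : Config → Prop) (T : ℕ) (δ : ENNReal) (s : Config) : Prop :=
  A.WordsBelow s W ∧ A.HaltsWithin s T ∧ (A.run s T).toOuterMeasure {s' | ¬ G s'} ≤ δ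

variable {A : Program} {W T T' : ℕ} {G : Config → Prop} {δ δ' : ENNReal} {s s' : Config}

/-- The error budget may depend on the outcome of the step: each successor gets its own budget `φ
s'`, and the price is the average. This is the only rule through which randomness enters. -/
theorem Ok.step (hs : s.Below W) (φ : Config → ENNReal)
    (h : ∀ s' ∈ (A.step s).support, Ok A W G T (φ s') s') :
    Ok A W G (T + 1) (∑' s', A.step s s' * φ s') s := by
  refine ⟨Program.wordsBelow_iff.2 ⟨hs, fun s' h' => (h s' h').1⟩,
    Program.haltsWithin_succ.2 fun s' h' => (h s' h').2.1, ?_⟩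
  rw [Program.run_succ', PMF.toOuterMeasure_bind_apply]
  refine ENNReal.tsum_le_tsum fun s' => ?_
  by_cases h' : s' ∈ (A.step s).support
  · gcongr
    exact (h s' h').2.2
  · rw [PMF.mem_support_iff, not_not] at h'
    simp [h']

theorem Ok.mono_error (h : Ok A W G T δ s) (hδ : δ ≤ δ') : Ok A W G T δ' s :=
  ⟨h.1, h.2.1, h.2.2.trans hδ⟩

theorem Ok.det {i : Instr} (hi : A[s.pc]? = some i) (he : i.exec s = PMF.pure s')
    (hs : s.Below W) (h : Ok A W G T δ s') : Ok A W G (T + 1) δ s := by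
  have hstep : A.step s = PMF.pure s' := (Program.step_of_getElem? hi).trans he
  refine (Ok.step (φ := fun _ => δ) hs fun s'' h'' => ?_).mono_error ?_
  · rw [hstep, PMF.support_pure, Set.mem_singleton_iff] at h''
    exact h'' ▸ h
  · rw [ENNReal.tsum_mul_right, PMF.tsum_coe, one_mul]

/-- An error budget of at least `1` demands nothing of the result. A run that has already failed is
continued with such a budget, so that its time and word bounds are still proved. -/
theorem Ok.of_halted (h : A.length ≤ s.pc) (hs : s.Below W) (hG : G s ∨ 1 ≤ δ) :
    Ok A W G T δ s := by
  refine ⟨fun t s' hs' => ?_, fun s' hs' => ?_, ?_⟩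
  · rw [Program.run_of_length_le h, PMF.support_pure, Set.mem_singleton_iff] at hs'
    exact hs' ▸ hs
  · rw [Program.run_of_length_le h, PMF.support_pure, Set.mem_singleton_iff] at hs'
    exact hs' ▸ h
  · rw [Program.run_of_length_le h, PMF.toOuterMeasure_pure_apply]
    rcases hG with hG | hG
    · simp [hG]
    · exact le_trans (by split_ifs <;> simp) hG

theorem Program.run_succ_of_haltsWithin {P : Program} (h : P.HaltsWithin s T) :
    P.run s (T + 1) = P.run s T := by
  change (P.run s T).bind P.step = _
  conv_rhs => rw [← PMF.bind_pure (P.run s T)]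
  ext x
  simp only [PMF.bind_apply]
  refine tsum_congr fun s' => ?_
  by_cases hs' : s' ∈ (P.run s T).support
  · rw [Program.step_of_length_le (h s' hs')]
  · rw [PMF.mem_support_iff, not_not] at hs'
    simp [hs']

/-- The error is measured at time exactly `T`; extra time is harmless because halted configurations
are fixed points. -/
theorem Ok.mono_time (h : Ok A W G T δ s) (hT : T ≤ T') : Ok A W G T' δ s := by
  induction hT with
  | refl => exact h
  | step _ ih =>
    have hr := Program.run_succ_of_haltsWithin ih.2.1
    refine ⟨ih.1, ?_, ?_⟩
    · unfold Program.HaltsWithin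
      rw [Nat.succ_eq_add_one, hr]
      exact ih.2.1
    · rw [Nat.succ_eq_add_one, hr]
      exact ih.2.2

theorem Ok.mono (h : Ok A W G T δ s) (hT : T ≤ T') (hδ : δ ≤ δ') : Ok A W G T' δ' s :=
  (h.mono_time hT).mono_error hδ

/-- The instructions `l` occupy the positions from `o` on in `A`. -/
def At (A : Program) (o : ℕ) (l : List Instr) : Prop :=
  ∀ i < l.length, A[o + i]? = l[i]?

theorem at_append {o : ℕ} {l₁ l₂ : List Instr} :
    At A o (l₁ ++ l₂) ↔ At A o l₁ ∧ At A (o + l₁.length) l₂ := by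
  constructor
  · intro h
    refine ⟨fun i hi => ?_, fun i hi => ?_⟩
    · rw [h i (by simp; omega), List.getElem?_append_left hi]
    · rw [Nat.add_assoc, h _ (by simp; omega), List.getElem?_append_right (by omega)]
      simp
  · rintro ⟨h₁, h₂⟩ i hi
    rw [List.length_append] at hi
    rcases lt_or_ge i l₁.length with h | h
    · rw [h₁ i h, List.getElem?_append_left h]
    · rw [List.getElem?_append_right h, ← h₂ _ (by omega)]
      congr 1
      omega

theorem at_cons {o : ℕ} {i : Instr} {l : List Instr} :
    At A o (i :: l) ↔ A[o]? = some i ∧ At A (o + 1) l := by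
  rw [← List.singleton_append, at_append]
  refine and_congr ?_ (by simp)
  simp [At]

end ACZkC

namespace ACZkC

/-! ### A small structured language -/

/-- The arithmetic operations of expressions. -/
inductive Arith
  | add | sub | mul | div | mod

/-- The corresponding machine operation. -/
def Arith.toOp : Arith → WordOp
  | add => .add
  | sub => .sub
  | mul => .mul
  | div => .div
  | mod => .mod

/-- Expressions over registers and memory. -/
inductive Expr
  | lit (c : ℕ)
  | var (r : ℕ)
  | bin (o : Arith) (a b : Expr)
  | load (a : Expr)

/-- The data a program works on. -/
structure State where
  reg : ℕ → ℕ
  mem : ℕ → ℕ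

/-- Write `x` into register `d`. -/
def State.set (σ : State) (d x : ℕ) : State := ⟨Function.update σ.reg d x, σ.mem⟩

/-- Write `x` into memory cell `a`. -/
def State.put (σ : State) (a x : ℕ) : State := ⟨σ.reg, Function.update σ.mem a x⟩

@[simp] theorem State.set_mem (σ : State) (d x : ℕ) : (σ.set d x).mem = σ.mem := rfl

@[simp] theorem State.put_reg (σ : State) (a x : ℕ) : (σ.put a x).reg = σ.reg := rfl

theorem State.set_reg (σ : State) (d x r : ℕ) :
    (σ.set d x).reg r = if r = d then x else σ.reg r := by
  simp [State.set, Function.update_apply]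

theorem State.put_mem (σ : State) (d x r : ℕ) :
    (σ.put d x).mem r = if r = d then x else σ.mem r := by
  simp [State.put, Function.update_apply]

namespace Expr

instance : Add Expr := ⟨bin .add⟩
instance : Sub Expr := ⟨bin .sub⟩
instance : Mul Expr := ⟨bin .mul⟩
instance : Div Expr := ⟨bin .div⟩
instance : Mod Expr := ⟨bin .mod⟩

/-- The value of an expression. -/
def eval (σ : State) : Expr → ℕ
  | lit c => c
  | var r => σ.reg r
  | bin o a b => o.toOp.eval (a.eval σ) (b.eval σ)
  | load a => σ.mem (a.eval σ)

@[simp] theorem eval_lit (σ : State) (c : ℕ) : (lit c).eval σ = c := rfl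
@[simp] theorem eval_var (σ : State) (r : ℕ) : (var r).eval σ = σ.reg r := rfl
@[simp] theorem eval_load (σ : State) (a : Expr) : (load a).eval σ = σ.mem (a.eval σ) := rfl
@[simp] theorem eval_add (σ : State) (a b : Expr) :
    (a + b).eval σ = a.eval σ + b.eval σ := rfl
@[simp] theorem eval_sub (σ : State) (a b : Expr) :
    (a - b).eval σ = a.eval σ - b.eval σ := rfl
@[simp] theorem eval_mul (σ : State) (a b : Expr) :
    (a * b).eval σ = a.eval σ * b.eval σ := rfl
@[simp] theorem eval_div (σ : State) (a b : Expr) :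
    (a / b).eval σ = a.eval σ / b.eval σ := rfl
@[simp] theorem eval_mod (σ : State) (a b : Expr) :
    (a % b).eval σ = a.eval σ % b.eval σ := rfl

/-- Code that evaluates an expression into register `d`, using the registers from `d` on. -/
def code : Expr → ℕ → List Instr
  | lit c, d => [.const d c]
  -- There is no move instruction; bitwise `or` of a register with itself copies it.
  | var r, d => [.op .or d r r]
  | bin o a b, d => a.code d ++ (b.code (d + 1) ++ [.op o.toOp d d (d + 1)])
  | load a, d => a.code d ++ [.load d d]

/-- The number of instructions. -/
def cost : Expr → ℕ
  | lit _ => 1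
  | var _ => 1
  | bin _ a b => a.cost + (b.cost + 1)
  | load a => a.cost + 1

theorem length_code (e : Expr) (d : ℕ) : (e.code d).length = e.cost := by
  induction e generalizing d with
  | lit => rfl
  | var => rfl
  | bin o a b iha ihb => simp [code, cost, iha, ihb]
  | load a ih => simp [code, cost, ih]

/-- All registers in the expression are below this number. -/
def bound : Expr → ℕ
  | lit _ => 0
  | var r => r + 1
  | bin _ a b => max a.bound b.bound
  | load a => a.bound

/-- All constants in the expression are below this number. -/
def lits : Expr → ℕ
  | lit c => c + 1
  | var _ => 0
  | bin _ a b => max a.lits b.lits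
  | load a => a.lits

/-- The nesting depth of the operations. -/
def depth : Expr → ℕ
  | lit _ => 0
  | var _ => 0
  | bin _ a b => max a.depth b.depth + 1
  | load a => a.depth

end Expr

/-- Commands. In `sim D v b S`, the program `D` is run on the registers from `v` on and on the
memory cells `b + a * S`. -/
inductive Cmd
  | skip
  | assign (x : ℕ) (e : Expr)
  | store (a e : Expr)
  | seq (c d : Cmd)
  | loop (i l : ℕ) (c : Cmd)
  | sim (D : Program) (v b S : ℕ)

/-- A strict bound for the registers in an instruction. -/
def Instr.regBound : Instr → ℕ
  | const d _ => d + 1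
  | op _ d a b => max (d + 1) (max (a + 1) (b + 1))
  | load d a => max (d + 1) (a + 1)
  | store a b => max (a + 1) (b + 1)
  | flip d => d + 1
  | jumpZero a _ => a + 1

/-- A strict bound for the registers in a program. -/
def Program.regBound (D : Program) : ℕ := (D.map Instr.regBound).foldr max 2

/-- The three instructions that simulate one instruction. -/
def Instr.simCode (len v b S tmp o : ℕ) : Instr → List Instr
  -- Shorter translations are padded to three instructions, so instruction number `j` of the
  -- simulated program starts at `o + 3 * j` and jump targets can be computed directly.
  | const d c => [.const tmp 0, .const tmp 0, .const (v + d) c]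
  | op p d a c => [.const tmp 0, .const tmp 0, .op p (v + d) (v + a) (v + c)]
  | load d a => [.op .mul tmp (v + a) S, .op .add tmp b tmp, .load (v + d) tmp]
  | store a c => [.op .mul tmp (v + a) S, .op .add tmp b tmp, .store tmp (v + c)]
  | flip d => [.const tmp 0, .const tmp 0, .flip (v + d)]
  -- A jump out of the simulated program means halting; `min` sends every such jump to the end of
  -- the block.
  | jumpZero a l => [.const tmp 0, .const tmp 0, .jumpZero (v + a) (o + 3 * min l len)]

/-- The code that simulates a program. -/
def Program.simCode (D : Program) (v b S tmp o : ℕ) : List Instr :=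
  D.flatMap (Instr.simCode D.length v b S tmp o)

namespace Cmd

/-- The code of a command placed at `o`, with temporary registers from `V` on. -/
def code (V : ℕ) : Cmd → ℕ → List Instr
  | skip, _ => []
  | assign x e, _ => e.code V ++ [.op .or x V V]
  | store a e, _ => a.code V ++ (e.code (V + 1) ++ [.store V (V + 1)])
  | seq c d, o => c.code V o ++ d.code V (o + (c.code V o).length)
  -- Truncated subtraction gives `l - i = 0` exactly when the loop is over. The final `jumpZero` on
  -- a register just set to `0` is an unconditional jump. Three instructions precede the body and
  -- four follow it, hence the offset `7`.
  | loop i l c, o =>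
    .const i 0 :: .op .sub V l i :: .jumpZero V (o + (c.code V (o + 3)).length + 7) ::
      (c.code V (o + 3) ++ [.const V 1, .op .add i i V, .const V 0, .jumpZero V (o + 1)])
  | sim D v b S, o => D.simCode v b S V o

/-- All registers in the command are below this number. -/
def bound : Cmd → ℕ
  | skip => 0
  | assign x e => max (x + 1) e.bound
  | store a e => max a.bound e.bound
  | seq c d => max c.bound d.bound
  | loop i l c => max (i + 1) (max (l + 1) c.bound)
  | sim D v b S => max (v + D.regBound) (max (b + 1) (S + 1))

/-- All constants in the command are below this number. -/
def lits : Cmd → ℕ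
  | skip => 0
  | assign _ e => e.lits
  | store a e => max a.lits e.lits
  | seq c d => max c.lits d.lits
  | loop _ _ c => c.lits
  | sim _ _ _ _ => 0

/-- The nesting depth of the operations. -/
def depth : Cmd → ℕ
  | skip => 0
  | assign _ e => e.depth
  | store a e => max a.depth e.depth
  | seq c d => max c.depth d.depth
  | loop _ _ c => max 1 c.depth
  | sim _ _ _ _ => 1

end Cmd

/-- The machine configuration `s` represents `σ`: registers below `V` agree, the others are
temporary; the represented values are below `B`, all others below `W`. -/
structure Rel (V B W : ℕ) (σ : State) (s : Config) : Prop where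
  reg : ∀ r < V, s.reg r = σ.reg r
  mem : s.mem = σ.mem
  reg_lt : ∀ r < V, σ.reg r < B
  temp_lt : ∀ r, s.reg r < W
  mem_lt : ∀ a, σ.mem a < B

variable {A : Program} {V B W T T' o d : ℕ} {G : Config → Prop} {δ δ' : ENNReal} {s s' : Config}
  {σ σ' : State} {e : Expr} {c c₁ c₂ : Cmd}

/-! ### Preservation of the representation of states -/

theorem Rel.below (h : Rel V B W σ s) (hBW : B ≤ W) : s.Below W :=
  fun a => ⟨h.temp_lt a, by rw [h.mem]; exact (h.mem_lt a).trans_le hBW⟩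

/-- Writing a temporary register. -/
theorem Rel.temp (h : Rel V B W σ s) (hd : V ≤ d) {x p : ℕ} (hx : x < W) :
    Rel V B W σ ⟨p, Function.update s.reg d x, s.mem⟩ where
  reg r hr := by
    rw [← h.reg r hr]
    exact Function.update_of_ne (by omega) _ _
  mem := h.mem
  reg_lt := h.reg_lt
  temp_lt r := by
    change Function.update s.reg d x r < W
    rw [Function.update_apply]
    split_ifs
    exacts [hx, h.temp_lt r]
  mem_lt := h.mem_lt

theorem Rel.jump (h : Rel V B W σ s) {p : ℕ} : Rel V B W σ ⟨p, s.reg, s.mem⟩ :=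
  ⟨h.reg, h.mem, h.reg_lt, h.temp_lt, h.mem_lt⟩

theorem Rel.set (h : Rel V B W σ s) (hBW : B ≤ W) {x p : ℕ} (hx : x < B) :
    Rel V B W (σ.set d x) ⟨p, Function.update s.reg d x, s.mem⟩ where
  reg r hr := by
    rw [State.set_reg]
    change Function.update s.reg d x r = _
    rw [Function.update_apply]
    split_ifs
    exacts [rfl, h.reg r hr]
  mem := h.mem
  reg_lt r hr := by
    rw [State.set_reg]
    split_ifs
    exacts [hx, h.reg_lt r hr]
  temp_lt r := by
    change Function.update s.reg d x r < W
    rw [Function.update_apply]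
    split_ifs
    exacts [hx.trans_le hBW, h.temp_lt r]
  mem_lt := h.mem_lt

theorem Rel.put (h : Rel V B W σ s) {a x p : ℕ} (hx : x < B) :
    Rel V B W (σ.put a x) ⟨p, s.reg, Function.update s.mem a x⟩ where
  reg := h.reg
  mem := by
    change Function.update s.mem a x = Function.update σ.mem a x
    rw [h.mem]
  reg_lt := h.reg_lt
  temp_lt := h.temp_lt
  mem_lt r := by
    rw [State.put_mem]
    split_ifs
    exacts [hx, h.mem_lt r]

/-! ### Correctness and word size of compiled expressions -/

theorem Arith.eval_lt {X x y : ℕ} (o : Arith) (hX : 2 ≤ X) (hx : x < X) (hy : y < X) :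
    o.toOp.eval x y < X ^ 2 := by
  have hXX : X * 2 ≤ X ^ 2 := by nlinarith
  cases o
  · change x + y < _
    omega
  · change x - y < _
    omega
  · change x * y < _
    rw [pow_two]
    exact Nat.mul_lt_mul'' hx hy
  · exact lt_of_le_of_lt (Nat.div_le_self x y) (by omega)
  · exact lt_of_le_of_lt (Nat.mod_le x y) (by omega)

/-- Every operation at most squares the bound, so depth `d` costs the exponent `2 ^ d`. For this
reason `Arith` contains no shifts. -/
theorem Expr.eval_lt (hB : 2 ≤ B) (hl : e.lits ≤ B) (hb : e.bound ≤ V)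
    (hr : ∀ r < V, σ.reg r < B) (hm : ∀ a, σ.mem a < B) : e.eval σ < B ^ 2 ^ e.depth := by
  induction e with
  | lit c => simpa [eval, depth, lits] using hl
  | var r => simpa [eval, depth] using hr r hb
  | load a ih =>
    exact (hm _).trans_le (Nat.le_self_pow (by positivity) B)
  | bin o a b iha ihb =>
    simp only [lits, bound, max_le_iff] at hl hb
    have h1 : 1 ≤ B := by omega
    have ha := (iha hl.1 hb.1).trans_le (pow_le_pow_right₀ h1
      (pow_le_pow_right₀ one_le_two (le_max_left a.depth b.depth)))
    have hb := (ihb hl.2 hb.2).trans_le (pow_le_pow_right₀ h1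
      (pow_le_pow_right₀ one_le_two (le_max_right a.depth b.depth)))
    have := Arith.eval_lt o (hB.trans (Nat.le_self_pow (by positivity) B)) ha hb
    rwa [← pow_mul, ← pow_succ] at this

/-- Stated with a continuation `h`, so that code can be chained without describing intermediate
configurations. That registers below `d` are kept protects the left operand, stored in `d`, while
the right one is computed from `d + 1` on. -/
theorem Expr.ok (hB : 2 ≤ B) (hl : e.lits ≤ B) (hb : e.bound ≤ V) (hW : B ^ 2 ^ e.depth ≤ W)
    (hd : V ≤ d) (hA : At A o (e.code d)) (hs : Rel V B W σ s) (ho : s.pc = o)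
    (h : ∀ s', s'.pc = o + e.cost → Rel V B W σ s' → s'.reg d = e.eval σ →
      (∀ r < d, s'.reg r = s.reg r) → Ok A W G T δ s') :
    Ok A W G (T + e.cost) δ s := by
  have hBW : B ≤ W := (Nat.le_self_pow (by positivity) B).trans hW
  induction e generalizing s o d T with
  | lit c =>
    have hlt := (eval_lt hB hl hb hs.reg_lt hs.mem_lt).trans_le hW
    obtain ⟨hA, -⟩ := at_cons.1 hA
    subst ho
    refine Ok.det hA rfl (hs.below hBW) (h _ rfl (hs.temp hd hlt) ?_ ?_)
    · exact Function.update_self _ _ _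
    · intro r hr
      exact Function.update_of_ne (by omega) _ _
  | var r =>
    have hlt := (eval_lt hB hl hb hs.reg_lt hs.mem_lt).trans_le hW
    obtain ⟨hA, -⟩ := at_cons.1 hA
    subst ho
    have hr : s.reg r ||| s.reg r = σ.reg r := by rw [Nat.or_self, hs.reg r hb]
    refine Ok.det hA rfl (hs.below hBW) (h _ rfl (hs.temp hd ?_) ?_ ?_)
    · exact hr.trans_lt hlt
    · exact (Function.update_self _ _ _).trans hr
    · intro r hr
      exact Function.update_of_ne (by omega) _ _
  | load a ih =>
    have hlt := (eval_lt hB hl hb hs.reg_lt hs.mem_lt).trans_le hW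
    obtain ⟨hA, hA'⟩ := at_append.1 hA
    obtain ⟨hA', -⟩ := at_cons.1 hA'
    rw [length_code] at hA'
    rw [cost, Nat.add_comm a.cost, ← Nat.add_assoc]
    refine ih hl hb hW hd hA hs ho fun s₁ hp h₁ hv hf => ?_
    rw [← hp] at hA'
    have hv' : s₁.mem (s₁.reg d) = (Expr.load a).eval σ := by rw [hv, h₁.mem]; rfl
    refine Ok.det hA' rfl (h₁.below hBW) (h _ ?_ (h₁.temp hd ?_) ?_ ?_)
    · change s₁.pc + 1 = _
      rw [hp, cost, Nat.add_assoc]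
    · exact hv'.trans_lt hlt
    · exact (Function.update_self _ _ _).trans hv'
    · intro r hr
      rw [← hf r hr]
      exact Function.update_of_ne (by omega) _ _
  | bin p a b iha ihb =>
    have hlt := (eval_lt hB hl hb hs.reg_lt hs.mem_lt).trans_le hW
    obtain ⟨hA, hA'⟩ := at_append.1 hA
    obtain ⟨hA', hA''⟩ := at_append.1 hA'
    obtain ⟨hA'', -⟩ := at_cons.1 hA''
    rw [length_code] at hA' hA''
    rw [length_code] at hA''
    simp only [lits, bound, max_le_iff] at hl hb
    have h1 : 1 ≤ B := by omega
    have hWa : B ^ 2 ^ a.depth ≤ W := (pow_le_pow_right₀ h1 (pow_le_pow_right₀ one_le_two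
      ((le_max_left a.depth b.depth).trans (Nat.le_succ _)))).trans hW
    have hWb : B ^ 2 ^ b.depth ≤ W := (pow_le_pow_right₀ h1 (pow_le_pow_right₀ one_le_two
      ((le_max_right a.depth b.depth).trans (Nat.le_succ _)))).trans hW
    rw [cost, show T + (a.cost + (b.cost + 1)) = T + 1 + b.cost + a.cost by omega]
    refine iha hl.1 hb.1 hWa hd hA hs ho fun s₁ hp h₁ hv hf => ?_
    refine ihb hl.2 hb.2 hWb (by omega) hA' h₁ hp fun s₂ hp₂ h₂ hv₂ hf₂ => ?_
    rw [← hp₂] at hA''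
    have hv' : p.toOp.eval (s₂.reg d) (s₂.reg (d + 1)) = (bin p a b).eval σ := by
      rw [hv₂, hf₂ d (by omega), hv]; rfl
    refine Ok.det hA'' rfl (h₂.below hBW) (h _ ?_ (h₂.temp hd ?_) ?_ ?_)
    · change s₂.pc + 1 = _
      rw [hp₂, cost]
      omega
    · exact hv'.trans_lt hlt
    · exact (Function.update_self _ _ _).trans hv'
    · intro r hr
      rw [← hf r hr, ← hf₂ r (by omega)]
      exact Function.update_of_ne (by omega) _ _

/-- Started in a representation of `σ` with time budget `T` and error budget `δ`, the command ends
in representations of states that satisfy `K` with the remaining budgets. The values of variables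
and of memory cells stay below `B`. Registers below `40` are never temporary. -/
def Run (B : ℕ) (c : Cmd) (σ : State) (T : ℕ) (δ : ENNReal)
    (K : State → ℕ → ENNReal → Prop) : Prop :=
  ∀ (V W : ℕ) (A : Program) (o : ℕ) (G : Config → Prop), 2 ≤ B ∧ 40 ≤ V → c.bound ≤ V → c.lits ≤ B →
    B ^ 2 ^ c.depth ≤ W → At A o (c.code V o) →
    (∀ σ' T' δ', K σ' T' δ' → ∀ s', s'.pc = o + (c.code V o).length → Rel V B W σ' s' →
      Ok A W G T' δ' s') →
    ∀ s, s.pc = o → Rel V B W σ s → Ok A W G T δ s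

variable {K K' : State → ℕ → ENNReal → Prop}

/-! ### Proof rules for commands -/

theorem Run.weaken (h : Run B c σ T δ K) (hK : ∀ σ' T' δ', K σ' T' δ' → K' σ' T' δ') :
    Run B c σ T δ K' := fun V W A o G h2 hb hl hW hA hok =>
  h V W A o G h2 hb hl hW hA fun σ' T' δ' hk => hok σ' T' δ' (hK _ _ _ hk)

theorem Run.mono (h : Run B c σ T δ K) (hT : T ≤ T') (hδ : δ ≤ δ') : Run B c σ T' δ' K :=
  fun V W A o G h2 hb hl hW hA hok s ho hs =>
    (h V W A o G h2 hb hl hW hA hok s ho hs).mono hT hδ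

/-- It may be assumed that the values of variables and memory cells are small initially. -/
theorem Run.of_lt (h : 2 ≤ B → (∀ r < 40, σ.reg r < B) → (∀ a, σ.mem a < B) → Run B c σ T δ K) :
    Run B c σ T δ K := fun V W A o G h2 hb hl hW hA hok s ho hs =>
  h h2.1 (fun r hr => hs.reg_lt r (hr.trans_le h2.2)) hs.mem_lt V W A o G h2 hb hl hW hA hok s ho hs

theorem Run.skip (h : K σ T δ) : Run B .skip σ T δ K := by
  intro V W A o G h2 hb hl hW hA hok s ho hs
  exact hok σ T δ h s ho hs

theorem Run.assign {x : ℕ} (he : e.eval σ < B) (h : K (σ.set x (e.eval σ)) T δ) :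
    Run B (.assign x e) σ (T + (e.cost + 1)) δ K := by
  intro V W A o G h2 hb hl hW hA hok s ho hs
  simp only [Cmd.bound, Cmd.lits, Cmd.depth, max_le_iff] at hb hl hW
  have hBW : B ≤ W := (Nat.le_self_pow (by positivity) B).trans hW
  obtain ⟨hA, hA'⟩ := at_append.1 hA
  obtain ⟨hA', -⟩ := at_cons.1 hA'
  rw [Expr.length_code] at hA'
  rw [Nat.add_comm e.cost, ← Nat.add_assoc]
  refine Expr.ok h2.1 hl hb.2 hW le_rfl hA hs ho fun s₁ hp h₁ hv _ => ?_
  rw [← hp] at hA'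
  refine Ok.det hA' rfl (h₁.below hBW) (hok _ _ _ h _ ?_ ?_)
  · change s₁.pc + 1 = _
    simp only [Cmd.code, List.length_append, List.length_singleton, Expr.length_code]
    omega
  · have hor : WordOp.or.eval (s₁.reg V) (s₁.reg V) = e.eval σ := (Nat.or_self _).trans hv
    change Rel V B W _ ⟨_, Function.update s₁.reg x (WordOp.or.eval (s₁.reg V) (s₁.reg V)), _⟩
    rw [hor]
    exact h₁.set hBW he

theorem Run.store {a : Expr} (he : e.eval σ < B) (h : K (σ.put (a.eval σ) (e.eval σ)) T δ) :
    Run B (.store a e) σ (T + (a.cost + e.cost + 1)) δ K := by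
  intro V W A o G h2 hb hl hW hA hok s ho hs
  simp only [Cmd.bound, Cmd.lits, Cmd.depth, max_le_iff] at hb hl hW
  have h1 : 1 ≤ B := by omega
  have hWa := (pow_le_pow_right₀ h1 (pow_le_pow_right₀ one_le_two
      (le_max_left a.depth e.depth))).trans hW
  have hWe := (pow_le_pow_right₀ h1 (pow_le_pow_right₀ one_le_two
      (le_max_right a.depth e.depth))).trans hW
  have hBW : B ≤ W := (Nat.le_self_pow (by positivity) B).trans hW
  obtain ⟨hA, hA'⟩ := at_append.1 hA
  obtain ⟨hA', hA''⟩ := at_append.1 hA'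
  obtain ⟨hA'', -⟩ := at_cons.1 hA''
  rw [Expr.length_code] at hA' hA''
  rw [Expr.length_code] at hA''
  rw [show T + (a.cost + e.cost + 1) = T + 1 + e.cost + a.cost by omega]
  refine Expr.ok h2.1 hl.1 hb.1 hWa le_rfl hA hs ho fun s₁ hp h₁ hv _ => ?_
  refine Expr.ok h2.1 hl.2 hb.2 hWe (Nat.le_succ V) hA' h₁ hp fun s₂ hp₂ h₂ hv₂ hf => ?_
  rw [← hp₂] at hA''
  refine Ok.det hA'' rfl (h₂.below hBW) (hok _ _ _ h _ ?_ ?_)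
  · change s₂.pc + 1 = _
    simp only [Cmd.code, List.length_append, List.length_singleton, Expr.length_code]
    omega
  · rw [hv₂, hf V (Nat.lt_succ_self V), hv]
    exact h₂.put he

theorem Run.seq {K₁ : State → ℕ → ENNReal → Prop} (h₁ : Run B c₁ σ T δ K₁)
    (h₂ : ∀ σ' T' δ', K₁ σ' T' δ' → Run B c₂ σ' T' δ' K) : Run B (.seq c₁ c₂) σ T δ K := by
  intro V W A o G h2 hb hl hW hA hok s ho hs
  simp only [Cmd.bound, Cmd.lits, Cmd.depth, max_le_iff] at hb hl hW
  have h1 : 1 ≤ B := by omega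
  have hW₁ := (pow_le_pow_right₀ h1 (pow_le_pow_right₀ one_le_two
      (le_max_left c₁.depth c₂.depth))).trans hW
  have hW₂ := (pow_le_pow_right₀ h1 (pow_le_pow_right₀ one_le_two
      (le_max_right c₁.depth c₂.depth))).trans hW
  obtain ⟨hA₁, hA₂⟩ := at_append.1 hA
  refine h₁ V W A o G h2 hb.1 hl.1 hW₁ hA₁ (fun σ₁ T₁ δ₁ hk s₁ hp hs₁ => ?_) s ho hs
  refine h₂ σ₁ T₁ δ₁ hk V W A _ G h2 hb.2 hl.2 hW₂ hA₂ (fun σ₂ T₂ δ₂ hk₂ s₂ hp₂ hs₂ => ?_) s₁ hp hs₁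
  refine hok σ₂ T₂ δ₂ hk₂ s₂ ?_ hs₂
  rw [hp₂]
  simp [Cmd.code, Nat.add_assoc]

theorem Ok.jump_zero {a l : ℕ} (hi : A[s.pc]? = some (.jumpZero a l)) (h0 : s.reg a = 0)
    (hs : s.Below W) (h : Ok A W G T δ ⟨l, s.reg, s.mem⟩) : Ok A W G (T + 1) δ s :=
  Ok.det hi (by simp [Instr.exec, h0]) hs h

theorem Ok.jump_pos {a l : ℕ} (hi : A[s.pc]? = some (.jumpZero a l)) (h0 : s.reg a ≠ 0)
    (hs : s.Below W) (h : Ok A W G T δ ⟨s.pc + 1, s.reg, s.mem⟩) : Ok A W G (T + 1) δ s :=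
  Ok.det hi (by simp [Instr.exec, h0]) hs h

/-- The invariant `I j` holds before iteration number `j`. -/
theorem Run.loop {i l N : ℕ} (I : ℕ → State → ℕ → ENNReal → Prop) (hN : σ.reg l = N)
    (h0 : N < B → I 0 (σ.set i 0) T δ)
    (hil : ∀ j σ' T' δ', I j σ' T' δ' → σ'.reg i = j ∧ σ'.reg l = N)
    (hbody : ∀ j < N, N < B → ∀ σ' T' δ', I j σ' T' δ' → ∃ T₁, T' = T₁ + 2 ∧
      Run B c σ' T₁ δ' fun σ'' T'' δ'' =>
        ∃ T₂, T'' = T₂ + 4 ∧ σ''.reg i = j ∧ I (j + 1) (σ''.set i (j + 1)) T₂ δ'')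
    (hend : ∀ σ' T' δ', I N σ' T' δ' → ∃ T₁, T' = T₁ + 2 ∧ K σ' T₁ δ') :
    Run B (.loop i l c) σ (T + 1) δ K := by
  intro V W A o G h2 hb hl hW hA hok s ho hs
  simp only [Cmd.bound, Cmd.lits, Cmd.depth, max_le_iff] at hb hl hW
  have h1 : 1 ≤ B := by omega
  have hWc := (pow_le_pow_right₀ h1 (pow_le_pow_right₀ one_le_two
      (le_max_right 1 c.depth))).trans hW
  have hBW : B ≤ W := (Nat.le_self_pow (by positivity) B).trans hW
  have hNB : N < B := hN ▸ hs.reg_lt l hb.2.1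
  have hlen : ((Cmd.loop i l c).code V o).length = (c.code V (o + 3)).length + 7 := by
    simp [Cmd.code]
  rw [hlen] at hok
  obtain ⟨a0, hA⟩ := at_cons.1 hA
  obtain ⟨a1, hA⟩ := at_cons.1 hA
  obtain ⟨a2, hA⟩ := at_cons.1 hA
  obtain ⟨ac, hA⟩ := at_append.1 hA
  obtain ⟨a3, hA⟩ := at_cons.1 hA
  obtain ⟨a4, hA⟩ := at_cons.1 hA
  obtain ⟨a5, hA⟩ := at_cons.1 hA
  obtain ⟨a6, -⟩ := at_cons.1 hA
  -- Induction on the number `m` of iterations that remain. Around the body, an iteration spends two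
  -- steps on the test and four on the increment and the jump back.
  have htop : ∀ m j, m + j = N → ∀ σ' T' δ', I j σ' T' δ' → ∀ s', s'.pc = o + 1 →
      Rel V B W σ' s' → Ok A W G T' δ' s' := by
    intro m
    induction m with
    | zero =>
      intro j hj σ' T' δ' hI s' hp hs'
      obtain rfl : j = N := by omega
      obtain ⟨hi, hL⟩ := hil _ _ _ _ hI
      obtain ⟨T₁, rfl, hk⟩ := hend _ _ _ hI
      have hsub : s'.reg l - s'.reg i = 0 := by
        rw [hs'.reg l (by omega), hs'.reg i (by omega)]
        omega
      have hs₁ : Rel V B W σ' (s'.setReg V (s'.reg l - s'.reg i)) :=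
        hs'.temp le_rfl (by omega)
      refine Ok.det (T := T₁ + 1) (hp ▸ a1) rfl (hs'.below hBW) ?_
      refine Ok.jump_zero ?_ ((Function.update_self _ _ _).trans hsub) (hs₁.below hBW)
        (hok _ _ _ hk _ rfl hs₁.jump)
      exact (congrArg (fun p => A[p + 1]?) hp).trans a2
    | succ m ih =>
      intro j hj σ' T' δ' hI s' hp hs'
      obtain ⟨hi, hL⟩ := hil _ _ _ _ hI
      obtain ⟨T₁, rfl, hrun⟩ := hbody j (by omega) hNB _ _ _ hI
      have hsub : s'.reg l - s'.reg i ≠ 0 := by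
        rw [hs'.reg l (by omega), hs'.reg i (by omega)]
        omega
      have hs₁ : Rel V B W σ' (s'.setReg V (s'.reg l - s'.reg i)) :=
        hs'.temp le_rfl (lt_of_le_of_lt (Nat.sub_le _ _) (hs'.temp_lt l))
      refine Ok.det (T := T₁ + 1) (hp ▸ a1) rfl (hs'.below hBW) ?_
      refine Ok.jump_pos ((congrArg (fun p => A[p + 1]?) hp).trans a2)
        (by rw [show (s'.setReg V _).reg V = _ from Function.update_self _ _ _]; exact hsub)
        (hs₁.below hBW) ?_
      refine hrun V W A (o + 3) G h2 hb.2.2 hl hWc ac ?_ _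
        (congrArg (fun p => p + 1 + 1) hp) hs₁.jump
      rintro σ₂ T₂' δ₂ ⟨T₂, rfl, hi₂, hI₂⟩ s₂ hp₂ hs₂
      have e1 : Rel V B W σ₂ (s₂.setReg V 1) := hs₂.temp le_rfl (by omega)
      refine Ok.det (T := T₂ + 3) (hp₂ ▸ a3) rfl (hs₂.below hBW) ?_
      have hadd : (s₂.setReg V 1).reg i + (s₂.setReg V 1).reg V = j + 1 := by
        rw [show (s₂.setReg V 1).reg V = _ from Function.update_self _ _ _, e1.reg i (by omega), hi₂]
      have e2 : Rel V B W (σ₂.set i (j + 1)) ((s₂.setReg V 1).setReg i (j + 1)) :=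
        e1.set hBW (by omega)
      refine Ok.det (T := T₂ + 2) (s' := (s₂.setReg V 1).setReg i (j + 1))
        ((congrArg (fun p => A[p + 1]?) hp₂).trans a4) ?_ (e1.below hBW) ?_
      · rw [← hadd]
        rfl
      have e3 := e2.temp (p := ((s₂.setReg V 1).setReg i (j + 1)).pc + 1) le_rfl
        (show 0 < W by omega)
      refine Ok.det (T := T₂ + 1) (i := .const V 0)
        ((congrArg (fun p => A[p + 1 + 1]?) hp₂).trans a5) rfl (e2.below hBW) ?_
      refine Ok.jump_zero ((congrArg (fun p => A[p + 1 + 1 + 1]?) hp₂).trans a6)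
        (Function.update_self _ _ _) (e3.below hBW) ?_
      exact ih (j + 1) (by omega) _ _ _ hI₂ _ rfl e3.jump
  refine Ok.det (T := T) (ho ▸ a0) rfl (hs.below hBW) ?_
  exact htop N 0 (by omega) _ _ _ (h0 hNB) _ (congrArg (· + 1) ho) (hs.set hBW (by omega))

/-! ### Deterministic commands -/

/-- From `σ`, the command needs exactly `τ` units of time and ends in a state that satisfies
`Q`. -/
def HT (B : ℕ) (c : Cmd) (σ : State) (τ : ℕ) (Q : State → Prop) : Prop :=
  ∀ T δ, Run B c σ (T + τ) δ fun σ' T' δ' => Q σ' ∧ T' = T ∧ δ' = δ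

variable {τ τ' τ₁ τ₂ : ℕ} {Q Q' : State → Prop}

theorem HT.weaken (h : HT B c σ τ Q) (hQ : ∀ σ', Q σ' → Q' σ') : HT B c σ τ Q' :=
  fun T δ => (h T δ).weaken fun _ _ _ ⟨h1, h2⟩ => ⟨hQ _ h1, h2⟩

theorem HT.mono (h : HT B c σ τ Q) (hT : τ ≤ τ') : HT B c σ τ' Q :=
  fun T δ => (h T δ).mono (by omega) le_rfl

theorem HT.of_lt (h : 2 ≤ B → (∀ r < 40, σ.reg r < B) → (∀ a, σ.mem a < B) → HT B c σ τ Q) :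
    HT B c σ τ Q := fun T δ => Run.of_lt fun h0 h1 h2 => h h0 h1 h2 T δ

theorem HT.skip (h : Q σ) : HT B .skip σ 0 Q := fun _ _ => Run.skip ⟨h, rfl, rfl⟩

theorem HT.assign {x : ℕ} (he : e.eval σ < B) (h : Q (σ.set x (e.eval σ))) :
    HT B (.assign x e) σ (e.cost + 1) Q :=
  fun _ _ => Run.assign he ⟨h, rfl, rfl⟩

theorem HT.store {a : Expr} (he : e.eval σ < B) (h : Q (σ.put (a.eval σ) (e.eval σ))) :
    HT B (.store a e) σ (a.cost + e.cost + 1) Q :=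
  fun _ _ => Run.store he ⟨h, rfl, rfl⟩

theorem HT.seq {Q₁ : State → Prop} (h₁ : HT B c₁ σ τ₁ Q₁)
    (h₂ : ∀ σ', Q₁ σ' → HT B c₂ σ' τ₂ Q) : HT B (.seq c₁ c₂) σ (τ₁ + τ₂) Q := by
  intro T δ
  rw [Nat.add_comm τ₁, ← Nat.add_assoc]
  refine Run.seq (h₁ (T + τ₂) δ) ?_
  rintro σ' T' δ' ⟨hQ, rfl, rfl⟩
  exact h₂ σ' hQ T δ'

/-- Six steps of overhead per iteration; the last three are the initialisation and the final test.
-/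
theorem HT.loop {i l N : ℕ} (I : ℕ → State → Prop) (hN : σ.reg l = N)
    (h0 : N < B → I 0 (σ.set i 0))
    (hil : ∀ j σ', I j σ' → σ'.reg i = j ∧ σ'.reg l = N)
    (hbody : ∀ j < N, N < B → ∀ σ', I j σ' →
      HT B c σ' τ fun σ'' => σ''.reg i = j ∧ I (j + 1) (σ''.set i (j + 1)))
    (hend : ∀ σ', I N σ' → Q σ') :
    HT B (.loop i l c) σ (N * (τ + 6) + 3) Q := by
  intro T δ
  refine Run.loop (T := T + N * (τ + 6) + 2)
    (fun j σ' T' δ' => I j σ' ∧ j ≤ N ∧ T' = T + (N - j) * (τ + 6) + 2 ∧ δ' = δ) hN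
    (fun h => ⟨h0 h, Nat.zero_le _, rfl, rfl⟩) (fun j σ' T' δ' h => hil j σ' h.1) ?_ ?_
  · rintro j hj hNB σ' T' δ' ⟨hI, -, rfl, rfl⟩
    refine ⟨_, rfl, ?_⟩
    obtain ⟨m, rfl⟩ : ∃ m, N = j + 1 + m := ⟨N - (j + 1), by omega⟩
    rw [show T + (j + 1 + m - j) * (τ + 6) = (T + m * (τ + 6) + 6) + τ by
      rw [show j + 1 + m - j = m + 1 by omega]; ring]
    refine (hbody j hj hNB σ' hI _ δ').weaken ?_
    rintro σ'' T'' δ'' ⟨⟨h1, h2⟩, rfl, rfl⟩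
    exact ⟨_, rfl, h1, h2, by omega, by rw [show j + 1 + m - (j + 1) = m by omega], rfl⟩
  · rintro σ' T' δ' ⟨hI, -, rfl, rfl⟩
    exact ⟨_, rfl, hend σ' hI, by simp, rfl⟩

/-- The time for a single execution of every part of a command. -/
def Cmd.size : Cmd → ℕ
  | skip => 0
  | assign _ e => e.cost + 1
  | store a e => a.cost + e.cost + 1
  | seq c d => c.size + d.size
  -- The `9 = 6 + 3` covers the overhead of a loop, since the test and the initialisation are
  -- executed at most `N * X + 1` times when `1 ≤ X`.
  | loop _ _ c => c.size + 9
  | sim _ _ _ _ => 0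

/-- From `σ`, the command ends in a state that satisfies `Q`, and every part of it is executed at
most `X` times. -/
def HX (B : ℕ) (c : Cmd) (σ : State) (X : ℕ) (Q : State → Prop) : Prop := HT B c σ (c.size * X) Q

variable {X X' : ℕ}

theorem HX.weaken (h : HX B c σ X Q) (hQ : ∀ σ', Q σ' → Q' σ') : HX B c σ X Q' := HT.weaken h hQ

theorem HX.mono (h : HX B c σ X Q) (hX : X ≤ X') : HX B c σ X' Q :=
  HT.mono h (Nat.mul_le_mul_left _ hX)

theorem HX.of_lt (h : 2 ≤ B → (∀ r < 40, σ.reg r < B) → (∀ a, σ.mem a < B) → HX B c σ X Q) :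
    HX B c σ X Q := HT.of_lt h

theorem HX.skip (h : Q σ) : HX B .skip σ X Q := (HT.skip h).mono (Nat.zero_le _)

theorem HX.assign {x : ℕ} (hX : 1 ≤ X) (he : e.eval σ < B) (h : Q (σ.set x (e.eval σ))) :
    HX B (.assign x e) σ X Q := (HT.assign he h).mono (Nat.le_mul_of_pos_right _ hX)

theorem HX.store {a : Expr} (hX : 1 ≤ X) (he : e.eval σ < B)
    (h : Q (σ.put (a.eval σ) (e.eval σ))) : HX B (.store a e) σ X Q :=
  (HT.store he h).mono (Nat.le_mul_of_pos_right _ hX)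

theorem HX.seq {Q₁ : State → Prop} (h₁ : HX B c₁ σ X Q₁) (h₂ : ∀ σ', Q₁ σ' → HX B c₂ σ' X Q) :
    HX B (.seq c₁ c₂) σ X Q := by
  unfold HX
  rw [Cmd.size, Nat.add_mul]
  exact HT.seq h₁ h₂

theorem HX.assign_seq {x : ℕ} (hX : 1 ≤ X) (he : e.eval σ < B)
    (h : HX B c (σ.set x (e.eval σ)) X Q) : HX B (.seq (.assign x e) c) σ X Q :=
  HX.seq (HX.assign (Q := fun σ' => σ' = σ.set x (e.eval σ)) hX he rfl) fun _ h' => h' ▸ h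

theorem HX.loop {i l N : ℕ} (I : ℕ → State → Prop) (hX : 1 ≤ X) (hN : σ.reg l = N)
    (h0 : N < B → I 0 (σ.set i 0))
    (hil : ∀ j σ', I j σ' → σ'.reg i = j ∧ σ'.reg l = N)
    (hbody : ∀ j < N, N < B → ∀ σ', I j σ' →
      HX B c σ' X fun σ'' => σ''.reg i = j ∧ I (j + 1) (σ''.set i (j + 1)))
    (hend : ∀ σ', I N σ' → Q σ') :
    HX B (.loop i l c) σ (N * X + 1) Q := by
  refine (HT.loop I hN h0 hil hbody hend).mono ?_
  rw [Cmd.size]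
  nlinarith [Nat.mul_le_mul_left N hX]

end ACZkC

namespace ACZkC

/-! ### Expectations -/

/-- The expectation of a nonnegative function. -/
noncomputable def expect {α : Type*} (p : PMF α) (φ : α → ENNReal) : ENNReal := ∑' x, p x * φ x

theorem expect_pure {α : Type*} (x : α) (φ : α → ENNReal) : expect (PMF.pure x) φ = φ x := by
  unfold expect
  rw [tsum_eq_single x]
  · simp
  · intro y hy
    simp [PMF.pure_apply, hy]

theorem expect_bind {α β : Type*} (p : PMF α) (f : α → PMF β) (φ : β → ENNReal) :
    expect (p.bind f) φ = expect p fun x => expect (f x) φ := by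
  simp only [expect, PMF.bind_apply, ← ENNReal.tsum_mul_right, ← ENNReal.tsum_mul_left]
  rw [ENNReal.tsum_comm]
  simp only [mul_assoc]

theorem expect_map {α β : Type*} (p : PMF α) (f : α → β) (φ : β → ENNReal) :
    expect (p.map f) φ = expect p fun x => φ (f x) := by
  rw [PMF.map, expect_bind]
  simp only [Function.comp_apply, expect_pure]

theorem expect_mono {α : Type*} (p : PMF α) {φ ψ : α → ENNReal} (h : ∀ x, φ x ≤ ψ x) :
    expect p φ ≤ expect p ψ :=
  ENNReal.tsum_le_tsum fun x => by gcongr; exact h x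

/-! ### Simulation of a program inside another one -/

variable {A D : Program} {V B W T T' t o v b S base stride : ℕ} {G : Config → Prop}
  {δ δ' : ENNReal} {s s' : Config} {σ₀ σ σ' : State} {d d' : Config}

/-- `σ` holds the data of `d` and agrees with `σ₀` outside. -/
structure SimRel (D : Program) (v base stride : ℕ) (σ₀ : State) (d : Config) (σ : State) :
    Prop where
  reg : ∀ r < D.regBound, σ.reg (v + r) = d.reg r
  mem : ∀ a, σ.mem (base + a * stride) = d.mem a
  frame_reg : ∀ r < v, σ.reg r = σ₀.reg r
  frame_mem : ∀ x, (∀ a, x ≠ base + a * stride) → σ.mem x = σ₀.mem x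

theorem SimRel.setReg (h : SimRel D v base stride σ₀ d σ) (r x : ℕ) :
    SimRel D v base stride σ₀ (d.setReg r x) (σ.set (v + r) x) where
  reg y hy := by
    rw [State.set_reg]
    change _ = Function.update d.reg r x y
    rw [Function.update_apply]
    by_cases hyr : y = r
    · simp [hyr]
    · rw [if_neg (by omega), if_neg hyr, h.reg y hy]
  mem := h.mem
  frame_reg y hy := by
    rw [State.set_reg, if_neg (by omega), h.frame_reg y hy]
  frame_mem := h.frame_mem

theorem SimRel.setMem (hS : 0 < stride) (h : SimRel D v base stride σ₀ d σ) (p a x : ℕ) :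
    SimRel D v base stride σ₀ ⟨p, d.reg, Function.update d.mem a x⟩
      (σ.put (base + a * stride) x) where
  reg := h.reg
  mem y := by
    rw [State.put_mem]
    change _ = Function.update d.mem a x y
    rw [Function.update_apply]
    by_cases hya : y = a
    · simp [hya]
    · have : y * stride ≠ a * stride := fun h => hya (Nat.eq_of_mul_eq_mul_right hS h)
      rw [if_neg (by omega), if_neg hya, h.mem]
  frame_reg := h.frame_reg
  frame_mem y hy := by
    rw [State.put_mem, if_neg (hy a), h.frame_mem y hy]

theorem SimRel.jump (h : SimRel D v base stride σ₀ d σ) (p : ℕ) :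
    SimRel D v base stride σ₀ ⟨p, d.reg, d.mem⟩ σ :=
  ⟨h.reg, h.mem, h.frame_reg, h.frame_mem⟩

theorem Instr.length_simCode (i : Instr) (len v b S tmp o : ℕ) :
    (i.simCode len v b S tmp o).length = 3 := by
  cases i <;> rfl

theorem Program.length_simCode (D : Program) (v b S tmp o : ℕ) :
    (D.simCode v b S tmp o).length = 3 * D.length := by
  simp only [Program.simCode, List.length_flatMap, Instr.length_simCode]
  simp [Nat.mul_comm]

theorem at_flatMap {f : Instr → List Instr} (hf : ∀ i, (f i).length = 3) {l : List Instr}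
    (h : At A o (l.flatMap f)) {j : ℕ} {i : Instr} (hj : l[j]? = some i) :
    At A (o + 3 * j) (f i) := by
  induction l generalizing o j with
  | nil => simp at hj
  | cons x l ih =>
    rw [List.flatMap_cons, at_append, hf] at h
    cases j with
    | zero =>
      simp only [List.getElem?_cons_zero, Option.some.injEq] at hj
      exact hj ▸ h.1
    | succ j =>
      have := ih h.2 (j := j) (by simpa using hj)
      rwa [show o + 3 * (j + 1) = o + 3 + 3 * j by ring]

theorem Program.regBound_le {i : Instr} {j : ℕ} (hj : D[j]? = some i) :
    i.regBound ≤ D.regBound := by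
  obtain ⟨h, rfl⟩ := List.getElem?_eq_some_iff.1 hj
  unfold Program.regBound
  have : D[j] ∈ D := List.getElem_mem h
  generalize D[j] = i at this
  clear hj h
  induction D with
  | nil => simp at this
  | cons x D ih =>
    simp only [List.map_cons, List.foldr_cons]
    rcases List.mem_cons.1 this with rfl | h
    · exact le_max_left _ _
    · exact (ih h).trans (le_max_right _ _)

/-- The fold in `Program.regBound` starts at `2`, so the output register `0` is simulated even if
the program never mentions it. -/
theorem Program.two_le_regBound : 2 ≤ D.regBound := by
  unfold Program.regBound
  induction D with
  | nil => exact le_rfl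
  | cons x D ih => exact ih.trans (le_max_right _ _)

theorem Program.HaltsWithin.of_succ (h : D.HaltsWithin d (t + 1)) (h' : d' ∈ (D.step d).support) :
    D.HaltsWithin d' t := Program.haltsWithin_succ.1 h d' h'

theorem Program.expect_run_succ (φ : Config → ENNReal) :
    expect (D.run d (t + 1)) φ = expect (D.step d) fun d' => expect (D.run d' t) φ := by
  rw [Program.run_succ', expect_bind]

/-- Two steps that only change the temporary register. -/
theorem Ok.nop_nop {l : List Instr} (hA : At A o (.const V 0 :: .const V 0 :: l)) (hp : s.pc = o)
    (hBW : B ≤ W) (hB : 0 < B) (hs : Rel V B W σ s)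
    (h : ∀ s', s'.pc = o + 2 → Rel V B W σ s' → At A s'.pc l → Ok A W G T δ s') :
    Ok A W G (T + 2) δ s := by
  subst hp
  obtain ⟨a0, hA⟩ := at_cons.1 hA
  obtain ⟨a1, hA⟩ := at_cons.1 hA
  refine Ok.det (T := T + 1) a0 rfl (hs.below hBW) ?_
  have h1 : Rel V B W σ (s.setReg V 0) := hs.temp le_rfl (by omega)
  refine Ok.det (i := .const V 0) a1 rfl (h1.below hBW) ?_
  exact h _ rfl (h1.temp le_rfl (by omega)) hA

/-- Two steps that compute an address in the temporary register. -/
theorem Ok.address {l : List Instr} {a : ℕ}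
    (hA : At A o (.op .mul V a S :: .op .add V b V :: l)) (hp : s.pc = o)
    (hBW : B ^ 2 ≤ W) (haV : a < V) (hSV : S < V) (hbV : b < V) (hs : Rel V B W σ s)
    (h : ∀ s', s'.pc = o + 2 → Rel V B W σ s' → s'.reg V = σ.reg b + σ.reg a * σ.reg S →
      At A s'.pc l → Ok A W G T δ s') :
    Ok A W G (T + 2) δ s := by
  subst hp
  have ha := hs.reg_lt a haV
  have hS := hs.reg_lt S hSV
  have hb := hs.reg_lt b hbV
  have hlt : σ.reg b + σ.reg a * σ.reg S < W := by nlinarith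
  have hBW' : B ≤ W := by nlinarith
  obtain ⟨a0, hA⟩ := at_cons.1 hA
  obtain ⟨a1, hA⟩ := at_cons.1 hA
  refine Ok.det (T := T + 1) a0 rfl (hs.below hBW') ?_
  have hmul : WordOp.mul.eval (s.reg a) (s.reg S) = σ.reg a * σ.reg S := by
    rw [← hs.reg a haV, ← hs.reg S hSV]
    rfl
  rw [hmul]
  have h1 : Rel V B W σ (s.setReg V (σ.reg a * σ.reg S)) := hs.temp le_rfl (by omega)
  refine Ok.det (i := .op .add V b V)
    (s' := (s.setReg V (σ.reg a * σ.reg S)).setReg V (σ.reg b + σ.reg a * σ.reg S))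
    a1 ?_ (h1.below hBW') ?_
  · have hadd : WordOp.add.eval ((s.setReg V (σ.reg a * σ.reg S)).reg b)
        ((s.setReg V (σ.reg a * σ.reg S)).reg V) = σ.reg b + σ.reg a * σ.reg S := by
      rw [h1.reg b hbV, show (s.setReg V _).reg V = _ from Function.update_self _ _ _]
      rfl
    rw [← hadd]
    rfl
  · exact h _ rfl (h1.temp le_rfl hlt) (Function.update_self _ _ _) hA

/-- One step of `D` becomes three steps of `A`. The error budget attached to a configuration `d` is
the expected value of `φ` at the end of the run from `d`; by the law of total expectation this
budget is passed on exactly at every step. The word bound of `D` ensures that all simulated values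
are legal values of variables. -/
theorem Ok.sim_aux (hS : 0 < σ₀.reg S) (hbv : b < v) (hSv : S < v) (hBW : B ^ 2 ≤ W) (hB : 2 ≤ B)
    (hV : v + D.regBound ≤ V) (hA : At A o (D.simCode v b S V o)) (φ : Config → ENNReal) :
    ∀ t d σ s, s.pc = o + 3 * min d.pc D.length →
      SimRel D v (σ₀.reg b) (σ₀.reg S) σ₀ d σ → Rel V B W σ s → D.WordsBelow d B →
      D.HaltsWithin d t →
      (∀ d' ∈ (D.run d t).support, ∀ σ' s', SimRel D v (σ₀.reg b) (σ₀.reg S) σ₀ d' σ' →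
        Rel V B W σ' s' → s'.pc = o + 3 * D.length → Ok A W G T (φ d') s') →
      Ok A W G (T + 3 * t) (expect (D.run d t) φ) s := by
  have hBW' : B ≤ W := by nlinarith
  intro t
  induction t with
  | zero =>
    intro d σ s hp hsim hs hw hh hk
    have hd : D.length ≤ d.pc := hh d (by simp [Program.run])
    rw [show D.run d 0 = PMF.pure d from rfl, expect_pure]
    exact hk d (by simp [Program.run]) σ s hsim hs (by rw [hp, min_eq_right hd])
  | succ t ih =>
    intro d σ s hp hsim hs hw hh hk
    -- If `D` has halted early, the simulation is already at the end of its block and the remaining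
    -- time is given away.
    rcases le_or_gt D.length d.pc with hd | hd
    · have hr := Program.run_of_length_le hd (t + 1)
      rw [hr] at hk ⊢
      rw [expect_pure]
      exact (hk d (by simp) σ s hsim hs (by rw [hp, min_eq_right hd])).mono_time (by omega)
    · obtain ⟨i, hi⟩ : ∃ i, D[d.pc]? = some i := ⟨_, List.getElem?_eq_getElem hd⟩
      rw [min_eq_left hd.le] at hp
      have hcode := at_flatMap (fun i => i.length_simCode _ _ _ _ _ _) hA hi
      have hreg := Program.regBound_le hi
      have hstep := Program.step_of_getElem? hi
      -- the situation after one step of `D`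
      have next : ∀ d₁ ∈ (D.step d).support, ∀ σ₁ s₁, s₁.pc = o + 3 * min d₁.pc D.length →
          SimRel D v (σ₀.reg b) (σ₀.reg S) σ₀ d₁ σ₁ → (D.WordsBelow d₁ B → Rel V B W σ₁ s₁) →
          Ok A W G (T + 3 * t) (expect (D.run d₁ t) φ) s₁ := by
        intro d₁ h₁ σ₁ s₁ hp₁ hsim₁ hs₁
        have hw₁ := (Program.wordsBelow_iff.1 hw).2 d₁ h₁
        refine ih d₁ σ₁ s₁ hp₁ hsim₁ (hs₁ hw₁) hw₁ (hh.of_succ h₁) ?_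
        intro d' hd'
        refine hk d' ?_
        rw [Program.run_succ', PMF.mem_support_bind_iff]
        exact ⟨d₁, h₁, hd'⟩
      have next_det : ∀ d₁, i.exec d = PMF.pure d₁ → ∀ σ₁ s₁,
          s₁.pc = o + 3 * min d₁.pc D.length →
          SimRel D v (σ₀.reg b) (σ₀.reg S) σ₀ d₁ σ₁ → (D.WordsBelow d₁ B → Rel V B W σ₁ s₁) →
          Ok A W G (T + 3 * t) (expect (D.run d (t + 1)) φ) s₁ := by
        intro d₁ h₁ σ₁ s₁ hp₁ hsim₁ hs₁
        rw [Program.expect_run_succ, hstep, h₁, expect_pure]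
        exact next d₁ (by rw [hstep, h₁]; simp) σ₁ s₁ hp₁ hsim₁ hs₁
      have hsucc : ∀ p, p = o + 3 * d.pc + 2 → p + 1 = o + 3 * min (d.pc + 1) D.length := by
        intro p hp
        rw [min_eq_left (by omega)]
        omega
      have below : ∀ {d₁}, D.WordsBelow d₁ B → d₁.Below B := fun h => (Program.wordsBelow_iff.1 h).1
      rw [show T + 3 * (t + 1) = T + 3 * t + 1 + 2 by ring]
      have hb0 := hsim.frame_reg b hbv
      have hS0 := hsim.frame_reg S hSv
      cases i with
      | const r c =>
        refine Ok.nop_nop hcode hp hBW' (by omega) hs fun s₂ hp₂ hs₂ hA₂ => ?_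
        refine Ok.det (at_cons.1 hA₂).1 rfl (hs₂.below hBW') ?_
        refine next_det _ rfl (σ.set (v + r) c) _ (hsucc _ hp₂) (hsim.setReg r c) fun hw₁ => ?_
        refine hs₂.set hBW' ?_
        simpa [Config.setReg] using (below hw₁ r).1
      | op p r a c =>
        simp only [Instr.regBound, max_le_iff] at hreg
        refine Ok.nop_nop hcode hp hBW' (by omega) hs fun s₂ hp₂ hs₂ hA₂ => ?_
        refine Ok.det (at_cons.1 hA₂).1 rfl (hs₂.below hBW') ?_
        have hv : p.eval (s₂.reg (v + a)) (s₂.reg (v + c)) = p.eval (d.reg a) (d.reg c) := by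
          rw [hs₂.reg _ (by omega), hs₂.reg _ (by omega), hsim.reg a (by omega),
            hsim.reg c (by omega)]
        rw [hv]
        refine next_det _ rfl (σ.set (v + r) _) _ (hsucc _ hp₂) (hsim.setReg r _) fun hw₁ => ?_
        refine hs₂.set hBW' ?_
        simpa [Config.setReg] using (below hw₁ r).1
      | load r a =>
        simp only [Instr.regBound, max_le_iff] at hreg
        refine Ok.address hcode hp hBW (by omega) (by omega) (by omega) hs
          fun s₂ hp₂ hs₂ hv₂ hA₂ => ?_
        refine Ok.det (at_cons.1 hA₂).1 rfl (hs₂.below hBW') ?_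
        have hv : s₂.mem (s₂.reg V) = d.mem (d.reg a) := by
          rw [hv₂, hs₂.mem, hb0, hS0, hsim.mem, hsim.reg a (by omega)]
        rw [hv]
        refine next_det _ rfl (σ.set (v + r) _) _ (hsucc _ hp₂) (hsim.setReg r _) fun hw₁ => ?_
        refine hs₂.set hBW' ?_
        simpa [Config.setReg] using (below hw₁ r).1
      | store a c =>
        simp only [Instr.regBound, max_le_iff] at hreg
        refine Ok.address hcode hp hBW (by omega) (by omega) (by omega) hs
          fun s₂ hp₂ hs₂ hv₂ hA₂ => ?_
        refine Ok.det (at_cons.1 hA₂).1 rfl (hs₂.below hBW') ?_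
        rw [hv₂, hb0, hS0, hsim.reg a (by omega), hs₂.reg (v + c) (by omega),
          hsim.reg c (by omega)]
        refine next_det _ rfl (σ.put (σ₀.reg b + d.reg a * σ₀.reg S) (d.reg c)) _ (hsucc _ hp₂)
          (hsim.setMem hS _ _ _) fun hw₁ => hs₂.put ?_
        simpa using (below hw₁ (d.reg a)).2
      | jumpZero a l =>
        simp only [Instr.regBound] at hreg
        refine Ok.nop_nop hcode hp hBW' (by omega) hs fun s₂ hp₂ hs₂ hA₂ => ?_
        have hv : s₂.reg (v + a) = d.reg a := by
          rw [hs₂.reg _ (by omega), hsim.reg a (by omega)]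
        by_cases h0 : d.reg a = 0
        · refine Ok.jump_zero (at_cons.1 hA₂).1 (hv.trans h0) (hs₂.below hBW') ?_
          refine next_det ⟨l, d.reg, d.mem⟩ (by simp [Instr.exec, h0]) σ _ rfl (hsim.jump l)
            fun _ => hs₂.jump
        · refine Ok.jump_pos (at_cons.1 hA₂).1 (by rwa [hv]) (hs₂.below hBW') ?_
          refine next_det ⟨d.pc + 1, d.reg, d.mem⟩ (by simp [Instr.exec, h0]) σ _ (hsucc _ hp₂)
            (hsim.jump _) fun _ => hs₂.jump
      | flip r =>
        simp only [Instr.regBound] at hreg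
        refine Ok.nop_nop hcode hp hBW' (by omega) hs fun s₂ hp₂ hs₂ hA₂ => ?_
        have hstepA := Program.step_of_getElem? (at_cons.1 hA₂).1
        -- The outcome of the coin can be read from register `v + r` of the successor, which makes
        -- the budget a function of that configuration.
        refine (Ok.step (φ := fun s' =>
          expect (D.run (d.setReg r (s'.reg (v + r))) t) φ) (hs₂.below hBW') ?_).mono_error ?_
        · intro s₃ hs₃
          rw [hstepA] at hs₃
          obtain ⟨x, -, rfl⟩ := (PMF.mem_support_map_iff _ _ _).1 hs₃
          have hx : (s₂.setReg (v + r) x.toNat).reg (v + r) = x.toNat := Function.update_self _ _ _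
          rw [hx]
          refine next _ ?_ (σ.set (v + r) x.toNat) _ (hsucc _ hp₂) (hsim.setReg r _) fun _ =>
            hs₂.set hBW' (by cases x <;> simp <;> omega)
          rw [hstep]
          exact (PMF.mem_support_map_iff _ _ _).2 ⟨x, by simp, rfl⟩
        · rw [Program.expect_run_succ, hstep]
          refine le_of_eq ?_
          rw [hstepA]
          change expect (PMF.map _ _) _ = expect (PMF.map _ _) _
          rw [expect_map, expect_map]
          refine congrArg _ (funext fun x => ?_)
          rw [show (s₂.setReg (v + r) x.toNat).reg (v + r) = x.toNat from
            Function.update_self _ _ _]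

variable {K : State → ℕ → ENNReal → Prop}

/-- Running `D` as a subroutine. -/
theorem Run.sim (φ : Config → ENNReal) (hS : 0 < σ.reg S) (hbv : b < v) (hSv : S < v)
    (hpc : d.pc = 0) (hsim : SimRel D v (σ.reg b) (σ.reg S) σ d σ) (hw : D.WordsBelow d B)
    (hh : D.HaltsWithin d t)
    (hK : ∀ d' σ', d'.Below B → SimRel D v (σ.reg b) (σ.reg S) σ d' σ' → K σ' T (φ d')) :
    Run B (.sim D v b S) σ (T + 3 * t) (expect (D.run d t) φ) K := by
  intro V W A o G h2 hb hl hW hA hok s ho hs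
  simp only [Cmd.bound, Cmd.depth, max_le_iff, pow_one] at hb hW
  refine Ok.sim_aux hS hbv hSv hW h2.1 hb.1 hA φ t d σ s (by simp [ho, hpc]) hsim hs hw hh ?_
  intro d' hd' σ' s' hsim' hs' hp'
  refine hok σ' T _ (hK d' σ' (hw t d' hd') hsim') s' ?_ hs'
  rw [hp']
  change _ = o + (D.simCode v b S V o).length
  rw [Program.length_simCode]

end ACZkC

namespace ACZkC

/-! ### Zero cliques as tuples -/

section Cliques

variable {k n R : ℕ}

/-- The vertex set that contains vertex `f i` of part `i` for every `i`. -/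
def tuple (f : Fin k → Fin n) : Finset (Fin k × Fin n) := Finset.univ.image fun i => (i, f i)

theorem mem_tuple {f : Fin k → Fin n} {x : Fin k × Fin n} : x ∈ tuple f ↔ f x.1 = x.2 := by
  simp only [tuple, Finset.mem_image, Finset.mem_univ, true_and]
  constructor
  · rintro ⟨i, rfl⟩
    rfl
  · intro h
    exact ⟨x.1, Prod.ext rfl h⟩

theorem tuple_injective : Function.Injective (tuple : (Fin k → Fin n) → _) := by
  intro f g h
  funext i
  have : (i, f i) ∈ tuple g := h ▸ mem_tuple.2 rfl
  exact (mem_tuple.1 this).symm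

theorem card_tuple (f : Fin k → Fin n) : (tuple f).card = k := by
  rw [tuple, Finset.card_image_of_injective _ fun i j h => (Prod.ext_iff.1 h).1]
  simp

/-- Vertices of a clique lie in different parts, so `k` of them meet each of the `k` parts exactly
once. -/
theorem cliqueFinset_graph : (graph k n).cliqueFinset k = Finset.univ.image tuple := by
  ext s
  rw [SimpleGraph.mem_cliqueFinset_iff, SimpleGraph.isNClique_iff]
  simp only [Finset.mem_image, Finset.mem_univ, true_and]
  constructor
  · rintro ⟨hc, hs⟩
    have hinj : Set.InjOn Prod.fst (s : Set (Fin k × Fin n)) := by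
      intro x hx y hy hxy
      by_contra hne
      exact hc hx hy hne hxy
    have himg : s.image Prod.fst = Finset.univ := by
      rw [← Finset.card_eq_iff_eq_univ, Finset.card_image_of_injOn hinj, hs, Fintype.card_fin]
    have hex : ∀ i, ∃ u, (i, u) ∈ s := by
      intro i
      have : i ∈ s.image Prod.fst := himg ▸ Finset.mem_univ i
      obtain ⟨x, hx, rfl⟩ := Finset.mem_image.1 this
      exact ⟨x.2, hx⟩
    choose f hf using hex
    refine ⟨f, Finset.eq_of_subset_of_card_le (fun x hx => ?_) (by rw [card_tuple, hs])⟩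
    rw [mem_tuple] at hx
    have := hf x.1
    rwa [hx] at this
  · rintro ⟨f, rfl⟩
    refine ⟨fun x hx y hy hne hxy => hne ?_, card_tuple f⟩
    rw [Finset.mem_coe, mem_tuple] at hx hy
    refine Prod.ext hxy ?_
    rw [← hx, ← hy]
    exact congrArg f hxy

theorem Instance.weight_tuple (w : Instance k n R) (f : Fin k → Fin n) :
    w.weight (tuple f) = ∑ p ∈ Finset.univ.filter (fun p : Fin k × Fin k => p.1 < p.2),
      w.entry (p.1, f p.1) (p.2, f p.2) := by
  unfold Instance.weight
  rw [← Finset.sum_filter]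
  symm
  refine Finset.sum_bij (fun p hp => ⟨s((p.1, f p.1), (p.2, f p.2)),
    (Finset.mem_filter.1 hp).2.ne⟩) ?_ ?_ ?_ ?_
  · intro p hp
    simp only [Finset.mem_filter, Finset.mem_univ, Finset.mk_mem_sym2_iff, mem_tuple,
      and_self]
  · intro p hp q hq h
    have hp := (Finset.mem_filter.1 hp).2
    have hq := (Finset.mem_filter.1 hq).2
    replace h := Sym2.eq_iff.1 (Subtype.mk.inj h)
    simp only [Prod.mk.injEq] at h
    rcases h with h | h
    · exact Prod.ext h.1.1 h.2.1
    · rw [h.1.1, h.2.1] at hp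
      exact absurd hp hq.asymm
  · rintro ⟨e, he⟩ hmem
    induction e with
    | _ x y =>
      simp only [Finset.mem_filter, Finset.mem_univ, true_and, Finset.mk_mem_sym2_iff,
        mem_tuple] at hmem
      have hne : x.1 ≠ y.1 := he
      rcases lt_or_gt_of_ne hne with h | h
      · refine ⟨(x.1, y.1), by simpa using h, ?_⟩
        simp only [hmem.1, hmem.2]
      · refine ⟨(y.1, x.1), by simpa using h, ?_⟩
        simp only [hmem.1, hmem.2]
        exact Subtype.ext Sym2.eq_swap
  · intro p hp
    have hp := (Finset.mem_filter.1 hp).2.ne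
    rw [Instance.entry, dif_pos (show (graph k n).Adj (p.1, f p.1) (p.2, f p.2) from hp)]

theorem Instance.memory_apply (w : Instance k n R) (x y : Fin k × Fin n) :
    w.memory ((x.1 * n + x.2) * (k * n) + (y.1 * n + y.2)) = w.entry x y := by
  have h : ((x.1 * n + x.2) * (k * n) + (y.1 * n + y.2) : ℕ) =
      (finProdFinEquiv (finProdFinEquiv x, finProdFinEquiv y) : Fin ((k * n) * (k * n))) := by
    simp only [finProdFinEquiv_apply_val]
    ring
  rw [h]
  unfold Instance.memory
  rw [dif_pos (Fin.is_lt _)]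
  simp only [Fin.eta, Equiv.symm_apply_apply]

theorem Instance.memory_of_le (w : Instance k n R) {a : ℕ} (h : (k * n) * (k * n) ≤ a) :
    w.memory a = 0 := dif_neg (by omega)

theorem Instance.entry_lt (w : Instance k n R) [NeZero R] (x y : Fin k × Fin n) :
    w.entry x y < R := by
  unfold Instance.entry
  split_ifs
  · exact Fin.is_lt _
  · exact NeZero.pos R

theorem Instance.memory_lt (w : Instance k n R) [NeZero R] (a : ℕ) : w.memory a < R := by
  unfold Instance.memory
  split_ifs
  · exact w.entry_lt _ _
  · exact NeZero.pos R

/-- The address of the entry for vertex `u` of part `i` and vertex `v` of part `j`. -/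
def addr (k n i u j v : ℕ) : ℕ := (i * n + u) * (k * n) + (j * n + v)

/-- The weight of the tuple `v` when the weights are given by `E`. -/
def wt (k : ℕ) (E : ℕ → ℕ → ℕ → ℕ → ℕ) (v : ℕ → ℕ) : ℕ :=
  ∑ j ∈ Finset.range k, ∑ i ∈ Finset.range j, E i (v i) j (v j)

theorem wt_congr {E : ℕ → ℕ → ℕ → ℕ → ℕ} {v v' : ℕ → ℕ} (h : ∀ i < k, v i = v' i) :
    wt k E v = wt k E v' := by
  refine Finset.sum_congr rfl fun j hj => Finset.sum_congr rfl fun i hi => ?_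
  rw [Finset.mem_range] at hi hj
  rw [h i (hi.trans hj), h j hj]

/-- A function on `Fin k` continued by zero. -/
def ext (v : Fin k → ℕ) (i : ℕ) : ℕ := if h : i < k then v ⟨i, h⟩ else 0

theorem ext_val (v : Fin k → ℕ) (i : Fin k) : ext v i = v i := by
  simp [ext]

theorem sum_range_sum_range {M : Type*} [AddCommMonoid M] (F : ℕ → ℕ → M) :
    ∑ j ∈ Finset.range k, ∑ i ∈ Finset.range j, F i j =
      ∑ p ∈ Finset.univ.filter (fun p : Fin k × Fin k => p.1 < p.2), F p.1 p.2 := by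
  rw [Finset.sum_sigma']
  refine Finset.sum_bij' (fun p hp => (⟨p.2, ?_⟩, ⟨p.1, ?_⟩)) (fun p _ => ⟨p.2, p.1⟩) ?_ ?_ ?_ ?_ ?_
  · simp only [Finset.mem_sigma, Finset.mem_range] at hp
    omega
  · simp only [Finset.mem_sigma, Finset.mem_range] at hp
    omega
  · intro p hp
    simpa using (Finset.mem_sigma.1 hp).2
  · intro p hp
    simpa using hp
  all_goals intros; rfl

theorem Instance.weight_eq_wt (w : Instance k n R) (f : Fin k → Fin n) :
    w.weight (tuple f) =
      wt k (fun i u j v => w.memory (addr k n i u j v)) (ext fun i => (f i : ℕ)) := by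
  rw [w.weight_tuple, wt, sum_range_sum_range]
  refine Finset.sum_congr rfl fun p _ => ?_
  rw [ext_val, ext_val, ← w.memory_apply]
  rfl

theorem Instance.card_zeroCliques (w : Instance k n R) :
    w.zeroCliques.card = ∑ f : Fin k → Fin n,
      if R ∣ wt k (fun i u j v => w.memory (addr k n i u j v)) (ext fun i => (f i : ℕ))
      then 1 else 0 := by
  unfold Instance.zeroCliques
  rw [cliqueFinset_graph, Finset.filter_image, Finset.card_image_of_injective _ tuple_injective,
    Finset.card_filter]
  refine Finset.sum_congr rfl fun f _ => ?_
  simp only [w.weight_eq_wt, Nat.modEq_zero_iff_dvd]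

/-- Sums over numbers with `k` digits. -/
theorem sum_digits {M : Type*} [AddCommMonoid M] (F : (Fin k → ℕ) → M) :
    ∑ x ∈ Finset.range (n ^ k), F (fun i => x / n ^ (i : ℕ) % n) =
      ∑ f : Fin k → Fin n, F fun i => f i := by
  rw [← Fin.sum_univ_eq_sum_range (fun x => F fun i => x / n ^ (i : ℕ) % n)]
  refine Fintype.sum_equiv finFunctionFinEquiv.symm _ _ fun x => ?_
  simp only [finFunctionFinEquiv_symm_apply_val]

/-- The form in which a single loop can run through all tuples: as the base-`n` digits of its
counter. -/
theorem Instance.counting_eq (w : Instance k n R) :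
    counting k n R w = ∑ x ∈ Finset.range (n ^ k),
      if R ∣ wt k (fun i u j v => w.memory (addr k n i u j v)) (fun i => x / n ^ i % n)
      then 1 else 0 := by
  rw [counting, w.card_zeroCliques, ← sum_digits (F := fun f => if R ∣ wt k
    (fun i u j v => w.memory (addr k n i u j v)) (ext f) then 1 else 0)]
  refine Finset.sum_congr rfl fun x _ => ?_
  congr 2
  exact wt_congr fun i hi => by simp [ext, hi]

theorem Instance.counting_le (w : Instance k n R) : counting k n R w ≤ n ^ k := by
  rw [w.counting_eq]
  calc _ ≤ ∑ x ∈ Finset.range (n ^ k), 1 := Finset.sum_le_sum fun x _ => by split_ifs <;> simp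
    _ = n ^ k := by simp

theorem Instance.decision_eq (w : Instance k n R) :
    decision k n R w = if counting k n R w = 0 then 0 else 1 := by
  unfold decision counting
  by_cases h : w.zeroCliques = ∅
  · simp [h]
  · rw [if_pos (Finset.nonempty_iff_ne_empty.2 h), if_neg (by simpa using h)]

/-! ### Instances on subsets of the vertices -/

/-- The instance on the vertices with numbers `st i + u`, `u < m`, in part `i`. -/
def Instance.sub {m : ℕ} (w : Instance k n R) (st : Fin k → ℕ) (h : ∀ i, st i + m ≤ n) :
    Instance k m R := fun e =>
  w ⟨e.1.map fun x => (x.1, ⟨st x.1 + x.2, by have := h x.1; omega⟩), by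
    obtain ⟨e, he⟩ := e
    induction e with
    | _ x y => exact he⟩

theorem Instance.entry_sub {m : ℕ} (w : Instance k n R) (st : Fin k → ℕ) (h : ∀ i, st i + m ≤ n)
    (x y : Fin k × Fin m) :
    (w.sub st h).entry x y = w.entry (x.1, ⟨st x.1 + x.2, by have := h x.1; omega⟩)
      (y.1, ⟨st y.1 + y.2, by have := h y.1; omega⟩) := by
  unfold Instance.entry
  by_cases hxy : x.1 = y.1
  · rw [dif_neg (by simpa using hxy), dif_neg (by simpa using hxy)]
  · rw [dif_pos (by simpa using hxy), dif_pos (by simpa using hxy)]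
    rfl

theorem Instance.memory_sub {m : ℕ} (w : Instance k n R) (st : Fin k → ℕ)
    (h : ∀ i, st i + m ≤ n) (i j : Fin k) {u v : ℕ} (hu : u < m) (hv : v < m) :
    (w.sub st h).memory (addr k m i u j v) =
      w.memory (addr k n i (st i + u) j (st j + v)) := by
  have hi := h i
  have hj := h j
  have h1 := (w.sub st h).memory_apply (i, ⟨u, hu⟩) (j, ⟨v, hv⟩)
  have h2 := w.memory_apply (i, ⟨st i + u, by omega⟩) (j, ⟨st j + v, by omega⟩)
  rw [w.entry_sub] at h1
  exact h1.trans h2.symm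

end Cliques

end ACZkC

namespace ACZkC

/-! ### Partition of the parts into groups -/

/-- The first vertex of group number `g`, when `n` vertices are divided into groups of size `m`;
the last group overlaps with the previous one. -/
def groupStart (n m g : ℕ) : ℕ := g * m - ((g + 1) * m - n)

variable {k n m R : ℕ}

theorem groupStart_add_le {g : ℕ} (hmn : m ≤ n) (hg : g ≤ n / m) : groupStart n m g + m ≤ n := by
  unfold groupStart
  have h1 : g * m ≤ n := (Nat.mul_le_mul_right m hg).trans (Nat.div_mul_le_self n m)
  rw [Nat.add_mul, one_mul]
  omega

theorem groupStart_le {g : ℕ} : groupStart n m g ≤ g * m := Nat.sub_le _ _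

theorem groupStart_of_lt {g : ℕ} (hg : g < n / m) : groupStart n m g = g * m := by
  unfold groupStart
  have h1 : (g + 1) * m ≤ n := (Nat.mul_le_mul_right m hg).trans (Nat.div_mul_le_self n m)
  omega

/-- Group `g` owns its vertices with number at least `g * m`. Thus vertex `v` is owned by group `v /
m` alone, although the last group overlaps with the previous one. -/
theorem div_of_owned {g x : ℕ} (hx : x < m) (h : g * m ≤ groupStart n m g + x) :
    (groupStart n m g + x) / m = g := by
  have := groupStart_le (n := n) (m := m) (g := g)
  rw [Nat.div_eq_iff (by omega)]
  constructor
  · rw [Nat.mul_comm] at *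
    omega
  · have : (g + 1) * m = g * m + m := by ring
    omega

theorem groupStart_div_le {v : ℕ} (hm : 0 < m) (hmn : m ≤ n) (hv : v < n) :
    groupStart n m (v / m) ≤ v ∧ v < groupStart n m (v / m) + m ∧
      v / m * m ≤ v := by
  have h1 := Nat.div_mul_le_self v m
  have h2 := Nat.lt_div_mul_add (a := v) hm
  refine ⟨groupStart_le.trans h1, ?_, h1⟩
  unfold groupStart
  rw [Nat.add_mul, one_mul]
  omega

/-- Every tuple of vertices is owned by exactly one tuple of groups, so counting owned tuples counts
nothing twice. If `m` divides `n`, the last group owns nothing. -/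
theorem sum_groups {M : Type*} [AddCommMonoid M] (hm : 0 < m) (hmn : m ≤ n)
    (F : (Fin k → ℕ) → M) :
    ∑ g : Fin k → Fin (n / m + 1), ∑ x : Fin k → Fin m,
      (if ∀ i, (g i : ℕ) * m ≤ groupStart n m (g i) + x i
        then F fun i => groupStart n m (g i) + x i else 0) =
      ∑ v : Fin k → Fin n, F fun i => v i := by
  rw [← Fintype.sum_prod_type' (fun (g : Fin k → Fin (n / m + 1)) (x : Fin k → Fin m) =>
      if ∀ i, (g i : ℕ) * m ≤ groupStart n m (g i) + x i
        then F fun i => groupStart n m (g i) + x i else 0), ← Finset.sum_filter]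
  symm
  refine Finset.sum_bij (fun v _ =>
    (fun i => ⟨v i / m, Nat.lt_succ_of_le (Nat.div_le_div_right (v i).2.le)⟩,
      fun i => ⟨v i - groupStart n m (v i / m), by
        have := groupStart_div_le hm hmn (v i).2
        omega⟩)) ?_ ?_ ?_ ?_
  · intro v _
    simp only [Finset.mem_filter, Finset.mem_univ, true_and]
    intro i
    have := groupStart_div_le hm hmn (v i).2
    omega
  · intro v _ v' _ h
    funext i
    have h1 := congrArg (fun p => (p.1 i : ℕ)) h
    have h2 := congrArg (fun p => (p.2 i : ℕ)) h
    simp only at h1 h2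
    rw [h1] at h2
    have := groupStart_div_le hm hmn (v i).2
    have := groupStart_div_le hm hmn (v' i).2
    rw [h1] at *
    exact Fin.ext (by omega)
  · rintro ⟨g, x⟩ hgx
    simp only [Finset.mem_filter, Finset.mem_univ, true_and] at hgx
    refine ⟨fun i => ⟨groupStart n m (g i) + x i, ?_⟩, Finset.mem_univ _, ?_⟩
    · have := groupStart_add_le hmn (Nat.lt_succ_iff.1 (g i).2)
      have := (x i).2
      omega
    · have h := fun i => div_of_owned (x i).2 (hgx i)
      refine Prod.ext (funext fun i => Fin.ext (h i)) (funext fun i => Fin.ext ?_)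
      simp only [h]
      omega
  · intro v _
    congr 1
    funext i
    have := groupStart_div_le hm hmn (v i).2
    simp only
    omega

/-- A vertex lies in at most two groups: a regular one and possibly the last. One bit per part,
recording whether the group is the last, therefore determines the groups of a tuple. -/
theorem sum_sum_groups_le (hmn : m ≤ n) (F : (Fin k → ℕ) → ℕ) :
    ∑ g : Fin k → Fin (n / m + 1), ∑ x : Fin k → Fin m,
      (F fun i => groupStart n m (g i) + x i) ≤ 2 ^ k * ∑ v : Fin k → Fin n, F fun i => v i := by
  let e : (Fin k → Fin (n / m + 1)) × (Fin k → Fin m) → (Fin k → Bool) × (Fin k → Fin n) :=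
    fun p => (fun i => decide ((p.1 i : ℕ) = n / m),
      fun i => ⟨groupStart n m (p.1 i) + p.2 i, by
        have := groupStart_add_le hmn (Nat.lt_succ_iff.1 (p.1 i).2)
        have := (p.2 i).2
        omega⟩)
  have he : Function.Injective e := by
    rintro ⟨g, x⟩ ⟨g', x'⟩ h
    have h1 : ∀ i, ((g i : ℕ) = n / m ↔ (g' i : ℕ) = n / m) := fun i => by
      simpa [e] using congrArg (fun p => p.1 i) h
    have h2 : ∀ i, groupStart n m (g i) + x i = groupStart n m (g' i) + x' i := fun i => by
      simpa [e] using congrArg (fun p => (p.2 i : ℕ)) h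
    have h3 : ∀ i, (g i : ℕ) = g' i := by
      intro i
      rcases eq_or_ne (g i : ℕ) (n / m) with hg | hg
      · rw [hg, (h1 i).1 hg]
      · have hg' := mt (h1 i).2 hg
        have a1 := groupStart_of_lt (lt_of_le_of_ne (Nat.lt_succ_iff.1 (g i).2) hg)
        have a2 := groupStart_of_lt (lt_of_le_of_ne (Nat.lt_succ_iff.1 (g' i).2) hg')
        have b1 := div_of_owned (n := n) (g := g i) (x i).2 (by omega)
        have b2 := div_of_owned (n := n) (g := g' i) (x' i).2 (by omega)
        rw [← b1, h2, b2]
    refine Prod.ext (funext fun i => Fin.ext (h3 i)) (funext fun i => Fin.ext ?_)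
    have := h2 i
    rw [h3] at this
    simpa using this
  calc _ = ∑ p : (Fin k → Fin (n / m + 1)) × (Fin k → Fin m), F fun i => ((e p).2 i : ℕ) := by
        rw [Fintype.sum_prod_type]
    _ = ∑ q ∈ Finset.univ.map ⟨e, he⟩, F fun i => (q.2 i : ℕ) := by
        rw [Finset.sum_map]; rfl
    _ ≤ ∑ q : (Fin k → Bool) × (Fin k → Fin n), F fun i => (q.2 i : ℕ) :=
        Finset.sum_le_sum_of_subset (Finset.subset_univ _)
    _ = _ := by simp [Fintype.sum_prod_type]

/-- The sub-instance on the groups whose numbers are the digits of `x`. -/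
def Instance.group (w : Instance k n R) (hmn : m ≤ n) (x : ℕ) : Instance k m R :=
  w.sub (fun i => groupStart n m (x / (n / m + 1) ^ (i : ℕ) % (n / m + 1))) fun _ =>
    groupStart_add_le hmn (Nat.lt_succ_iff.1 (Nat.mod_lt _ (Nat.succ_pos _)))

/-- The vertex of part `i` in the tuple number `x` of the groups number `g`. -/
def groupVertex (n m g x i : ℕ) : ℕ :=
  groupStart n m (g / (n / m + 1) ^ i % (n / m + 1)) + x / m ^ i % m

/-- The number of zero cliques that belong to the groups number `g`. -/
def Instance.owned (w : Instance k n R) (m g : ℕ) : ℕ :=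
  ∑ x ∈ Finset.range (m ^ k),
    if R ∣ wt k (fun i u j v => w.memory (addr k n i u j v)) (groupVertex n m g x) ∧
      ∀ i < k, g / (n / m + 1) ^ i % (n / m + 1) * m ≤ groupVertex n m g x i then 1 else 0

theorem Instance.sum_owned (w : Instance k n R) (hm : 0 < m) (hmn : m ≤ n) :
    ∑ g ∈ Finset.range ((n / m + 1) ^ k), w.owned m g = counting k n R w := by
  let Z : (Fin k → ℕ) → ℕ := fun v =>
    if R ∣ wt k (fun i u j v => w.memory (addr k n i u j v)) (ext v) then 1 else 0
  have h1 : counting k n R w = ∑ v : Fin k → Fin n, Z fun i => v i := w.card_zeroCliques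
  rw [h1, ← sum_groups hm hmn, ← sum_digits (F := fun g => ∑ x : Fin k → Fin m,
    if ∀ i, g i * m ≤ groupStart n m (g i) + x i
      then Z fun i => groupStart n m (g i) + x i else 0)]
  refine Finset.sum_congr rfl fun g _ => ?_
  have hx := sum_digits (n := m) fun x : Fin k → ℕ =>
    if ∀ i : Fin k, g / (n / m + 1) ^ (i : ℕ) % (n / m + 1) * m ≤
        groupStart n m (g / (n / m + 1) ^ (i : ℕ) % (n / m + 1)) + x i
      then Z fun i => groupStart n m (g / (n / m + 1) ^ (i : ℕ) % (n / m + 1)) + x i else 0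
  refine Eq.trans ?_ hx
  refine Finset.sum_congr rfl fun x _ => ?_
  simp only [Z]
  rw [← ite_and]
  refine if_congr ?_ rfl rfl
  rw [and_comm, Fin.forall_iff]
  refine and_congr Iff.rfl ?_
  rw [wt_congr]
  intro i hi
  simp only [ext, hi, dif_pos]
  rfl

theorem Instance.counting_group (w : Instance k n R) (hmn : m ≤ n) (g : ℕ) :
    counting k m R (w.group hmn g) = ∑ x ∈ Finset.range (m ^ k),
      if R ∣ wt k (fun i u j v => w.memory (addr k n i u j v)) (groupVertex n m g x)
      then 1 else 0 := by
  rw [Instance.counting_eq]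
  refine Finset.sum_congr rfl fun x hx => ?_
  congr 2
  refine Finset.sum_congr rfl fun j hj => Finset.sum_congr rfl fun i hi => ?_
  rw [Finset.mem_range] at hi hj hx
  have hm : 0 < m := Nat.pos_of_ne_zero fun h => by
    subst h
    rw [zero_pow (by omega)] at hx
    omega
  exact w.memory_sub _ _ ⟨i, by omega⟩ ⟨j, hj⟩ (Nat.mod_lt _ hm) (Nat.mod_lt _ hm)

/-- In particular, groups without a zero clique contribute nothing and need not be searched. -/
theorem Instance.owned_le (w : Instance k n R) (hmn : m ≤ n) (g : ℕ) :
    w.owned m g ≤ counting k m R (w.group hmn g) := by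
  rw [w.counting_group]
  refine Finset.sum_le_sum fun x _ => ?_
  split_ifs with h1 h2
  · exact le_rfl
  · exact absurd h1.1 h2
  · exact Nat.zero_le _
  · exact le_rfl

/-- Bounds the number of searches caused by correct answers in terms of the number of zero cliques.
-/
theorem Instance.sum_decision_le (w : Instance k n R) (hmn : m ≤ n) :
    ∑ g ∈ Finset.range ((n / m + 1) ^ k), decision k m R (w.group hmn g) ≤
      2 ^ k * counting k n R w := by
  let Z : (Fin k → ℕ) → ℕ := fun v =>
    if R ∣ wt k (fun i u j v => w.memory (addr k n i u j v)) (ext v) then 1 else 0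
  have h1 : counting k n R w = ∑ v : Fin k → Fin n, Z fun i => v i := w.card_zeroCliques
  rw [h1]
  refine le_trans ?_ (sum_sum_groups_le hmn Z)
  rw [← sum_digits (F := fun g => ∑ x : Fin k → Fin m, Z fun i => groupStart n m (g i) + x i)]
  refine Finset.sum_le_sum fun g _ => ?_
  have hx := sum_digits (n := m) fun x : Fin k → ℕ =>
    Z fun i : Fin k => groupStart n m (g / (n / m + 1) ^ (i : ℕ) % (n / m + 1)) + x i
  refine le_trans ?_ hx.le
  have : decision k m R (w.group hmn g) ≤ counting k m R (w.group hmn g) := by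
    rw [Instance.decision_eq]
    split_ifs <;> omega
  refine this.trans (le_of_eq ?_)
  rw [w.counting_group]
  refine Finset.sum_congr rfl fun x _ => ?_
  simp only [Z]
  congr 2
  refine wt_congr fun i hi => ?_
  simp only [ext, hi, dif_pos]
  rfl

end ACZkC

namespace ACZkC

/-! ### Fast matrix multiplication in trilinear form -/

/-- The coefficients of the first factors in Strassen's algorithm. -/
def strassenA : List ℤ :=
  [1, 0, 0, 1, 0, 0, 1, 1, 1, 0, 0, 0, 0, 0, 0, 1, 1, 1, 0, 0, -1, 0, 1, 0, 0, 1, 0, -1]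

/-- The coefficients of the second factors in Strassen's algorithm. -/
def strassenB : List ℤ :=
  [1, 0, 0, 1, 1, 0, 0, 0, 0, 1, 0, -1, -1, 0, 1, 0, 0, 0, 0, 1, 1, 1, 0, 0, 0, 0, 1, 1]

/-- The coefficients of the results in Strassen's algorithm. -/
def strassenC : List ℤ :=
  [1, 0, 0, 1, 0, 1, 0, -1, 0, 0, 1, 1, 1, 1, 0, 0, -1, 0, 1, 0, 0, 0, 0, 1, 1, 0, 0, 0]

/-- The coefficients in the `L`-th tensor power. -/
def coef (S : List ℤ) : ℕ → ℕ → ℕ → ℕ → ℤ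
  | 0, _, _, _ => 1
  | L + 1, r, i, j => S.getD (4 * (r % 7) + 2 * (i % 2) + j % 2) 0 * coef S L (r / 7) (i / 2) (j / 2)

theorem sum_range_mul {M : Type*} [AddCommMonoid M] (a b : ℕ) (f : ℕ → ℕ → M) :
    ∑ x ∈ Finset.range (a * b), f (x / b) (x % b) =
      ∑ i ∈ Finset.range a, ∑ j ∈ Finset.range b, f i j := by
  induction a with
  | zero => simp
  | succ a ih =>
    rw [Nat.add_mul, one_mul, Finset.sum_range_add, ih, Finset.sum_range_succ]
    congr 1
    refine Finset.sum_congr rfl fun j hj => ?_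
    rw [Finset.mem_range] at hj
    have hb : 0 < b := by omega
    rw [Nat.mul_comm a b, Nat.mul_add_div hb, Nat.mul_add_mod, Nat.div_eq_of_lt hj,
      Nat.mod_eq_of_lt hj, Nat.add_zero]

theorem sum_range_mul' {M : Type*} [AddCommMonoid M] (a b : ℕ) (f : ℕ → M) :
    ∑ x ∈ Finset.range (a * b), f x =
      ∑ i ∈ Finset.range a, ∑ j ∈ Finset.range b, f (i * b + j) := by
  rw [← sum_range_mul a b fun i j => f (i * b + j)]
  refine Finset.sum_congr rfl fun x _ => ?_
  rw [Nat.div_add_mod']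

/-- Strassen's identities as one tensor identity: the tensor of the trace of a product of three 2 by
2 matrices has rank at most seven. The table `strassenC` is indexed by the transposed position `(l,
i)` accordingly. -/
theorem strassen_base : ∀ i < 2, ∀ j < 2, ∀ j' < 2, ∀ l < 2, ∀ l' < 2, ∀ i' < 2,
    ∑ r ∈ Finset.range 7, strassenA.getD (4 * r + 2 * i + j) 0 *
      strassenB.getD (4 * r + 2 * j' + l) 0 * strassenC.getD (4 * r + 2 * l' + i') 0 =
      if i = i' ∧ j = j' ∧ l = l' then 1 else 0 := by
  decide

/-- The identity is multiplicative under tensor products: after splitting off the lowest base-`7`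
digit of `r` and the lowest bits of the indices, the sum factors into the base case and the case
`L`. -/
theorem strassen_tensor (L : ℕ) : ∀ i < 2 ^ L, ∀ j < 2 ^ L, ∀ j' < 2 ^ L, ∀ l < 2 ^ L,
    ∀ l' < 2 ^ L, ∀ i' < 2 ^ L,
    ∑ r ∈ Finset.range (7 ^ L), coef strassenA L r i j * coef strassenB L r j' l *
      coef strassenC L r l' i' = if i = i' ∧ j = j' ∧ l = l' then 1 else 0 := by
  induction L with
  | zero =>
    intro i hi j hj j' hj' l hl l' hl' i' hi'
    rw [pow_zero, Nat.lt_one_iff] at *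
    subst hi hj hj' hl hl' hi'
    simp [coef]
  | succ L ih =>
    intro i hi j hj j' hj' l hl l' hl' i' hi'
    rw [pow_succ] at *
    have hr := sum_range_mul (7 ^ L) 7 fun q a =>
      (strassenA.getD (4 * a + 2 * (i % 2) + j % 2) 0 * coef strassenA L q (i / 2) (j / 2)) *
      (strassenB.getD (4 * a + 2 * (j' % 2) + l % 2) 0 * coef strassenB L q (j' / 2) (l / 2)) *
      (strassenC.getD (4 * a + 2 * (l' % 2) + i' % 2) 0 * coef strassenC L q (l' / 2) (i' / 2))
    refine hr.trans ?_
    have h1 := ih (i / 2) (by omega) (j / 2) (by omega) (j' / 2) (by omega) (l / 2) (by omega)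
      (l' / 2) (by omega) (i' / 2) (by omega)
    have h2 := strassen_base (i % 2) (by omega) (j % 2) (by omega) (j' % 2) (by omega) (l % 2)
      (by omega) (l' % 2) (by omega) (i' % 2) (by omega)
    have h3 := congrArg₂ (· * ·) h1 h2
    simp only [Finset.sum_mul_sum] at h3
    refine Eq.trans (Finset.sum_congr rfl fun q _ => Finset.sum_congr rfl fun a _ => ?_)
      (h3.trans ?_)
    · ring
    · rw [ite_zero_mul_ite_zero]
      have e : ∀ x y : ℕ, (x / 2 = y / 2 ∧ x % 2 = y % 2) ↔ x = y := fun x y => by omega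
      simp only [mul_one]
      refine if_congr ?_ rfl rfl
      rw [← e i, ← e j, ← e l]
      tauto

variable {K : Type*} [CommRing K]

/-- Only a trace is wanted, never a product matrix. The `7 ^ L` terms can thus be computed one after
the other, without recursion. -/
theorem strassen_trilinear (L : ℕ) (a b c : ℕ → ℕ → K) :
    ∑ r ∈ Finset.range (7 ^ L),
      (∑ i ∈ Finset.range (2 ^ L), ∑ j ∈ Finset.range (2 ^ L), (coef strassenA L r i j : K) * a i j) *
      (∑ j ∈ Finset.range (2 ^ L), ∑ l ∈ Finset.range (2 ^ L), (coef strassenB L r j l : K) * b j l) *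
      (∑ l ∈ Finset.range (2 ^ L), ∑ i ∈ Finset.range (2 ^ L), (coef strassenC L r l i : K) * c l i) =
    ∑ i ∈ Finset.range (2 ^ L), ∑ j ∈ Finset.range (2 ^ L), ∑ l ∈ Finset.range (2 ^ L),
      a i j * b j l * c l i := by
  have hexp : ∀ (I : Finset ℕ) (f g h : ℕ → ℕ → K),
      (∑ i ∈ I, ∑ j ∈ I, f i j) * (∑ j ∈ I, ∑ l ∈ I, g j l) * (∑ l ∈ I, ∑ i ∈ I, h l i) =
      ∑ p ∈ I ×ˢ I, ∑ q ∈ I ×ˢ I, ∑ s ∈ I ×ˢ I, f p.1 p.2 * g q.2 q.1 * h s.1 s.2 := by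
    intro I f g h
    have e : ∀ f : ℕ → ℕ → K, ∑ i ∈ I, ∑ j ∈ I, f i j = ∑ p ∈ I ×ˢ I, f p.1 p.2 :=
      fun f => (Finset.sum_product' _ _ _).symm
    rw [Finset.sum_comm (f := g), e f, e fun l j => g j l, e h]
    rw [Finset.sum_mul_sum, Finset.sum_mul]
    refine Finset.sum_congr rfl fun p _ => ?_
    rw [Finset.sum_mul]
    refine Finset.sum_congr rfl fun q _ => ?_
    rw [Finset.mul_sum]
  simp only [hexp]
  rw [Finset.sum_comm, Finset.sum_product]
  refine Finset.sum_congr rfl fun i hi => Finset.sum_congr rfl fun j hj => ?_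
  rw [Finset.sum_comm, Finset.sum_product]
  refine Finset.sum_congr rfl fun l hl => ?_
  have hinner : ∀ j' ∈ Finset.range (2 ^ L), ∑ r ∈ Finset.range (7 ^ L),
      ∑ s ∈ Finset.range (2 ^ L) ×ˢ Finset.range (2 ^ L),
        (coef strassenA L r i j : K) * a i j * ((coef strassenB L r j' l : K) * b j' l) *
          ((coef strassenC L r s.1 s.2 : K) * c s.1 s.2) =
      if j = j' then a i j * b j' l * c l i else 0 := by
    intro j' hj'
    rw [Finset.sum_comm, Finset.sum_product]
    have hs : ∀ l' ∈ Finset.range (2 ^ L), ∀ i' ∈ Finset.range (2 ^ L),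
        ∑ r ∈ Finset.range (7 ^ L), (coef strassenA L r i j : K) * a i j *
          ((coef strassenB L r j' l : K) * b j' l) * ((coef strassenC L r l' i' : K) * c l' i') =
        if i = i' then if l = l' then if j = j' then a i j * b j' l * c l' i' else 0 else 0
          else 0 := by
      intro l' hl' i' hi'
      rw [Finset.mem_range] at *
      have h := congrArg (Int.cast : ℤ → K) (strassen_tensor L i hi j hj j' hj' l hl l' hl' i' hi')
      push_cast at h
      have h' := congrArg (· * (a i j * b j' l * c l' i')) h
      simp only [Finset.sum_mul] at h'
      refine Eq.trans (Finset.sum_congr rfl fun r _ => ?_) (h'.trans ?_)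
      · ring
      · simp only [ite_and, ite_mul, one_mul, zero_mul]
        split_ifs <;> rfl
    rw [Finset.sum_congr rfl fun l' hl' => Finset.sum_congr rfl fun i' hi' => hs l' hl' i' hi']
    simp only [Finset.sum_ite_eq, hi, hl, if_true]
  rw [Finset.sum_congr rfl hinner, Finset.sum_ite_eq, if_pos hj]

/-- The linear forms of the algorithm, for matrices that are divided into blocks of size `M`. -/
def block (S : List ℤ) (L M r : ℕ) (a : ℕ → ℕ → K) (u v : ℕ) : K :=
  ∑ i ∈ Finset.range (2 ^ L), ∑ j ∈ Finset.range (2 ^ L),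
    (coef S L r i j : K) * a (i * M + u) (j * M + v)

/-- The identity is applied to the `2 ^ L` by `2 ^ L` matrices of entries at a fixed position in
their blocks; the sums over the positions are carried along. -/
theorem sum_block (L M : ℕ) (a b c : ℕ → ℕ → K) :
    ∑ r ∈ Finset.range (7 ^ L), ∑ u ∈ Finset.range M, ∑ v ∈ Finset.range M,
      ∑ x ∈ Finset.range M, block strassenA L M r a u v * block strassenB L M r b v x *
        block strassenC L M r c x u =
    ∑ u ∈ Finset.range (2 ^ L * M), ∑ v ∈ Finset.range (2 ^ L * M),
      ∑ x ∈ Finset.range (2 ^ L * M), a u v * b v x * c x u := by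
  simp only [sum_range_mul']
  rw [Finset.sum_comm]
  simp only [Finset.sum_comm (s := Finset.range (7 ^ L))]
  have hl : ∀ u v x, ∑ r ∈ Finset.range (7 ^ L), block strassenA L M r a u v *
      block strassenB L M r b v x * block strassenC L M r c x u =
      ∑ i ∈ Finset.range (2 ^ L), ∑ j ∈ Finset.range (2 ^ L), ∑ l ∈ Finset.range (2 ^ L),
        a (i * M + u) (j * M + v) * b (j * M + v) (l * M + x) * c (l * M + x) (i * M + u) :=
    fun u v x => strassen_trilinear L (fun i j => a (i * M + u) (j * M + v))
      (fun j l => b (j * M + v) (l * M + x)) (fun l i => c (l * M + x) (i * M + u))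
  simp only [hl]
  have h3 : ∀ (I J : Finset ℕ) (F : ℕ → ℕ → ℕ → ℕ → K),
      ∑ x ∈ J, ∑ i ∈ I, ∑ j ∈ I, ∑ l ∈ I, F x i j l =
        ∑ i ∈ I, ∑ j ∈ I, ∑ l ∈ I, ∑ x ∈ J, F x i j l := by
    intro I J F
    rw [Finset.sum_comm]
    refine Finset.sum_congr rfl fun i _ => ?_
    rw [Finset.sum_comm]
    refine Finset.sum_congr rfl fun j _ => ?_
    rw [Finset.sum_comm]
  have h2 : ∀ (I J : Finset ℕ) (F : ℕ → ℕ → ℕ → K),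
      ∑ v ∈ J, ∑ i ∈ I, ∑ j ∈ I, F v i j = ∑ i ∈ I, ∑ j ∈ I, ∑ v ∈ J, F v i j := by
    intro I J F
    rw [Finset.sum_comm]
    refine Finset.sum_congr rfl fun i _ => ?_
    rw [Finset.sum_comm]
  exact Eq.trans (Finset.sum_congr rfl fun u _ =>
    (Finset.sum_congr rfl fun v _ => h3 _ _ _).trans (h2 _ _ _)) Finset.sum_comm

/-! ### Counting cliques by matrix multiplication -/

/-- The weight of the edges that involve `u`, `v` in parts `0`, `1`, and no vertex of part `2`; the
vertices of the parts from `3` on are the digits of `y`. -/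
def weightA (E : ℕ → ℕ → ℕ → ℕ → ℕ) (n κ y u v : ℕ) : ℕ :=
  E 0 u 1 v + ∑ j ∈ Finset.range κ, (E 0 u (j + 3) (y / n ^ j % n) +
    ∑ i ∈ Finset.range j, E (i + 3) (y / n ^ i % n) (j + 3) (y / n ^ j % n))

/-- The weight of the edges at vertex `v` of part `1` to part `2` and to the parts from `3` on. -/
def weightB (E : ℕ → ℕ → ℕ → ℕ → ℕ) (n κ y v x : ℕ) : ℕ :=
  E 1 v 2 x + ∑ j ∈ Finset.range κ, E 1 v (j + 3) (y / n ^ j % n)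

/-- The weight of the edges at vertex `x` of part `2` to part `0` and to the parts from `3` on. -/
def weightC (E : ℕ → ℕ → ℕ → ℕ → ℕ) (n κ y x u : ℕ) : ℕ :=
  E 0 u 2 x + ∑ j ∈ Finset.range κ, E 2 x (j + 3) (y / n ^ j % n)

/-- Each edge of the clique is assigned to one side of the triangle on parts `0`, `1`, `2`, and the
edges among the remaining parts go to the first side. Hence each summand depends on only two of the
three vertices. -/
theorem wt_digits (E : ℕ → ℕ → ℕ → ℕ → ℕ) (n κ y : ℕ) :
    wt (κ + 3) E (fun i => y / n ^ i % n) =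
      weightA E n κ (y / n / n / n) (y % n) (y / n % n) +
      weightB E n κ (y / n / n / n) (y / n % n) (y / n / n % n) +
      weightC E n κ (y / n / n / n) (y / n / n % n) (y % n) := by
  have hd : ∀ j, y / n / n / n / n ^ j % n = y / n ^ (j + 3) % n := by
    intro j
    rw [Nat.div_div_eq_div_mul, Nat.div_div_eq_div_mul, Nat.div_div_eq_div_mul]
    congr 2
    ring
  have h2 : y / n / n = y / n ^ 2 := by rw [Nat.div_div_eq_div_mul, pow_two]
  simp only [weightA, weightB, weightC, hd]
  simp only [wt, Finset.sum_range_succ', Finset.sum_add_distrib, Finset.range_zero,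
    Finset.sum_empty, h2]
  simp only [zero_add, pow_zero, Nat.div_one, pow_one, Nat.reduceAdd]
  ring

/-- The indicator of weight `p` modulo `R`, on vertices below `n`. -/
def indicator (R n p u v W : ℕ) : ℕ := if (u < n ∧ v < n) ∧ R ∣ W + p then 1 else 0

/-- `R ∣ a + (R - p)` says that `p` is the residue of `a`. Exactly one pair `(p, q)` survives, and
for it the third indicator tests whether `c + p + q` is divisible by `R`. -/
theorem sum_residues {R n u v x a b c : ℕ} (hR : 0 < R) (hu : u < n) (hv : v < n) (hx : x < n) :
    ∑ p ∈ Finset.range R, ∑ q ∈ Finset.range R, indicator R n (R - p) u v a *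
      indicator R n (R - q) v x b * indicator R n (p + q) x u c =
      if R ∣ a + b + c then 1 else 0 := by
  have key : ∀ {a p : ℕ}, p < R → (R ∣ a + (R - p) ↔ p = a % R) := by
    intro a p hp
    have h1 : a + (R - p) + p = a + R := by omega
    rw [Nat.dvd_iff_mod_eq_zero]
    constructor
    · intro h
      have h2 : (a + (R - p) + p) % R = (a + R) % R := by rw [h1]
      rw [Nat.add_mod, h, zero_add, Nat.mod_mod, Nat.mod_eq_of_lt hp, Nat.add_mod_right] at h2
      exact h2
    · rintro rfl
      have h2 := Nat.div_add_mod a R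
      have h3 : a + (R - a % R) = R * (a / R + 1) := by
        rw [Nat.mul_add, mul_one]
        omega
      rw [h3, Nat.mul_mod_right]
  have ha := Nat.mod_lt a hR
  have hb := Nat.mod_lt b hR
  rw [Finset.sum_eq_single (a % R), Finset.sum_eq_single (b % R)]
  · simp only [indicator, hu, hv, hx, key ha, key hb, true_and, if_true, one_mul]
    have : R ∣ c + (a % R + b % R) ↔ R ∣ a + b + c := by
      rw [Nat.dvd_iff_mod_eq_zero, Nat.dvd_iff_mod_eq_zero]
      rw [show (c + (a % R + b % R)) % R = (a + b + c) % R by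
        simp only [Nat.add_mod, Nat.mod_mod, Nat.add_comm]]
    simp only [this]
  · intro q hq hne
    rw [Finset.mem_range] at hq
    simp [indicator, key hq, hne]
  · intro h
    exact absurd (Finset.mem_range.2 hb) h
  · intro p hp hne
    rw [Finset.mem_range] at hp
    refine Finset.sum_eq_zero fun q _ => ?_
    simp [indicator, key hp, hne]
  · intro h
    exact absurd (Finset.mem_range.2 ha) h

/-- The number of zero cliques as a sum of traces of products of matrices. -/
theorem Instance.counting_eq_sum_trace {κ n R : ℕ} (w : Instance (κ + 3) n R) (hR : 0 < R)
    {N : ℕ} (hN : n ≤ N) (E : ℕ → ℕ → ℕ → ℕ → ℕ)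
    (hE : E = fun i u j v => w.memory (addr (κ + 3) n i u j v)) :
    counting (κ + 3) n R w = ∑ y ∈ Finset.range (n ^ κ), ∑ p ∈ Finset.range R,
      ∑ q ∈ Finset.range R, ∑ u ∈ Finset.range N, ∑ v ∈ Finset.range N, ∑ x ∈ Finset.range N,
        indicator R n (R - p) u v (weightA E n κ y u v) *
        indicator R n (R - q) v x (weightB E n κ y v x) *
        indicator R n (p + q) x u (weightC E n κ y x u) := by
  rw [w.counting_eq, ← hE, show n ^ (κ + 3) = n ^ κ * n * n * n by ring]
  simp only [wt_digits]
  rw [sum_range_mul (n ^ κ * n * n) n fun y' u => if R ∣ weightA E n κ (y' / n / n) u (y' % n) +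
    weightB E n κ (y' / n / n) (y' % n) (y' / n % n) + weightC E n κ (y' / n / n) (y' / n % n) u
    then 1 else 0]
  rw [Finset.sum_comm]
  have h1 : ∀ u, _ := fun u => sum_range_mul (n ^ κ * n) n fun y' v =>
    if R ∣ weightA E n κ (y' / n) u v + weightB E n κ (y' / n) v (y' % n) +
      weightC E n κ (y' / n) (y' % n) u then 1 else 0
  have h2 : ∀ u v, _ := fun u v => sum_range_mul (n ^ κ) n fun y x =>
    if R ∣ weightA E n κ y u v + weightB E n κ y v x + weightC E n κ y x u then 1 else 0
  simp only [h1]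
  rw [Finset.sum_congr rfl fun u _ => Finset.sum_comm]
  simp only [h2]
  have h3 : ∀ (I J : Finset ℕ) (F : ℕ → ℕ → ℕ → ℕ → ℕ),
      ∑ u ∈ I, ∑ v ∈ I, ∑ y ∈ J, ∑ x ∈ I, F u v y x =
        ∑ y ∈ J, ∑ u ∈ I, ∑ v ∈ I, ∑ x ∈ I, F u v y x := by
    intro I J F
    simp only [Finset.sum_comm (s := I) (t := J)]
  rw [h3]
  refine Finset.sum_congr rfl fun y _ => ?_
  have h4 : ∀ (I J : Finset ℕ) (F : ℕ → ℕ → ℕ → ℕ → ℕ → ℕ),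
      ∑ p ∈ J, ∑ q ∈ J, ∑ u ∈ I, ∑ v ∈ I, ∑ x ∈ I, F u v x p q =
        ∑ u ∈ I, ∑ v ∈ I, ∑ x ∈ I, ∑ p ∈ J, ∑ q ∈ J, F u v x p q := by
    intro I J F
    simp only [Finset.sum_comm (s := J) (t := I)]
  rw [h4]
  -- The matrices are padded from size `n` to size `N`; the indicators vanish on the added rows and
  -- columns.
  have hsub : Finset.range n ⊆ Finset.range N := Finset.range_subset_range.2 hN
  rw [← Finset.sum_subset hsub]
  · refine Finset.sum_congr rfl fun u hu => ?_
    rw [← Finset.sum_subset hsub]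
    · refine Finset.sum_congr rfl fun v hv => ?_
      rw [← Finset.sum_subset hsub]
      · refine Finset.sum_congr rfl fun x hx => ?_
        rw [Finset.mem_range] at hu hv hx
        rw [sum_residues hR hu hv hx]
      · intro x _ hx
        rw [Finset.mem_range] at hx
        simp [indicator, hx]
    · intro v _ hv
      rw [Finset.mem_range] at hv
      simp [indicator, hv]
  · intro u _ hu
    rw [Finset.mem_range] at hu
    simp [indicator, hu]

end ACZkC

namespace ACZkC

/-! ### Random instances -/

section Random

variable {k n m R : ℕ}

/-- Restriction to a subset of the coordinates is a surjective homomorphism, so its fibres all have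
the same size `c`. -/
theorem sum_comp_of_injective {α β F M : Type*} [Fintype α] [Fintype β] [DecidableEq α]
    [DecidableEq β] [AddGroup F] [Fintype F] [DecidableEq F] [AddCommMonoid M] {ι : α → β}
    (hι : Function.Injective ι) (φ : (α → F) → M) :
    ∃ c : ℕ, Fintype.card (β → F) = c * Fintype.card (α → F) ∧
      ∑ w : β → F, φ (w ∘ ι) = c • ∑ v : α → F, φ v := by
  let T : (β → F) →+ (α → F) := ⟨⟨fun w => w ∘ ι, rfl⟩, fun _ _ => rfl⟩
  have hT : Function.Surjective T := fun v => ⟨Function.extend ι v 0, Function.extend_comp hι v 0⟩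
  have hfib : ∀ v, (Finset.univ.filter fun w => T w = v).card =
      (Finset.univ.filter fun w => T w = 0).card := fun v =>
    AddMonoidHom.card_fiber_eq_of_mem_range T (hT v) (hT 0)
  refine ⟨(Finset.univ.filter fun w => T w = 0).card, ?_, ?_⟩
  · rw [← Finset.card_univ, Finset.card_eq_sum_card_fiberwise (f := T) (t := Finset.univ)
      fun _ _ => Finset.mem_coe.2 (Finset.mem_univ _)]
    simp only [hfib, Finset.sum_const, Finset.card_univ, smul_eq_mul, Nat.mul_comm]
  · rw [← Finset.sum_fiberwise Finset.univ T, Finset.smul_sum]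
    refine Finset.sum_congr rfl fun v _ => ?_
    rw [← hfib v, ← Finset.sum_const]
    refine Finset.sum_congr rfl fun w hw => ?_
    exact congrArg φ (Finset.mem_filter.1 hw).2

theorem expect_uniform {α : Type*} [Fintype α] [Nonempty α] (φ : α → ENNReal) :
    expect (PMF.uniformOfFintype α) φ = (Fintype.card α : ENNReal)⁻¹ * ∑ x, φ x := by
  simp only [expect, PMF.uniformOfFintype_apply, tsum_fintype, Finset.mul_sum]

/-- A sub-instance of a uniform instance is uniform. Different sub-instances are dependent, but only
linearity of expectation will be used. -/
theorem expect_sub [NeZero R] (st : Fin k → ℕ) (h : ∀ i, st i + m ≤ n) (φ : Instance k m R → ENNReal) :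
    expect (PMF.uniformOfFintype (Instance k n R)) (fun w => φ (w.sub st h)) =
      expect (PMF.uniformOfFintype (Instance k m R)) φ := by
  classical
  let ι : (graph k m).edgeSet → (graph k n).edgeSet := fun e =>
    ⟨e.1.map fun x => (x.1, ⟨st x.1 + x.2, by have := h x.1; omega⟩), by
      obtain ⟨e, he⟩ := e
      induction e with
      | _ x y => exact he⟩
  have hι : Function.Injective ι := by
    intro e e' hee
    refine Subtype.ext (Sym2.map.injective ?_ (congrArg Subtype.val hee))
    intro x y hxy
    have h1 : x.1 = y.1 := (Prod.ext_iff.1 hxy).1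
    have h2 := congrArg Fin.val (Prod.ext_iff.1 hxy).2
    simp only [h1] at h2
    exact Prod.ext h1 (Fin.ext (by omega))
  obtain ⟨c, hc, hs⟩ := sum_comp_of_injective (F := Fin R) hι φ
  have hs' : ∑ w : Instance k n R, φ (w.sub st h) = c • ∑ v, φ v := hs
  rw [expect_uniform, expect_uniform, hs', nsmul_eq_mul, ← mul_assoc]
  congr 1
  have hc0 : (c : ENNReal) ≠ 0 := by
    intro h0
    rw [Nat.cast_eq_zero] at h0
    rw [h0, zero_mul] at hc
    exact Fintype.card_ne_zero hc
  rw [show Fintype.card (Instance k n R) = c * Fintype.card (Instance k m R) from hc,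
    Nat.cast_mul, ENNReal.mul_inv (Or.inl hc0) (Or.inl (ENNReal.natCast_ne_top c)), mul_comm _ (c : ENNReal),
    ← mul_assoc, ENNReal.mul_inv_cancel hc0 (ENNReal.natCast_ne_top c), one_mul]

/-- The weight of a tuple in `ZMod R`. -/
def Instance.weightZ (w : Instance k n R) (f : Fin k → Fin n) : ZMod R :=
  ∑ p ∈ Finset.univ.filter (fun p : Fin k × Fin k => p.1 < p.2),
    (w.entry (p.1, f p.1) (p.2, f p.2) : ZMod R)

theorem Instance.counting_eq_card (w : Instance k n R) :
    counting k n R w = ∑ f : Fin k → Fin n, if w.weightZ f = 0 then 1 else 0 := by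
  rw [counting, w.card_zeroCliques]
  refine Finset.sum_congr rfl fun f _ => ?_
  rw [← w.weight_eq_wt]
  refine if_congr ?_ rfl rfl
  rw [w.weight_tuple, Instance.weightZ, ← Nat.cast_sum, ZMod.natCast_eq_zero_iff]

theorem Instance.weightZ_add (w w' : Instance k n R) (f : Fin k → Fin n) :
    (w + w').weightZ f = w.weightZ f + w'.weightZ f := by
  simp only [Instance.weightZ, ← Finset.sum_add_distrib]
  refine Finset.sum_congr rfl fun p _ => ?_
  unfold Instance.entry
  split_ifs
  · rw [Pi.add_apply, Fin.val_add, ZMod.natCast_mod, Nat.cast_add]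
  · simp

/-- The instance with weights `a u v` between the parts `i` and `j`, and zero elsewhere. -/
def pairInstance [NeZero R] (i j : Fin k) (a : Fin n × Fin n → Fin R) : Instance k n R := fun e =>
  ∑ p : Fin n × Fin n, if e.1 = s((i, p.1), (j, p.2)) then a p else 0

theorem weightZ_pairInstance [NeZero R] {i j : Fin k} (hij : i < j) (a : Fin n × Fin n → Fin R)
    (f : Fin k → Fin n) :
    (pairInstance i j a).weightZ f = ((a (f i, f j) : ℕ) : ZMod R) := by
  unfold Instance.weightZ
  rw [Finset.sum_eq_single (i, j)]
  · unfold Instance.entry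
    rw [dif_pos (by simpa using hij.ne)]
    unfold pairInstance
    rw [Finset.sum_eq_single (f i, f j)]
    · simp
    · intro p _ hp
      rw [if_neg]
      intro h
      simp only [Sym2.eq_iff, Prod.mk.injEq] at h
      rcases h with h | h
      · exact hp (Prod.ext h.1.2.symm h.2.2.symm)
      · exact hij.ne h.1.1
    · simp
  · rintro ⟨i', j'⟩ hp hne
    have hlt : i' < j' := (Finset.mem_filter.1 hp).2
    unfold Instance.entry
    split_ifs
    · unfold pairInstance
      rw [Finset.sum_eq_zero]
      · simp
      · intro p _
        rw [if_neg]
        intro h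
        simp only [Sym2.eq_iff, Prod.mk.injEq] at h
        rcases h with h | h
        · exact hne (Prod.ext h.1.1 h.2.1)
        · rw [h.1.1, h.2.1] at hlt
          exact hlt.asymm hij
    · simp
  · intro h
    exact absurd (by simp [hij]) h

/-- Exchanging coordinate `i` of `g` with `u` is an involution on the pairs `(g, u)`. -/
theorem sum_update {M : Type*} [AddCommMonoid M] (F : (Fin k → Fin n) → M) (i : Fin k) :
    ∑ g : Fin k → Fin n, ∑ u : Fin n, F (Function.update g i u) = n • ∑ g, F g := by
  have hinv : Function.Involutive fun p : (Fin k → Fin n) × Fin n =>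
      (Function.update p.1 i p.2, p.1 i) := by
    rintro ⟨g, u⟩
    simp
  have h := Equiv.sum_comp hinv.toPerm fun p => F p.1
  rw [Fintype.sum_prod_type, Fintype.sum_prod_type] at h
  simp only [Finset.sum_const, Finset.card_univ, Fintype.card_fin] at h
  rw [Finset.smul_sum, ← h]
  rfl

/-- The number of zero cliques that agree with `g` outside of the parts `i` and `j`. -/
def Instance.pairCount (w : Instance k n R) (i j : Fin k) (g : Fin k → Fin n) : ℕ :=
  ∑ p : Fin n × Fin n,
    if w.weightZ (Function.update (Function.update g i p.1) j p.2) = 0 then 1 else 0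

theorem Instance.sum_pairCount (w : Instance k n R) (i j : Fin k) :
    ∑ g, w.pairCount i j g = n ^ 2 * counting k n R w := by
  simp only [Instance.pairCount, Fintype.sum_prod_type]
  rw [sum_update (fun g => ∑ v, if w.weightZ (Function.update g j v) = 0 then 1 else 0) i,
    sum_update (fun g => if w.weightZ g = 0 then 1 else 0) j, w.counting_eq_card,
    smul_eq_mul, smul_eq_mul]
  ring

/-- Exactly one of the `R` values of `x` makes the sum zero; it contributes `2`, and the others
contribute `1`. -/
theorem sum_two_pow [NeZero R] (c : ZMod R) :
    ∑ x : Fin R, 2 ^ (if c + ((x : ℕ) : ZMod R) = 0 then 1 else 0) = R + 1 := by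
  have hx : ∀ x : Fin R, 2 ^ (if c + ((x : ℕ) : ZMod R) = 0 then 1 else 0) =
      1 + if x = ⟨(-c).val, ZMod.val_lt _⟩ then 1 else 0 := by
    intro x
    have : c + ((x : ℕ) : ZMod R) = 0 ↔ x = ⟨(-c).val, ZMod.val_lt _⟩ := by
      rw [add_comm, add_eq_zero_iff_eq_neg, Fin.ext_iff]
      constructor
      · intro h
        have := congrArg ZMod.val h
        rwa [ZMod.val_cast_of_lt x.2] at this
      · intro h
        simp only at h
        rw [h, ZMod.natCast_zmod_val]
    by_cases h : x = ⟨(-c).val, ZMod.val_lt _⟩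
    · rw [if_pos (this.2 h), if_pos h]; norm_num
    · rw [if_neg (mt this.1 h), if_neg h]; norm_num
  simp only [hx, Finset.sum_add_distrib, Finset.sum_ite_eq', Finset.mem_univ, if_true]
  simp

/-- The exponential moment is `(1 + 1 / R) ^ (n ^ 2)`. Adding fresh uniform weights `a` on the edges
between the parts `i` and `j` keeps the instance uniform; each completion uses exactly one of these
weights, so for a fixed `w` the moment factors over the `n ^ 2` pairs. -/
theorem sum_two_pow_pairCount [NeZero R] {i j : Fin k} (hij : i < j) (g : Fin k → Fin n) :
    R ^ n ^ 2 * ∑ w : Instance k n R, 2 ^ w.pairCount i j g =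
      Fintype.card (Instance k n R) * (R + 1) ^ n ^ 2 := by
  have hsq : n ^ 2 = Fintype.card (Fin n × Fin n) := by simp [pow_two]
  have hcard : R ^ n ^ 2 = Fintype.card (Fin n × Fin n → Fin R) := by
    rw [Fintype.card_fun, Fintype.card_fin, hsq]
  calc _ = ∑ a : Fin n × Fin n → Fin R, ∑ w : Instance k n R, 2 ^ w.pairCount i j g := by
        rw [Finset.sum_const, Finset.card_univ, smul_eq_mul, hcard]
    _ = ∑ a : Fin n × Fin n → Fin R, ∑ w : Instance k n R,
          2 ^ (w + pairInstance i j a).pairCount i j g := by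
        refine Finset.sum_congr rfl fun a _ => ?_
        -- Translation by a fixed instance permutes the instances.
        exact (Fintype.sum_equiv (Equiv.addRight (pairInstance i j a))
          (fun w => 2 ^ (w + pairInstance i j a).pairCount i j g) _ fun _ => rfl).symm
    _ = ∑ w : Instance k n R, ∑ a : Fin n × Fin n → Fin R, ∏ p : Fin n × Fin n,
          2 ^ (if w.weightZ (Function.update (Function.update g i p.1) j p.2) +
            ((a p : ℕ) : ZMod R) = 0 then 1 else 0) := by
        rw [Finset.sum_comm]
        refine Finset.sum_congr rfl fun w _ => Finset.sum_congr rfl fun a _ => ?_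
        rw [Instance.pairCount, ← Finset.prod_pow_eq_pow_sum]
        refine Finset.prod_congr rfl fun p _ => ?_
        rw [Instance.weightZ_add, weightZ_pairInstance hij]
        simp [Function.update_of_ne hij.ne]
    _ = ∑ w : Instance k n R, (R + 1) ^ n ^ 2 := by
        refine Finset.sum_congr rfl fun w _ => ?_
        have h := Finset.prod_univ_sum (fun _ : Fin n × Fin n => (Finset.univ : Finset (Fin R)))
          fun p x => 2 ^ (if w.weightZ (Function.update (Function.update g i p.1) j p.2) +
            ((x : ℕ) : ZMod R) = 0 then 1 else 0)
        rw [Fintype.piFinset_univ] at h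
        rw [← h]
        simp only [sum_two_pow, Finset.prod_const, Finset.card_univ, ← hsq]
    _ = _ := by rw [Finset.sum_const, Finset.card_univ, smul_eq_mul]

/-- A tail bound for the number of zero cliques. -/
theorem card_counting_gt [NeZero R] (hk : 2 ≤ k) {r b : ℕ} (hb : n ^ k * r ≤ n ^ 2 * b) (hn : 0 < n) :
    (Finset.univ.filter fun w : Instance k n R => b < counting k n R w).card *
      (2 ^ r * R ^ n ^ 2) ≤ n ^ k * (Fintype.card (Instance k n R) * (R + 1) ^ n ^ 2) := by
  have hij : (⟨0, by omega⟩ : Fin k) < ⟨1, by omega⟩ := Nat.zero_lt_one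
  generalize (⟨0, by omega⟩ : Fin k) = i at hij
  generalize (⟨1, by omega⟩ : Fin k) = j at hij
  -- Pigeonhole: the counts for the `n ^ k` choices of `g` add up to `n ^ 2` times the number of
  -- zero cliques, so one of them exceeds `r`.
  have hex : ∀ w : Instance k n R, b < counting k n R w → ∃ g, r < w.pairCount i j g := by
    intro w hw
    by_contra! h
    have h1 := Finset.sum_le_sum fun g (_ : g ∈ Finset.univ) => h g
    rw [w.sum_pairCount] at h1
    simp only [Finset.sum_const, Finset.card_univ, Fintype.card_fun, Fintype.card_fin,
      smul_eq_mul] at h1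
    have : n ^ 2 * b < n ^ 2 * counting k n R w := Nat.mul_lt_mul_of_pos_left hw (by positivity)
    omega
  -- Markov's inequality for `2 ^ pairCount`, together with the union bound over `g`.
  have h1 : (Finset.univ.filter fun w : Instance k n R => b < counting k n R w).card * 2 ^ r ≤
      ∑ g : Fin k → Fin n, ∑ w : Instance k n R, 2 ^ w.pairCount i j g := by
    rw [Finset.sum_comm, ← smul_eq_mul, ← Finset.sum_const]
    refine (Finset.sum_le_sum fun w hw => ?_).trans
      (Finset.sum_le_sum_of_subset (Finset.filter_subset _ _))
    obtain ⟨g, hg⟩ := hex w (Finset.mem_filter.1 hw).2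
    exact (Nat.pow_le_pow_right two_pos hg.le).trans
      (Finset.single_le_sum (f := fun g => 2 ^ w.pairCount i j g) (fun _ _ => Nat.zero_le _)
        (Finset.mem_univ g))
  calc _ = R ^ n ^ 2 * ((Finset.univ.filter fun w : Instance k n R =>
          b < counting k n R w).card * 2 ^ r) := by ring
    _ ≤ R ^ n ^ 2 * ∑ g : Fin k → Fin n, ∑ w : Instance k n R, 2 ^ w.pairCount i j g :=
        Nat.mul_le_mul_left _ h1
    _ = _ := by
        rw [Finset.mul_sum]
        simp only [sum_two_pow_pairCount hij, Finset.sum_const, Finset.card_univ, Fintype.card_fun,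
          Fintype.card_fin, smul_eq_mul]

end Random

end ACZkC

namespace ACZkC

/-! ### Building blocks for expressions -/

namespace Expr

variable {σ : State}

/-- The expression `∑ i < n, f i`. -/
def sum : ℕ → (ℕ → Expr) → Expr
  | 0, _ => lit 0
  | n + 1, f => sum n f + f n

@[simp] theorem eval_sum (n : ℕ) (f : ℕ → Expr) :
    (sum n f).eval σ = ∑ i ∈ Finset.range n, (f i).eval σ := by
  induction n with
  | zero => rfl
  | succ n ih => rw [sum, eval_add, ih, Finset.sum_range_succ]

/-- The expression `e ^ n`. -/
def pow (e : Expr) : ℕ → Expr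
  | 0 => lit 1
  | n + 1 => pow e n * e

@[simp] theorem eval_pow (e : Expr) (n : ℕ) : (e.pow n).eval σ = e.eval σ ^ n := by
  induction n with
  | zero => rfl
  | succ n ih => rw [pow, eval_mul, ih, pow_succ]

/-- The expression that is `1` if `e = 0`, and else `0`. -/
def isZero (e : Expr) : Expr := lit 1 - e

@[simp] theorem eval_isZero (e : Expr) : e.isZero.eval σ = if e.eval σ = 0 then 1 else 0 := by
  change 1 - e.eval σ = _
  split_ifs <;> omega

/-- The expression that selects `f x` for `x < n`. -/
def select (n : ℕ) (x : Expr) (f : ℕ → Expr) : Expr :=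
  sum n fun t => isZero ((x - lit t) + (lit t - x)) * f t

theorem eval_select {n : ℕ} {x : Expr} {f : ℕ → Expr} (hx : x.eval σ < n) :
    (select n x f).eval σ = (f (x.eval σ)).eval σ := by
  rw [select, eval_sum, Finset.sum_eq_single (x.eval σ)]
  · simp
  · intro t _ ht
    rw [eval_mul, eval_isZero, if_neg, zero_mul]
    simp only [eval_add, eval_sub, eval_lit]
    omega
  · simp [hx]

/-- The entry of the adjacency matrix for vertex `u` of part `i` and vertex `v` of part `j`. -/
def entry (k i : ℕ) (u : Expr) (j : ℕ) (v : Expr) : Expr :=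
  load ((lit i * var 0 + u) * (lit k * var 0) + (lit j * var 0 + v))

@[simp] theorem eval_entry (k i : ℕ) (u : Expr) (j : ℕ) (v : Expr) :
    (entry k i u j v).eval σ = σ.mem (addr k (σ.reg 0) i (u.eval σ) j (v.eval σ)) := rfl

/-- The weight of a tuple. -/
def weight (k : ℕ) (v : ℕ → Expr) : Expr := sum k fun j => sum j fun i => entry k i (v i) j (v j)

@[simp] theorem eval_weight (k : ℕ) (v : ℕ → Expr) : (weight k v).eval σ =
    wt k (fun i u j v => σ.mem (addr k (σ.reg 0) i u j v)) fun i => (v i).eval σ := by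
  simp [weight, wt]

end Expr

/-- Registers below `40` that are not in the list have the same values. -/
def Agree (l : List ℕ) (σ σ' : State) : Prop := ∀ r < 40, r ∉ l → σ'.reg r = σ.reg r

theorem Agree.refl (l : List ℕ) (σ : State) : Agree l σ σ := fun _ _ _ => rfl

theorem Agree.set {l : List ℕ} {σ σ' : State} (h : Agree l σ σ') {x : ℕ} (hx : x ∈ l ∨ 40 ≤ x)
    (v : ℕ) : Agree l σ (σ'.set x v) := by
  intro r hr hl
  rw [State.set_reg, if_neg, h r hr hl]
  rintro rfl
  rcases hx with hx | hx
  · exact hl hx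
  · omega

theorem Agree.put {l : List ℕ} {σ σ' : State} (h : Agree l σ σ') (x v : ℕ) :
    Agree l σ (σ'.put x v) := h

theorem Agree.trans {l l' : List ℕ} {σ σ' σ'' : State} (h : Agree l σ σ') (h' : Agree l' σ' σ'')
    (hl : l' ⊆ l) : Agree l σ σ'' := fun r hr hr' => by
  rw [h' r hr fun hh => hr' (hl hh), h r hr hr']

/-! ### Commands for matrix multiplication

The variables are `0`: `n`, `1`: `R`, `2`: `m`, `3`: `7 ^ L`, `4`: `L`, `7`: the result, `16`: the
modulus, `17`: `M ^ 2`, `18`: `M ^ 3`, `19`: the index in the main loop, `23`: `2 ^ L * 2 ^ L`,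
`30`: the block size `M`. Here `2 ^ L = m ^ Q`. -/

section Matrix

open ACZkC.Expr ACZkC.Cmd

/-- An entry in the table of an algorithm for matrix multiplication. -/
def tableEntry (S : List ℤ) (t : ℕ) : Expr :=
  -- Words are natural numbers, so `-1` is represented by the modulus in register `16` minus one.
  if S.getD t 0 = -1 then var 16 - lit 1 else lit (S.getD t 0).toNat

/-- The entries of a table are at least `-1`. -/
def TableOk (S : List ℤ) : Prop := ∀ t, -1 ≤ S.getD t 0

theorem tableOk_of_lt {S : List ℤ} (h : ∀ t < S.length, -1 ≤ S.getD t 0) : TableOk S := by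
  intro t
  rcases lt_or_ge t S.length with ht | ht
  · exact h t ht
  · rw [List.getD_eq_default _ _ ht]
    norm_num

theorem cast_eval_tableEntry {σ : State} {S : List ℤ} (hS : TableOk S) {N : ℕ} (hN : 0 < N)
    (h16 : σ.reg 16 = N) (t : ℕ) :
    (((tableEntry S t).eval σ : ℕ) : ZMod N) = ((S.getD t 0 : ℤ) : ZMod N) := by
  have := hS t
  unfold tableEntry
  split_ifs with h
  · rw [h, eval_sub, eval_var, eval_lit, h16, Nat.cast_sub hN]
    simp
  · rw [eval_lit]
    have h0 : 0 ≤ S.getD t 0 := by omega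
    conv_rhs => rw [← Int.toNat_of_nonneg h0]
    rw [Int.cast_natCast]

/-- The variables that are modified when a coefficient is computed. -/
def coefVars : List ℕ := [24, 25, 26, 27, 28]

/-- One more factor for the coefficient. -/
def coefStep (S : List ℤ) : Cmd :=
  seq (assign 24 ((var 24 * select 28 (lit 4 * (var 26 % lit 7) + lit 2 * (var 27 % lit 2) +
    var 28 % lit 2) (tableEntry S)) % var 16))
  (seq (assign 26 (var 26 / lit 7))
  (seq (assign 27 (var 27 / lit 2))
  (assign 28 (var 28 / lit 2))))

theorem coefStep_spec {B : ℕ} {σ : State} {S : List ℤ} (hS : TableOk S) (hN : 0 < σ.reg 16) :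
    HX B (coefStep S) σ 1 fun σ' => Agree coefVars σ σ' ∧ σ'.mem = σ.mem ∧
      σ'.reg 25 = σ.reg 25 ∧ σ'.reg 26 = σ.reg 26 / 7 ∧ σ'.reg 27 = σ.reg 27 / 2 ∧
      σ'.reg 28 = σ.reg 28 / 2 ∧ ((σ'.reg 24 : ℕ) : ZMod (σ.reg 16)) = (σ.reg 24 : ℕ) *
        ((S.getD (4 * (σ.reg 26 % 7) + 2 * (σ.reg 27 % 2) + σ.reg 28 % 2) 0 : ℤ) : ZMod (σ.reg 16)) := by
  refine HX.of_lt fun hB hr hm => ?_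
  have h16 := hr 16 (by norm_num)
  have h26 := hr 26 (by norm_num)
  have h27 := hr 27 (by norm_num)
  have h28 := hr 28 (by norm_num)
  have hd1 := Nat.div_le_self (σ.reg 26) 7
  have hd2 := Nat.div_le_self (σ.reg 27) 2
  have hd3 := Nat.div_le_self (σ.reg 28) 2
  -- The table has `28 = 7 * 4` entries.
  have hsel := eval_select (n := 28) (σ := σ) (x := lit 4 * (var 26 % lit 7) +
    lit 2 * (var 27 % lit 2) + var 28 % lit 2) (f := tableEntry S) (by
      simp only [eval_add, eval_mul, eval_mod, eval_lit, eval_var]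
      omega)
  refine HX.assign_seq le_rfl ?_ (HX.assign_seq le_rfl ?_ (HX.assign_seq le_rfl ?_
    (HX.assign le_rfl ?_ ⟨?_, ?_⟩)))
  · exact (Nat.mod_lt _ hN).trans h16
  · simp [State.set_reg]; omega
  · simp [State.set_reg]; omega
  · simp [State.set_reg]; omega
  · exact ((((Agree.refl _ _).set (by decide) _).set (by decide) _).set (by decide) _).set
      (by decide) _
  · refine ⟨rfl, ?_, ?_, ?_, ?_, ?_⟩
    · simp [State.set_reg]
    · simp [State.set_reg]
    · simp [State.set_reg]
    · simp [State.set_reg]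
    · rw [← cast_eval_tableEntry hS hN rfl]
      simp only [eval_add, eval_mul, eval_mod, eval_lit, eval_var] at hsel
      simp [State.set_reg, hsel]

/-- Computation of a coefficient. -/
def coefCmd (S : List ℤ) (Q : ℕ) : Cmd :=
  seq (assign 24 (lit 1))
  (seq (assign 26 (var 19 % var 3))
  (seq (assign 27 (var 22 / pow (var 2) Q))
  (seq (assign 28 (var 22 % pow (var 2) Q))
  (loop 25 4 (coefStep S)))))

theorem coefCmd_spec {B L N Q : ℕ} {σ : State} {S : List ℤ} (hS : TableOk S) (h16 : σ.reg 16 = N)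
    (hN : 0 < N) (hL : σ.reg 4 = L) :
    HX B (coefCmd S Q) σ (L + 1) fun σ' => Agree coefVars σ σ' ∧ σ'.mem = σ.mem ∧
      ((σ'.reg 24 : ℕ) : ZMod N) = ((coef S L (σ.reg 19 % σ.reg 3) (σ.reg 22 / σ.reg 2 ^ Q)
        (σ.reg 22 % σ.reg 2 ^ Q) : ℤ) : ZMod N) := by
  refine HX.of_lt fun hB hr hm => ?_
  have h19 := hr 19 (by norm_num)
  have h22 := hr 22 (by norm_num)
  have hd1 := Nat.mod_le (σ.reg 19) (σ.reg 3)
  have hd2 := Nat.div_le_self (σ.reg 22) (σ.reg 2 ^ Q)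
  have hd3 := Nat.mod_le (σ.reg 22) (σ.reg 2 ^ Q)
  refine HX.assign_seq (by omega) ?_ (HX.assign_seq (by omega) ?_ (HX.assign_seq (by omega) ?_
    (HX.assign_seq (by omega) ?_ ?_)))
  · simp; omega
  · simp [State.set_reg]; omega
  · simp [State.set_reg]; omega
  · simp [State.set_reg]; omega
  -- Invariant: the product of the factors found so far, times the coefficient that belongs to the
  -- remaining digits, is the coefficient sought.
  · refine (HX.loop (X := 1) (N := L) (fun t σ' => t ≤ L ∧ Agree coefVars σ σ' ∧ σ'.mem = σ.mem ∧
      σ'.reg 25 = t ∧ ((σ'.reg 24 : ℕ) : ZMod N) *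
        ((coef S (L - t) (σ'.reg 26) (σ'.reg 27) (σ'.reg 28) : ℤ) : ZMod N) =
        ((coef S L (σ.reg 19 % σ.reg 3) (σ.reg 22 / σ.reg 2 ^ Q)
          (σ.reg 22 % σ.reg 2 ^ Q) : ℤ) : ZMod N)) le_rfl ?_ ?_ ?_ ?_ ?_).mono (by omega)
    · simpa [State.set_reg] using hL
    · intro _
      refine ⟨Nat.zero_le _, ?_, rfl, by simp [State.set_reg], by simp [State.set_reg]⟩
      exact (((((Agree.refl _ _).set (by decide) _).set (by decide) _).set (by decide) _).set
        (by decide) _).set (by decide) _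
    · rintro j σ' ⟨-, hag, -, h, -⟩
      exact ⟨h, (hag 4 (by norm_num) (by decide)).trans hL⟩
    · rintro j hj - σ' ⟨-, hag, hmem, h25, hc⟩
      have h16' : σ'.reg 16 = N := (hag 16 (by norm_num) (by decide)).trans h16
      refine (coefStep_spec hS (by omega)).weaken ?_
      rintro σ'' ⟨hag', hmem', h25', h26, h27, h28, hc'⟩
      refine ⟨h25'.trans h25, by omega, (hag.trans hag' (by simp)).set (by decide) _,
        hmem'.trans hmem, by simp [State.set_reg], ?_⟩
      rw [h16'] at hc'
      rw [← hc, show L - j = L - (j + 1) + 1 by omega]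
      simp only [State.set_reg]
      norm_num only
      rw [if_neg (by norm_num), if_neg (by norm_num), if_neg (by norm_num), if_neg (by norm_num),
        hc', h26, h27, h28, coef]
      push_cast
      ring
    · rintro σ' ⟨-, hag, hmem, -, hc⟩
      refine ⟨hag, hmem, ?_⟩
      rw [← hc, Nat.sub_self, coef]
      simp

/-- The variables that are modified when a matrix is filled. -/
def fillVars : List ℕ := [20, 21, 22, 24, 25, 26, 27, 28]

/-- Computation of an entry of a linear form of the algorithm. -/
def blockCmd (S : List ℤ) (Q : ℕ) (e : Expr) : Cmd :=
  seq (assign 21 (lit 0))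
  (loop 22 23 (seq (coefCmd S Q) (assign 21 ((var 21 + var 24 * e) % var 16))))

/-- One loop over `x < z * z` runs through the block indices `(x / z, x % z)`, while register `20`
holds the position inside the block. The hypothesis `he` says that `e` computes the matrix entry at
the current indices. -/
theorem blockCmd_spec {B L N Q M z : ℕ} {σ : State} {S : List ℤ} {e : Expr} {a : ℕ → ℕ → ℕ}
    (hS : TableOk S) (h16 : σ.reg 16 = N) (hN : 0 < N) (hL : σ.reg 4 = L) (hz : σ.reg 2 ^ Q = z)
    (hzL : z = 2 ^ L) (h23 : σ.reg 23 = z * z)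
    (he : ∀ σ', Agree fillVars σ σ' → σ'.reg 20 = σ.reg 20 → σ'.mem = σ.mem → e.eval σ' =
      a (σ'.reg 22 / z * M + σ.reg 20 / M) (σ'.reg 22 % z * M + σ.reg 20 % M)) :
    HX B (blockCmd S Q e) σ (z * z * (L + 1) + 1) fun σ' => Agree fillVars σ σ' ∧
      σ'.mem = σ.mem ∧ σ'.reg 20 = σ.reg 20 ∧ ((σ'.reg 21 : ℕ) : ZMod N) =
        block S L M (σ.reg 19 % σ.reg 3) (fun u v => (a u v : ZMod N)) (σ.reg 20 / M)
          (σ.reg 20 % M) := by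
  refine HX.of_lt fun hB hr hm => ?_
  refine HX.assign_seq (by omega) (by simp; omega) ?_
  refine HX.loop (N := z * z) (fun x σ' => Agree fillVars σ σ' ∧ σ'.mem = σ.mem ∧
    σ'.reg 20 = σ.reg 20 ∧ σ'.reg 22 = x ∧ ((σ'.reg 21 : ℕ) : ZMod N) =
      ∑ i ∈ Finset.range x, ((coef S L (σ.reg 19 % σ.reg 3) (i / z) (i % z) : ℤ) : ZMod N) *
        (a (i / z * M + σ.reg 20 / M) (i % z * M + σ.reg 20 % M) : ℕ))
    (by omega) ?_ ?_ ?_ ?_ ?_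
  · simpa [State.set_reg] using h23
  · intro _
    refine ⟨?_, rfl, by simp [State.set_reg], by simp [State.set_reg], by simp [State.set_reg]⟩
    exact ((Agree.refl _ _).set (by decide) _).set (by decide) _
  · rintro j σ' ⟨hag, -, -, h, -⟩
    exact ⟨h, (hag 23 (by norm_num) (by decide)).trans h23⟩
  · rintro j hj - σ' ⟨hag, hmem, h20, h22, hs⟩
    refine HX.seq (coefCmd_spec hS ((hag 16 (by norm_num) (by decide)).trans h16) hN
      ((hag 4 (by norm_num) (by decide)).trans hL)) ?_
    rintro σ₁ ⟨hag₁, hmem₁, hc⟩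
    have e20 : σ₁.reg 20 = σ.reg 20 := (hag₁ 20 (by norm_num) (by decide)).trans h20
    have e21 : σ₁.reg 21 = σ'.reg 21 := hag₁ 21 (by norm_num) (by decide)
    have e22 : σ₁.reg 22 = j := (hag₁ 22 (by norm_num) (by decide)).trans h22
    have hag₂ := hag.trans hag₁ (by decide)
    have e16 : σ₁.reg 16 = N := (hag₂ 16 (by norm_num) (by decide)).trans h16
    have ee := he σ₁ hag₂ e20 (hmem₁.trans hmem)
    rw [hag 19 (by norm_num) (by decide), hag 3 (by norm_num) (by decide),
      hag 2 (by norm_num) (by decide), hz, h22] at hc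
    refine HX.assign (by omega) ?_ ⟨?_, ?_, ?_, ?_, ?_, ?_⟩
    · have h16B := hr 16 (by norm_num)
      simp only [eval_mod, eval_var, e16]
      exact (Nat.mod_lt _ hN).trans (h16 ▸ h16B)
    · simpa [State.set_reg] using e22
    · exact (hag₂.set (by decide) _).set (by decide) _
    · exact hmem₁.trans hmem
    · simpa [State.set_reg] using e20
    · simp [State.set_reg]
    · rw [Finset.sum_range_succ, ← hs, ← hc]
      simp only [State.set_reg, eval_mod, eval_add, eval_mul, eval_var, e16, ee, e21, e22]
      norm_num
  · rintro σ' ⟨hag, hmem, h20, -, hs⟩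
    refine ⟨hag, hmem, h20, hs.trans ?_⟩
    rw [block, ← hzL]
    exact sum_range_mul z z fun i j => ((coef S L (σ.reg 19 % σ.reg 3) i j : ℤ) : ZMod N) *
        (a (i * M + σ.reg 20 / M) (j * M + σ.reg 20 % M) : ℕ)

/-- The start of the `c`-th matrix in memory. -/
def matrixStart (k c : ℕ) : Expr :=
  (lit k * var 0) * (lit k * var 0) + lit c * var 17

/-- Computation of a linear form of the algorithm. -/
def fillCmd (k c : ℕ) (S : List ℤ) (Q : ℕ) (e : Expr) : Cmd :=
  loop 20 17 (seq (blockCmd S Q e) (store (matrixStart k c + var 20) (var 21)))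

/-- Matrix number `c` is stored behind the input, in its own stretch of `M * M` cells. The frame
condition keeps the input and the other matrices intact. -/
theorem fillCmd_spec {B L N Q M z k c : ℕ} {σ : State} {S : List ℤ} {e : Expr}
    {a : ℕ → ℕ → ℕ} (hS : TableOk S) (h16 : σ.reg 16 = N) (hN : 0 < N) (hL : σ.reg 4 = L)
    (hz : σ.reg 2 ^ Q = z) (hzL : z = 2 ^ L) (h23 : σ.reg 23 = z * z) (h17 : σ.reg 17 = M * M)
    (he : ∀ σ', Agree fillVars σ σ' →
      (∀ x < (k * σ.reg 0) * (k * σ.reg 0), σ'.mem x = σ.mem x) → e.eval σ' =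
      a (σ'.reg 22 / z * M + σ'.reg 20 / M) (σ'.reg 22 % z * M + σ'.reg 20 % M)) :
    HX B (fillCmd k c S Q e) σ (M * M * (z * z * (L + 1) + 1) + 1) fun σ' =>
      Agree fillVars σ σ' ∧
      (∀ x, x < (k * σ.reg 0) * (k * σ.reg 0) + c * (M * M) ∨
        (k * σ.reg 0) * (k * σ.reg 0) + c * (M * M) + M * M ≤ x → σ'.mem x = σ.mem x) ∧
      ∀ y < M * M, ((σ'.mem ((k * σ.reg 0) * (k * σ.reg 0) + c * (M * M) + y) : ℕ) : ZMod N) =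
        block S L M (σ.reg 19 % σ.reg 3) (fun u v => (a u v : ZMod N)) (y / M) (y % M) := by
  refine HX.of_lt fun hB hr hm => ?_
  generalize hb : (k * σ.reg 0) * (k * σ.reg 0) + c * (M * M) = b
  refine HX.loop (N := M * M) (fun y σ' => Agree fillVars σ σ' ∧ σ'.reg 20 = y ∧
      (∀ x, x < b ∨ b + M * M ≤ x → σ'.mem x = σ.mem x) ∧
      ∀ x < y, ((σ'.mem (b + x) : ℕ) : ZMod N) =
        block S L M (σ.reg 19 % σ.reg 3) (fun u v => (a u v : ZMod N)) (x / M) (x % M))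
    (by omega) h17 ?_ ?_ ?_ ?_
  · intro _
    exact ⟨(Agree.refl _ _).set (by decide) _, by simp [State.set_reg], fun _ _ => rfl,
      fun x hx => absurd hx (by omega)⟩
  · rintro j σ' ⟨hag, h, -⟩
    exact ⟨h, (hag 17 (by norm_num) (by decide)).trans h17⟩
  · rintro j hj - σ' ⟨hag, h20, hmem, hs⟩
    have hlow : ∀ x < (k * σ.reg 0) * (k * σ.reg 0), σ'.mem x = σ.mem x := fun x hx =>
      hmem x (Or.inl (by omega))
    refine HX.seq (blockCmd_spec (M := M) (a := a) hS ((hag 16 (by norm_num) (by decide)).trans h16)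
      hN ((hag 4 (by norm_num) (by decide)).trans hL)
      (by rw [hag 2 (by norm_num) (by decide), hz]) hzL
      ((hag 23 (by norm_num) (by decide)).trans h23) ?_) ?_
    · intro σ₁ hag₁ h20₁ hmem₁
      rw [← h20₁]
      exact he σ₁ (hag.trans hag₁ (by simp)) fun x hx => by rw [hmem₁, hlow x hx]
    · rintro σ₁ ⟨hag₁, hmem₁, h20₁, h21⟩
      have hag₂ := hag.trans hag₁ (by simp)
      rw [hag 19 (by norm_num) (by decide), hag 3 (by norm_num) (by decide), h20] at h21
      have haddr : (matrixStart k c + var 20).eval σ₁ = b + j := by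
        simp only [matrixStart, eval_add, eval_mul, eval_lit, eval_var]
        rw [hag₂ 0 (by norm_num) (by decide), hag₂ 17 (by norm_num) (by decide), h17, h20₁, h20, hb]
      refine HX.of_lt fun _ hr₁ _ => HX.store (by omega) (hr₁ 21 (by norm_num)) ?_
      rw [haddr]
      refine ⟨h20₁.trans h20, (hag₂.put _ _).set (by decide) _, by simp [State.set_reg], ?_, ?_⟩
      · intro x hx
        rw [State.set_mem, State.put_mem, if_neg (by omega), hmem₁, hmem x hx]
      · intro x hx
        rw [State.set_mem, State.put_mem]
        split_ifs with hxj
        · obtain rfl : x = j := by omega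
          exact h21
        · rw [hmem₁]
          exact hs x (by omega)
  · rintro σ' ⟨hag, -, h1, h2⟩
    exact ⟨hag, h1, h2⟩

end Matrix

end ACZkC

namespace ACZkC

/-! ### Counting for small ranges -/

section SmallRange

open ACZkC.Expr ACZkC.Cmd

variable {σ : State} {k κ n R B : ℕ}

theorem addr_lt {i u j v : ℕ} (hi : i < k) (hu : u < n) (hj : j < k) (hv : v < n) :
    addr k n i u j v < (k * n) * (k * n) := by
  have h : ∀ {i u}, i < k → u < n → i * n + u + 1 ≤ k * n := by
    intro i u hi hu
    have := Nat.mul_le_mul_right n (Nat.succ_le_of_lt hi)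
    rw [Nat.succ_mul] at this
    omega
  have h1 := Nat.mul_le_mul_right (k * n) (h hi hu)
  have h2 := h hj hv
  rw [Nat.add_mul, one_mul] at h1
  unfold addr
  omega

/-- For indices beyond `n` the computed address may point to unrelated cells; whatever is read
there, the indicator is zero. -/
theorem indicator_congr {p u v W W' : ℕ} (h : u < n → v < n → W = W') :
    indicator R n p u v W = indicator R n p u v W' := by
  unfold indicator
  by_cases huv : u < n ∧ v < n
  · rw [h huv.1 huv.2]
  · simp only [huv, false_and]

/-- Weights given by a memory. -/
def memWeight (μ : ℕ → ℕ) (k n i u j v : ℕ) : ℕ := μ (addr k n i u j v)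

theorem memWeight_congr {μ μ' : ℕ → ℕ} (hμ : ∀ x < (k * n) * (k * n), μ' x = μ x) {i u j v : ℕ}
    (hi : i < k) (hu : u < n) (hj : j < k) (hv : v < n) :
    memWeight μ' k n i u j v = memWeight μ k n i u j v := hμ _ (addr_lt hi hu hj hv)

theorem weightA_congr {E E' : ℕ → ℕ → ℕ → ℕ → ℕ} {y u v : ℕ} (hu : u < n) (hv : v < n)
    (h : ∀ i < κ + 3, ∀ u < n, ∀ j < κ + 3, ∀ v < n, E' i u j v = E i u j v) :
    weightA E' n κ y u v = weightA E n κ y u v := by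
  have hd : ∀ j, y / n ^ j % n < n := fun j => Nat.mod_lt _ (by omega)
  unfold weightA
  rw [h 0 (by omega) u hu 1 (by omega) v hv]
  congr 1
  refine Finset.sum_congr rfl fun j hj => ?_
  rw [Finset.mem_range] at hj
  rw [h 0 (by omega) u hu (j + 3) (by omega) _ (hd j)]
  congr 1
  refine Finset.sum_congr rfl fun i hi => ?_
  rw [Finset.mem_range] at hi
  exact h (i + 3) (by omega) _ (hd i) (j + 3) (by omega) _ (hd j)

theorem weightB_congr {E E' : ℕ → ℕ → ℕ → ℕ → ℕ} {y u v : ℕ} (hu : u < n) (hv : v < n)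
    (h : ∀ i < κ + 3, ∀ u < n, ∀ j < κ + 3, ∀ v < n, E' i u j v = E i u j v) :
    weightB E' n κ y u v = weightB E n κ y u v := by
  have hd : ∀ j, y / n ^ j % n < n := fun j => Nat.mod_lt _ (by omega)
  unfold weightB
  rw [h 1 (by omega) u hu 2 (by omega) v hv]
  congr 1
  refine Finset.sum_congr rfl fun j hj => ?_
  rw [Finset.mem_range] at hj
  exact h 1 (by omega) u hu (j + 3) (by omega) _ (hd j)

theorem weightC_congr {E E' : ℕ → ℕ → ℕ → ℕ → ℕ} {y u v : ℕ} (hu : u < n) (hv : v < n)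
    (h : ∀ i < κ + 3, ∀ u < n, ∀ j < κ + 3, ∀ v < n, E' i u j v = E i u j v) :
    weightC E' n κ y u v = weightC E n κ y u v := by
  have hd : ∀ j, y / n ^ j % n < n := fun j => Nat.mod_lt _ (by omega)
  unfold weightC
  rw [h 0 (by omega) v hv 2 (by omega) u hu]
  congr 1
  refine Finset.sum_congr rfl fun j hj => ?_
  rw [Finset.mem_range] at hj
  exact h 2 (by omega) u hu (j + 3) (by omega) _ (hd j)

namespace Expr

/-- The expression for `weightA`. -/
def weightA (κ : ℕ) (y u v : Expr) : Expr :=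
  entry (κ + 3) 0 u 1 v + sum κ fun j => entry (κ + 3) 0 u (j + 3) (y / pow (var 0) j % var 0) +
    sum j fun i => entry (κ + 3) (i + 3) (y / pow (var 0) i % var 0) (j + 3)
      (y / pow (var 0) j % var 0)

/-- The expression for `weightB`. -/
def weightB (κ : ℕ) (y v x : Expr) : Expr :=
  entry (κ + 3) 1 v 2 x + sum κ fun j => entry (κ + 3) 1 v (j + 3) (y / pow (var 0) j % var 0)

/-- The expression for `weightC`. -/
def weightC (κ : ℕ) (y x u : Expr) : Expr :=
  entry (κ + 3) 0 u 2 x + sum κ fun j => entry (κ + 3) 2 x (j + 3) (y / pow (var 0) j % var 0)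

theorem eval_weightA (y u v : Expr) : (weightA κ y u v).eval σ =
    ACZkC.weightA (memWeight σ.mem (κ + 3) (σ.reg 0)) (σ.reg 0) κ (y.eval σ) (u.eval σ)
      (v.eval σ) := by
  simp [weightA, ACZkC.weightA, memWeight]

theorem eval_weightB (y u v : Expr) : (weightB κ y u v).eval σ =
    ACZkC.weightB (memWeight σ.mem (κ + 3) (σ.reg 0)) (σ.reg 0) κ (y.eval σ) (u.eval σ)
      (v.eval σ) := by
  simp [weightB, ACZkC.weightB, memWeight]

theorem eval_weightC (y u v : Expr) : (weightC κ y u v).eval σ =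
    ACZkC.weightC (memWeight σ.mem (κ + 3) (σ.reg 0)) (σ.reg 0) κ (y.eval σ) (u.eval σ)
      (v.eval σ) := by
  simp [weightC, ACZkC.weightC, memWeight]

/-- The expression for `indicator`. -/
def indicator (p u v W : Expr) : Expr :=
  isZero ((u + lit 1 - var 0) + (v + lit 1 - var 0) + (W + p) % var 1)

theorem eval_indicator (p u v W : Expr) : (indicator p u v W).eval σ =
    ACZkC.indicator (σ.reg 1) (σ.reg 0) (p.eval σ) (u.eval σ) (v.eval σ) (W.eval σ) := by
  simp only [indicator, ACZkC.indicator, eval_isZero, eval_add, eval_sub, eval_mod, eval_var,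
    eval_lit]
  refine if_congr ?_ rfl rfl
  rw [Nat.dvd_iff_mod_eq_zero]
  omega

/-- The row of the current matrix entry. -/
def row (Q : ℕ) : Expr := var 22 / pow (var 2) Q * var 30 + var 20 / var 30

/-- The column of the current matrix entry. -/
def col (Q : ℕ) : Expr := var 22 % pow (var 2) Q * var 30 + var 20 % var 30

/-- The current digits of the vertices in the parts from `3` on. -/
def curRest : Expr := var 19 / var 3 / var 1 / var 1

/-- The current residue for the first matrix. -/
def curP : Expr := var 19 / var 3 / var 1 % var 1

/-- The current residue for the second matrix. -/
def curQ : Expr := var 19 / var 3 % var 1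

end Expr

/-- Summation over the products of the entries of the matrices. -/
def traceCmd (k : ℕ) : Cmd :=
  loop 20 18 (assign 7 ((var 7 +
    load (matrixStart k 0 + (var 20 / var 30 / var 30 * var 30 + var 20 / var 30 % var 30)) *
    load (matrixStart k 1 + (var 20 / var 30 % var 30 * var 30 + var 20 % var 30)) *
    load (matrixStart k 2 + (var 20 % var 30 * var 30 + var 20 / var 30 / var 30))) % var 16))

theorem traceCmd_spec {N M b : ℕ} {X : ℕ → ℕ → ℕ → ZMod N} (h16 : σ.reg 16 = N)
    (hN : σ.reg 7 < N) (h17 : σ.reg 17 = M * M) (h18 : σ.reg 18 = M * M * M) (h30 : σ.reg 30 = M)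
    (hb : (k * σ.reg 0) * (k * σ.reg 0) = b)
    (hX : ∀ c < 3, ∀ y < M * M, ((σ.mem (b + c * (M * M) + y) : ℕ) : ZMod N) =
      X c (y / M) (y % M)) :
    HX B (traceCmd k) σ (M * M * M + 1) fun σ' => Agree [7, 20] σ σ' ∧ σ'.mem = σ.mem ∧
      σ'.reg 7 < N ∧ ((σ'.reg 7 : ℕ) : ZMod N) = (σ.reg 7 : ℕ) +
        ∑ u ∈ Finset.range M, ∑ v ∈ Finset.range M, ∑ x ∈ Finset.range M,
          X 0 u v * X 1 v x * X 2 x u := by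
  have hX' : ∀ c < 3, ∀ u < M, ∀ v < M,
      ((σ.mem (b + c * (M * M) + (u * M + v)) : ℕ) : ZMod N) = X c u v := by
    intro c hc u hu v hv
    have h1 : u * M + v < M * M := by
      have := Nat.mul_le_mul_right M (Nat.succ_le_of_lt hu)
      rw [Nat.succ_mul] at this
      omega
    rw [hX c hc _ h1, Nat.mul_comm u M, Nat.mul_add_div (by omega), Nat.mul_add_mod,
      Nat.div_eq_of_lt hv, Nat.mod_eq_of_lt hv, Nat.add_zero]
  rw [show M * M * M + 1 = M * M * M * 1 + 1 by ring]
  refine HX.loop (N := M * M * M) (fun y σ' => Agree [7, 20] σ σ' ∧ σ'.mem = σ.mem ∧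
      σ'.reg 20 = y ∧ σ'.reg 7 < N ∧ ((σ'.reg 7 : ℕ) : ZMod N) = (σ.reg 7 : ℕ) +
        ∑ i ∈ Finset.range y, X 0 (i / M / M) (i / M % M) * X 1 (i / M % M) (i % M) *
          X 2 (i % M) (i / M / M)) le_rfl h18 ?_ ?_ ?_ ?_
  · intro _
    exact ⟨(Agree.refl _ _).set (by decide) _, rfl, by simp [State.set_reg],
      by simpa [State.set_reg] using hN, by simp [State.set_reg]⟩
  · rintro j σ' ⟨hag, -, h, -⟩
    exact ⟨h, (hag 18 (by norm_num) (by decide)).trans h18⟩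
  · rintro j hj - σ' ⟨hag, hmem, h20, hlt, hs⟩
    have hM : 0 < M := Nat.pos_of_ne_zero (by rintro rfl; omega)
    have e16 := (hag 16 (by norm_num) (by decide)).trans h16
    have e17 := (hag 17 (by norm_num) (by decide)).trans h17
    have e30 := (hag 30 (by norm_num) (by decide)).trans h30
    have e0 := hag 0 (by norm_num) (by decide)
    have hu : j / M / M < M := by
      rw [Nat.div_div_eq_div_mul]
      exact Nat.div_lt_of_lt_mul hj
    have hv : j / M % M < M := Nat.mod_lt _ hM
    have hx : j % M < M := Nat.mod_lt _ hM
    refine HX.of_lt fun _ hr _ => HX.assign le_rfl ?_ ⟨?_, ?_, hmem, ?_, ?_, ?_⟩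
    · exact (Nat.mod_lt _ (by rw [eval_var]; omega)).trans (hr 16 (by norm_num))
    · simpa [State.set_reg] using h20
    · exact (hag.set (by decide) _).set (by decide) _
    · simp [State.set_reg]
    · simp only [State.set_reg]
      norm_num only
      rw [if_pos trivial, eval_mod, eval_var, e16]
      exact Nat.mod_lt _ (by omega)
    · rw [Finset.sum_range_succ, ← add_assoc, ← hs, ← hX' 0 (by norm_num) _ hu _ hv,
        ← hX' 1 (by norm_num) _ hv _ hx, ← hX' 2 (by norm_num) _ hx _ hu]
      simp [State.set_reg, matrixStart, e16, e17, e30, e0, h20, hmem, hb]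
  · rintro σ' ⟨hag, hmem, -, hlt, hs⟩
    refine ⟨hag, hmem, hlt, hs.trans ?_⟩
    congr 1
    refine (sum_range_mul (M * M) M fun i x => X 0 (i / M) (i % M) * X 1 (i % M) x *
      X 2 x (i / M)).trans ?_
    exact sum_range_mul M M fun u v => ∑ x ∈ Finset.range M, X 0 u v * X 1 v x * X 2 x u

/-- One summand of the number of zero cliques. -/
def productCmd (κ Q : ℕ) : Cmd :=
  seq (fillCmd (κ + 3) 0 strassenA Q (Expr.indicator (var 1 - curP) (row Q) (col Q)
    (Expr.weightA κ curRest (row Q) (col Q))))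
  (seq (fillCmd (κ + 3) 1 strassenB Q (Expr.indicator (var 1 - curQ) (row Q) (col Q)
    (Expr.weightB κ curRest (row Q) (col Q))))
  (seq (fillCmd (κ + 3) 2 strassenC Q (Expr.indicator (curP + curQ) (row Q) (col Q)
    (Expr.weightC κ curRest (row Q) (col Q))))
  (traceCmd (κ + 3))))

/-- What the main loop for small ranges needs to know about a state. -/
structure SmallRange (κ Q n R m L M N : ℕ) (μ : ℕ → ℕ) (σ : State) : Prop where
  r0 : σ.reg 0 = n
  r1 : σ.reg 1 = R
  r2 : σ.reg 2 = m
  r3 : σ.reg 3 = 7 ^ L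
  r4 : σ.reg 4 = L
  r16 : σ.reg 16 = N
  r17 : σ.reg 17 = M * M
  r18 : σ.reg 18 = M * M * M
  r23 : σ.reg 23 = 2 ^ L * 2 ^ L
  r30 : σ.reg 30 = M
  r7 : σ.reg 7 < N
  pow : m ^ Q = 2 ^ L
  mem : ∀ x < ((κ + 3) * n) * ((κ + 3) * n), σ.mem x = μ x

variable {Q m L M N : ℕ} {μ : ℕ → ℕ}

theorem SmallRange.of_agree {l : List ℕ} {σ' : State} (h : SmallRange κ Q n R m L M N μ σ)
    (hag : Agree l σ σ') (hl : l ⊆ 7 :: 19 :: fillVars)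
    (hmem : ∀ x < ((κ + 3) * n) * ((κ + 3) * n), σ'.mem x = σ.mem x) (h7 : σ'.reg 7 < N) :
    SmallRange κ Q n R m L M N μ σ' := by
  have e : ∀ r < 40, r ∉ 7 :: 19 :: fillVars → σ'.reg r = σ.reg r := fun r hr hr' =>
    hag r hr fun hh => hr' (hl hh)
  constructor
  · rw [e 0 (by norm_num) (by decide), h.r0]
  · rw [e 1 (by norm_num) (by decide), h.r1]
  · rw [e 2 (by norm_num) (by decide), h.r2]
  · rw [e 3 (by norm_num) (by decide), h.r3]
  · rw [e 4 (by norm_num) (by decide), h.r4]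
  · rw [e 16 (by norm_num) (by decide), h.r16]
  · rw [e 17 (by norm_num) (by decide), h.r17]
  · rw [e 18 (by norm_num) (by decide), h.r18]
  · rw [e 23 (by norm_num) (by decide), h.r23]
  · rw [e 30 (by norm_num) (by decide), h.r30]
  · exact h7
  · exact h.pow
  · intro x hx
    rw [hmem x hx, h.mem x hx]

theorem strassenA_ok : TableOk strassenA := tableOk_of_lt (by decide)

theorem strassenB_ok : TableOk strassenB := tableOk_of_lt (by decide)

theorem strassenC_ok : TableOk strassenC := tableOk_of_lt (by decide)

/-- The three matrices in the trace for the digits `y` and the residues `p` and `q`. -/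
def cliqueMatrix (E : ℕ → ℕ → ℕ → ℕ → ℕ) (n R κ y p q : ℕ) : ℕ → ℕ → ℕ → ℕ
  | 0, u, v => indicator R n (R - p) u v (weightA E n κ y u v)
  | 1, u, v => indicator R n (R - q) u v (weightB E n κ y u v)
  | _, u, v => indicator R n (p + q) u v (weightC E n κ y u v)

theorem SmallRange.fill {c h : ℕ} {S : List ℤ} {e : Expr} {a : ℕ → ℕ → ℕ}
    (hS : TableOk S) (hσ : SmallRange κ Q n R m L M N μ σ) (h19 : σ.reg 19 = h)
    (he : ∀ σ' : State, σ'.reg 0 = n → σ'.reg 1 = R → σ'.reg 3 = 7 ^ L → σ'.reg 19 = h →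
      (∀ x < ((κ + 3) * n) * ((κ + 3) * n), σ'.mem x = μ x) →
      e.eval σ' = a ((row Q).eval σ') ((col Q).eval σ')) :
    HX B (fillCmd (κ + 3) c S Q e) σ (M * M * (2 ^ L * 2 ^ L * (L + 1) + 1) + 1) fun σ' =>
      SmallRange κ Q n R m L M N μ σ' ∧ σ'.reg 7 = σ.reg 7 ∧ Agree fillVars σ σ' ∧
      (∀ x, x < ((κ + 3) * n) * ((κ + 3) * n) + c * (M * M) ∨
        ((κ + 3) * n) * ((κ + 3) * n) + c * (M * M) + M * M ≤ x → σ'.mem x = σ.mem x) ∧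
      ∀ y < M * M, ((σ'.mem (((κ + 3) * n) * ((κ + 3) * n) + c * (M * M) + y) : ℕ) : ZMod N) =
        block S L M (h % 7 ^ L) (fun u v => (a u v : ZMod N)) (y / M) (y % M) := by
  have h7 := hσ.r7
  refine (fillCmd_spec (k := κ + 3) (a := a) hS hσ.r16 (by omega) hσ.r4
    (by rw [hσ.r2, hσ.pow]) rfl hσ.r23 hσ.r17 ?_).weaken ?_
  · intro σ' hag hmem
    rw [hσ.r0] at hmem
    rw [he σ' (by rw [hag 0 (by norm_num) (by decide), hσ.r0])
      (by rw [hag 1 (by norm_num) (by decide), hσ.r1])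
      (by rw [hag 3 (by norm_num) (by decide), hσ.r3])
      (by rw [hag 19 (by norm_num) (by decide), h19])
      (fun x hx => by rw [hmem x hx, hσ.mem x hx])]
    simp only [row, col, eval_add, eval_mul, eval_div, eval_mod, eval_var, eval_pow]
    rw [hag 30 (by norm_num) (by decide), hσ.r30, hag 2 (by norm_num) (by decide), hσ.r2, hσ.pow]
  · rw [hσ.r0, h19, hσ.r3]
    rintro σ' ⟨hag, hmem, hy⟩
    have e7 := hag 7 (by norm_num) (by decide)
    exact ⟨hσ.of_agree hag (by decide) (fun x hx => hmem x (Or.inl (by omega))) (e7 ▸ h7), e7, hag,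
      hmem, hy⟩

/-- The counter `h` is a mixed-radix number: lowest the Strassen index `r < 7 ^ L`, then `q` and `p`
below `R`, then the digits `y` of the remaining vertices. -/
theorem productCmd_spec {h : ℕ} (hσ : SmallRange κ Q n R m L M N μ σ) (h19 : σ.reg 19 = h)
    {a : ℕ → ℕ → ℕ → ℕ} (ha : a = cliqueMatrix (memWeight μ (κ + 3) n) n R κ
      (h / 7 ^ L / R / R) (h / 7 ^ L / R % R) (h / 7 ^ L % R)) :
    HX B (productCmd κ Q) σ (M * M * (2 ^ L * 2 ^ L * (L + 1) + 1) + 1 + M * M * M) fun σ' =>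
      SmallRange κ Q n R m L M N μ σ' ∧ Agree (7 :: fillVars) σ σ' ∧
      ((σ'.reg 7 : ℕ) : ZMod N) = (σ.reg 7 : ℕ) +
        ∑ u ∈ Finset.range M, ∑ v ∈ Finset.range M, ∑ x ∈ Finset.range M,
          block strassenA L M (h % 7 ^ L) (fun u v => (a 0 u v : ZMod N)) u v *
          block strassenB L M (h % 7 ^ L) (fun u v => (a 1 u v : ZMod N)) v x *
          block strassenC L M (h % 7 ^ L) (fun u v => (a 2 u v : ZMod N)) x u := by
  have hE : ∀ σ' : State, (∀ x < ((κ + 3) * n) * ((κ + 3) * n), σ'.mem x = μ x) →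
      ∀ i < κ + 3, ∀ u < n, ∀ j < κ + 3, ∀ v < n,
      memWeight σ'.mem (κ + 3) n i u j v = memWeight μ (κ + 3) n i u j v :=
    fun σ' hm i hi u hu j hj v hv => memWeight_congr hm hi hu hj hv
  refine HX.seq ((hσ.fill (a := a 0) strassenA_ok h19 ?_).mono (Nat.le_add_right _ _)) ?_
  · intro σ' r0 r1 r3 r19 hm
    simp only [eval_indicator, Expr.eval_weightA, curRest, curP, eval_sub, eval_div, eval_mod,
      eval_var, r0, r1, r3, r19, ha, cliqueMatrix]
    exact indicator_congr fun hu hv => weightA_congr hu hv (hE σ' hm)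
  rintro σ₁ ⟨hσ₁, e7₁, hag₁, -, hA⟩
  refine HX.seq ((hσ₁.fill (a := a 1) strassenB_ok
    ((hag₁ 19 (by norm_num) (by decide)).trans h19) ?_).mono (Nat.le_add_right _ _)) ?_
  · intro σ' r0 r1 r3 r19 hm
    simp only [eval_indicator, Expr.eval_weightB, curRest, curQ, eval_sub, eval_div, eval_mod,
      eval_var, r0, r1, r3, r19, ha, cliqueMatrix]
    exact indicator_congr fun hu hv => weightB_congr hu hv (hE σ' hm)
  rintro σ₂ ⟨hσ₂, e7₂, hag₂, hf₂, hB⟩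
  have hag₂' := hag₁.trans hag₂ (by simp)
  refine HX.seq ((hσ₂.fill (a := a 2) strassenC_ok
    ((hag₂' 19 (by norm_num) (by decide)).trans h19) ?_).mono (Nat.le_add_right _ _)) ?_
  · intro σ' r0 r1 r3 r19 hm
    simp only [eval_indicator, Expr.eval_weightC, curRest, curP, curQ, eval_add, eval_div, eval_mod,
      eval_var, r0, r1, r3, r19, ha, cliqueMatrix]
    exact indicator_congr fun hu hv => weightC_congr hu hv (hE σ' hm)
  rintro σ₃ ⟨hσ₃, e7₃, hag₃, hf₃, hC⟩
  have hag₃' := hag₂'.trans hag₃ (by simp)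
  refine ((traceCmd_spec (k := κ + 3) (M := M)
    (b := ((κ + 3) * n) * ((κ + 3) * n))
    (X := fun c => match c with
      | 0 => block strassenA L M (h % 7 ^ L) (fun u v => (a 0 u v : ZMod N))
      | 1 => block strassenB L M (h % 7 ^ L) (fun u v => (a 1 u v : ZMod N))
      | _ => block strassenC L M (h % 7 ^ L) (fun u v => (a 2 u v : ZMod N)))
    hσ₃.r16 hσ₃.r7 hσ₃.r17 hσ₃.r18 hσ₃.r30 (by rw [hσ₃.r0]) ?_).mono (by omega)).weaken ?_
  · intro c hc y hy
    interval_cases c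
    · rw [hf₃ _ (Or.inl (by omega)), hf₂ _ (Or.inl (by omega))]
      exact hA y hy
    · rw [hf₃ _ (Or.inl (by omega))]
      exact hB y hy
    · exact hC y hy
  · rintro σ₄ ⟨hag₄, hm₄, h7₄, hs⟩
    refine ⟨hσ₃.of_agree hag₄ (by decide) (fun x _ => by rw [hm₄]) h7₄, ?_, ?_⟩
    · intro r hr hr'
      rw [hag₄ r hr fun hh => hr' ?_, hag₃' r hr fun hh => hr' ?_]
      · exact (by decide : fillVars ⊆ 7 :: fillVars) hh
      · exact (by decide : [7, 20] ⊆ 7 :: fillVars) hh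
    · rw [hs, e7₃, e7₂, e7₁]
      rfl

/-- Counting for small ranges. -/
def smallCmd (κ Q : ℕ) : Cmd := loop 19 15 (productCmd κ Q)

/-- The negative coefficients force a computation modulo `N`; the count itself is recovered later,
by taking `N` larger than it. -/
theorem smallCmd_spec (w : Instance (κ + 3) n R) (hR : 0 < R) (hnM : n ≤ 2 ^ L * M)
    (hσ : SmallRange κ Q n R m L M N w.memory σ)
    (h15 : σ.reg 15 = n ^ κ * R * R * 7 ^ L) :
    HX B (smallCmd κ Q) σ
      (n ^ κ * R * R * 7 ^ L * (M * M * (2 ^ L * 2 ^ L * (L + 1) + 1) + 1 + M * M * M) + 1)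
      fun σ' => SmallRange κ Q n R m L M N w.memory σ' ∧
        ((σ'.reg 7 : ℕ) : ZMod N) = (σ.reg 7 : ℕ) + (counting (κ + 3) n R w : ℕ) := by
  let E := memWeight w.memory (κ + 3) n
  let F : ℕ → ℕ → ℕ → ℕ → ZMod N := fun y p q r =>
    ∑ u ∈ Finset.range M, ∑ v ∈ Finset.range M, ∑ x ∈ Finset.range M,
      block strassenA L M r (fun u v => (cliqueMatrix E n R κ y p q 0 u v : ZMod N)) u v *
      block strassenB L M r (fun u v => (cliqueMatrix E n R κ y p q 1 u v : ZMod N)) v x *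
      block strassenC L M r (fun u v => (cliqueMatrix E n R κ y p q 2 u v : ZMod N)) x u
  refine HX.loop (N := n ^ κ * R * R * 7 ^ L) (fun j σ' => SmallRange κ Q n R m L M N w.memory σ' ∧
    σ'.reg 19 = j ∧ σ'.reg 15 = σ.reg 15 ∧ ((σ'.reg 7 : ℕ) : ZMod N) = (σ.reg 7 : ℕ) +
      ∑ h ∈ Finset.range j, F (h / 7 ^ L / R / R) (h / 7 ^ L / R % R) (h / 7 ^ L % R) (h % 7 ^ L))
    (by omega) h15 ?_ ?_ ?_ ?_
  · intro _
    exact ⟨hσ.of_agree ((Agree.refl [19] σ).set (by decide) _) (by simp) (fun _ _ => rfl)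
      (by simpa [State.set_reg] using hσ.r7), by simp [State.set_reg], by simp [State.set_reg],
      by simp [State.set_reg]⟩
  · rintro j σ' ⟨-, h, h', -⟩
    exact ⟨h, h'.trans h15⟩
  · rintro j hj - σ' ⟨hσ', h19, h15', hs⟩
    refine (productCmd_spec hσ' h19 rfl).weaken ?_
    rintro σ₁ ⟨hσ₁, hag, hs₁⟩
    refine ⟨(hag 19 (by norm_num) (by decide)).trans h19,
      hσ₁.of_agree ((Agree.refl [19] σ₁).set (by decide) _) (by simp) (fun _ _ => rfl)
      (by simpa [State.set_reg] using hσ₁.r7), by simp [State.set_reg], ?_, ?_⟩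
    · rw [State.set_reg, if_neg (by norm_num), hag 15 (by norm_num) (by decide), h15']
    · rw [State.set_reg, if_neg (by norm_num), Finset.sum_range_succ, ← add_assoc, ← hs]
      exact hs₁
  · rintro σ' ⟨hσ', -, -, hs⟩
    refine ⟨hσ', hs.trans ?_⟩
    congr 1
    refine (sum_range_mul (n ^ κ * R * R) (7 ^ L) fun h r =>
      F (h / R / R) (h / R % R) (h % R) r).trans ?_
    refine (sum_range_mul (n ^ κ * R) R fun h q =>
      ∑ r ∈ Finset.range (7 ^ L), F (h / R) (h % R) q r).trans ?_
    refine (sum_range_mul (n ^ κ) R fun y p =>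
      ∑ q ∈ Finset.range R, ∑ r ∈ Finset.range (7 ^ L), F y p q r).trans ?_
    rw [w.counting_eq_sum_trace hR hnM E rfl]
    push_cast
    refine Finset.sum_congr rfl fun y _ => Finset.sum_congr rfl fun p _ =>
      Finset.sum_congr rfl fun q _ => ?_
    exact sum_block L M _ _ _

end SmallRange

end ACZkC

namespace ACZkC

/-! ### Counting for large ranges

The variables are `0`: `n`, `1`: `R`, `2`: `m`, `5`: the number of the current group, `6`: the number
of groups, `7`: the result, `8`: the number of groups that have been searched, `9`: the start of the
memory of the subroutine, `11`: the size of its input, `14`: the number of groups, `31`: the maximal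
number of groups that are searched. The registers of the subroutine start at `40`. -/

section LargeRange

open ACZkC.Expr ACZkC.Cmd

namespace Expr

/-- The digit number `t` of the current group. -/
def groupDigit (t : ℕ) : Expr := var 5 / pow (var 0 / var 2 + lit 1) t % (var 0 / var 2 + lit 1)

/-- The first vertex in part `t` of the current group. -/
def groupFirst (t : ℕ) : Expr :=
  groupDigit t * var 2 - ((groupDigit t + lit 1) * var 2 - var 0)

/-- The vertex of part `t` of the current tuple in the current group. -/
def groupTuple (t : ℕ) : Expr := groupFirst t + var 13 / pow (var 2) t % var 2

/-- Is the current tuple a zero clique that belongs to the current group? -/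
def ownedClique (k : ℕ) : Expr :=
  isZero (weight k groupTuple % var 1 + sum k fun t => groupDigit t * var 2 - groupTuple t)

/-- The number of the part of a vertex of a group. -/
def part (x : Expr) : Expr := x / var 2

/-- The number within its part of a vertex of a group. -/
def vertex (k : ℕ) (x : Expr) : Expr := select k (part x) groupFirst + x % var 2

/-- The address of the current entry of the adjacency matrix. -/
def source (k : ℕ) : Expr :=
  (part (var 10 / (lit k * var 2)) * var 0 + vertex k (var 10 / (lit k * var 2))) *
    (lit k * var 0) +
  (part (var 10 % (lit k * var 2)) * var 0 + vertex k (var 10 % (lit k * var 2)))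

end Expr

/-- Set the first registers of the subroutine to `0`. -/
def clearCmd : ℕ → Cmd
  | 0 => skip
  | r + 1 => seq (clearCmd r) (assign (40 + r) (lit 0))

/-- Prepare the input of the subroutine. -/
def prepareCmd (k r : ℕ) : Cmd :=
  seq (assign 9 ((lit k * var 0) * (lit k * var 0) + var 5))
  (seq (loop 10 11 (store (var 9 + var 10 * var 6) (load (source k))))
  (seq (clearCmd r)
  (seq (assign 40 (var 2))
  (assign 41 (var 1)))))

/-- Search the current group if necessary. -/
def tallyCmd (k : ℕ) : Cmd :=
  -- The factors test that the answer is "yes" and that the cap is not reached. Multiplied by `m ^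
  -- k`, this flag becomes the length of the search loop, which replaces a branch.
  seq (assign 12 ((lit 1 - isZero (var 40)) * isZero (var 8 + lit 1 - var 31)))
  (seq (assign 8 (var 8 + var 12))
  (seq (assign 12 (var 12 * pow (var 2) k))
  (loop 13 12 (assign 7 (var 7 + ownedClique k)))))

/-- Counting for large ranges with the help of a program for the decision problem. -/
def largeCmd (D : Program) (k : ℕ) : Cmd :=
  loop 5 14 (seq (prepareCmd k D.regBound) (seq (sim D 40 9 6) (tallyCmd k)))

variable {B k n R m g : ℕ} {σ : State}

theorem clearCmd_spec (r : ℕ) : HX B (clearCmd r) σ 1 fun σ' => σ'.mem = σ.mem ∧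
    (∀ x < 40, σ'.reg x = σ.reg x) ∧ ∀ x < r, σ'.reg (40 + x) = 0 := by
  refine HX.of_lt fun hB _ _ => ?_
  induction r with
  | zero => exact HX.skip ⟨rfl, fun _ _ => rfl, fun x hx => absurd hx (Nat.not_lt_zero x)⟩
  | succ r ih =>
    refine HX.seq ih ?_
    rintro σ' ⟨hm, hr, h0⟩
    refine HX.assign le_rfl (by rw [eval_lit]; omega) ⟨hm, fun x hx => ?_, fun x hx => ?_⟩
    · rw [State.set_reg, if_neg (by omega), hr x hx]
    · rw [State.set_reg]
      split_ifs with h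
      · rfl
      · exact h0 x (by omega)

theorem eval_groupFirst (t : ℕ) (h0 : σ.reg 0 = n) (h2 : σ.reg 2 = m) (h5 : σ.reg 5 = g) :
    (groupFirst t).eval σ = groupStart n m (g / (n / m + 1) ^ t % (n / m + 1)) := by
  simp [groupFirst, groupDigit, groupStart, h0, h2, h5]

theorem eval_groupTuple (t : ℕ) (h0 : σ.reg 0 = n) (h2 : σ.reg 2 = m) (h5 : σ.reg 5 = g) :
    (groupTuple t).eval σ = groupVertex n m g (σ.reg 13) t := by
  simp [groupTuple, groupVertex, eval_groupFirst t h0 h2 h5, h2]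

theorem eval_ownedClique {E : ℕ → ℕ → ℕ → ℕ → ℕ} (h0 : σ.reg 0 = n) (h1 : σ.reg 1 = R)
    (h2 : σ.reg 2 = m) (h5 : σ.reg 5 = g)
    (hE : wt k (fun i u j v => σ.mem (addr k n i u j v)) (groupVertex n m g (σ.reg 13)) =
      wt k E (groupVertex n m g (σ.reg 13))) :
    (ownedClique k).eval σ = if R ∣ wt k E (groupVertex n m g (σ.reg 13)) ∧
      ∀ i < k, g / (n / m + 1) ^ i % (n / m + 1) * m ≤ groupVertex n m g (σ.reg 13) i
      then 1 else 0 := by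
  simp only [ownedClique, eval_isZero, eval_add, eval_mod, eval_weight, eval_sum, eval_sub, eval_mul,
    eval_var, h0, h1, h2, eval_groupTuple _ h0 h2 h5, hE]
  refine if_congr ?_ rfl rfl
  rw [Nat.add_eq_zero_iff, ← Nat.dvd_iff_mod_eq_zero, Finset.sum_eq_zero_iff]
  refine and_congr Iff.rfl (forall_congr' fun i => ?_)
  rw [Finset.mem_range, Nat.sub_eq_zero_iff_le]
  simp [groupDigit, h0, h2, h5]

/-- Run number `g` uses the cells `b + g + a * S` with `b = (k * n) * (k * n)`, just behind the
input. By `hz` they are still zero, so only the cells of the sub-matrix have to be written and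
nothing is cleared. -/
theorem prepareCmd_spec {S r : ℕ} (w : Instance k n R) (hmn : m ≤ n) (hm : 0 < m)
    (h0 : σ.reg 0 = n) (h1 : σ.reg 1 = R) (h2 : σ.reg 2 = m) (h5 : σ.reg 5 = g) (h6 : σ.reg 6 = S)
    (hS : 0 < S) (h11 : σ.reg 11 = (k * m) * (k * m)) (hgB : (k * n) * (k * n) + g < B)
    (hw : ∀ x < (k * n) * (k * n), σ.mem x = w.memory x)
    (hz : ∀ a, σ.mem ((k * n) * (k * n) + g + a * S) = 0) :
    HX B (prepareCmd k r) σ ((k * m) * (k * m) + 1) fun σ' => Agree [9, 10] σ σ' ∧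
      σ'.reg 9 = (k * n) * (k * n) + g ∧
      (∀ a, σ'.mem ((k * n) * (k * n) + g + a * S) = (w.group hmn g).memory a) ∧
      (∀ x, (∀ a, x ≠ (k * n) * (k * n) + g + a * S) → σ'.mem x = σ.mem x) ∧
      ∀ x < r, σ'.reg (40 + x) = (w.group hmn g).init.reg x := by
  have hX : 1 ≤ (k * m) * (k * m) + 1 := by omega
  refine HX.assign_seq hX (by simpa [h0, h5] using hgB) ?_
  have e9 : (lit k * var 0 * (lit k * var 0) + var 5).eval σ = (k * n) * (k * n) + g := by
    simp [h0, h5]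
  rw [e9]
  refine HX.seq (Q₁ := fun σ' => Agree [9, 10] σ σ' ∧ σ'.reg 9 = (k * n) * (k * n) + g ∧
      (∀ a, σ'.mem ((k * n) * (k * n) + g + a * S) = (w.group hmn g).memory a) ∧
      ∀ x, (∀ a, x ≠ (k * n) * (k * n) + g + a * S) → σ'.mem x = σ.mem x) ?_ ?_
  · rw [show (k * m) * (k * m) + 1 = (k * m) * (k * m) * 1 + 1 by ring]
    refine HX.loop (N := (k * m) * (k * m)) (fun j σ' => Agree [9, 10] σ σ' ∧
      σ'.reg 9 = (k * n) * (k * n) + g ∧ σ'.reg 10 = j ∧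
      (∀ a, σ'.mem ((k * n) * (k * n) + g + a * S) =
        if a < j then (w.group hmn g).memory a else 0) ∧
      ∀ x, (∀ a, x ≠ (k * n) * (k * n) + g + a * S) → σ'.mem x = σ.mem x) le_rfl ?_ ?_ ?_ ?_ ?_
    · rw [State.set_reg, if_neg (by norm_num), h11]
    · intro _
      refine ⟨((Agree.refl _ _).set (by decide) _).set (by decide) _, by simp [State.set_reg],
        by simp [State.set_reg], fun a => ?_, fun x _ => rfl⟩
      rw [if_neg (Nat.not_lt_zero a)]
      exact hz a
    · rintro j σ' ⟨hag, -, h, -⟩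
      exact ⟨h, (hag 11 (by norm_num) (by decide)).trans h11⟩
    · rintro j hj - σ' ⟨hag, h9, h10, hm1, hm2⟩
      have e0 := (hag 0 (by norm_num) (by decide)).trans h0
      have e2 := (hag 2 (by norm_num) (by decide)).trans h2
      have e5 := (hag 5 (by norm_num) (by decide)).trans h5
      have e6 := (hag 6 (by norm_num) (by decide)).trans h6
      have hkm : 0 < k * m := Nat.pos_of_ne_zero fun h => by
        rw [h] at hj
        omega
      have hx : j / (k * m) < k * m := Nat.div_lt_of_lt_mul hj
      have hy : j % (k * m) < k * m := Nat.mod_lt _ hkm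
      have hlow : ∀ x < (k * n) * (k * n), σ'.mem x = w.memory x := fun x hx => by
        rw [hm2 x fun a => by omega, hw x hx]
      have hpart : ∀ x < k * m, x / m < k := fun x hx =>
        Nat.div_lt_of_lt_mul (by rwa [Nat.mul_comm])
      have hst : ∀ t, groupStart n m (g / (n / m + 1) ^ t % (n / m + 1)) + m ≤ n := fun t =>
        groupStart_add_le hmn (Nat.lt_succ_iff.1 (Nat.mod_lt _ (Nat.succ_pos _)))
      have hvert : ∀ e : Expr, e.eval σ' < k * m → (vertex k e).eval σ' =
          groupStart n m (g / (n / m + 1) ^ (e.eval σ' / m) % (n / m + 1)) + e.eval σ' % m := by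
        intro e he
        have hp : (part e).eval σ' = e.eval σ' / m := by simp [part, e2]
        rw [vertex, eval_add, eval_select (by rw [hp]; exact hpart _ he), hp,
          eval_groupFirst _ e0 e2 e5]
        simp [e2]
      have ex : (var 10 / (lit k * var 2)).eval σ' = j / (k * m) := by simp [h10, e2]
      have ey : (var 10 % (lit k * var 2)).eval σ' = j % (k * m) := by simp [h10, e2]
      have hsrc : (load (source k)).eval σ' = (w.group hmn g).memory j := by
        have hg := w.memory_sub
          (fun i => groupStart n m (g / (n / m + 1) ^ (i : ℕ) % (n / m + 1)))
          (fun i => hst i) ⟨_, hpart _ hx⟩ ⟨_, hpart _ hy⟩ (Nat.mod_lt (j / (k * m)) hm)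
          (Nat.mod_lt (j % (k * m)) hm)
        have hj' : addr k m (j / (k * m) / m) (j / (k * m) % m) (j % (k * m) / m)
            (j % (k * m) % m) = j := by
          unfold addr
          rw [Nat.div_add_mod', Nat.div_add_mod', Nat.div_add_mod']
        simp only [hj'] at hg
        refine Eq.trans ?_ hg.symm
        rw [eval_load, ← hlow]
        · refine congrArg _ ?_
          simp only [source, eval_add, eval_mul, eval_var, eval_lit]
          rw [hvert _ (by rwa [ex]), hvert _ (by rwa [ey]), ex, ey]
          simp only [part, eval_div, ex, ey, eval_var, e0, e2]
          rfl
        · have := hst (j / (k * m) / m)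
          have := hst (j % (k * m) / m)
          have := Nat.mod_lt (j / (k * m)) hm
          have := Nat.mod_lt (j % (k * m)) hm
          exact addr_lt (hpart _ hx) (by omega) (hpart _ hy) (by omega)
      refine HX.of_lt fun _ _ hmB => HX.store le_rfl ?_ ?_
      · rw [eval_load]
        exact hmB _
      · have ha : (var 9 + var 10 * var 6).eval σ' = (k * n) * (k * n) + g + j * S := by
          simp [h9, h10, e6]
        rw [hsrc, ha]
        refine ⟨h10, (hag.put _ _).set (by decide) _, by simp [State.set_reg, h9],
          by simp [State.set_reg], fun a => ?_, fun x hx => ?_⟩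
        · rw [State.set_mem, State.put_mem]
          by_cases haj : a = j
          · rw [if_pos (by rw [haj]), if_pos (by omega), haj]
          · have : a * S ≠ j * S := fun h => haj (Nat.eq_of_mul_eq_mul_right hS h)
            rw [if_neg (by omega), hm1]
            refine if_congr (by omega) rfl rfl
        · rw [State.set_mem, State.put_mem, if_neg (hx j), hm2 x hx]
    · rintro σ' ⟨hag, h9, -, hm1, hm2⟩
      refine ⟨hag, h9, fun a => ?_, hm2⟩
      rw [hm1 a]
      split_ifs with ha
      · rfl
      · exact ((w.group hmn g).memory_of_le (by omega)).symm
  · rintro σ₁ ⟨hag₁, h9₁, hm1, hm2⟩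
    refine HX.seq ((clearCmd_spec r).mono hX) ?_
    rintro σ₂ ⟨hm₂, hr₂, hz₂⟩
    have e1 := (hr₂ 1 (by norm_num)).trans ((hag₁ 1 (by norm_num) (by decide)).trans h1)
    have e2 := (hr₂ 2 (by norm_num)).trans ((hag₁ 2 (by norm_num) (by decide)).trans h2)
    refine HX.of_lt fun _ hB _ => ?_
    refine HX.assign_seq hX (hB 2 (by norm_num)) (HX.assign hX ?_ ⟨?_, ?_, ?_, ?_, ?_⟩)
    · rw [eval_var, State.set_reg, if_neg (by norm_num)]
      exact hB 1 (by norm_num)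
    · refine Agree.set (Agree.set ?_ (by norm_num) _) (by norm_num) _
      intro x hx hx'
      rw [hr₂ x hx, hag₁ x hx hx']
    · simp [State.set_reg, hr₂, h9₁]
    · intro a
      rw [State.set_mem, State.set_mem, hm₂, hm1]
    · intro x hx
      rw [State.set_mem, State.set_mem, hm₂, hm2 x hx]
    · intro x hx
      change _ = if x = 0 then m else if x = 1 then R else 0
      simp only [State.set_reg, eval_var, e2]
      rcases x with _ | _ | x
      · simp
      · simp [e1]
      · rw [if_neg (by omega), if_neg (by omega), if_neg (by omega), if_neg (by omega), hz₂ _ hx]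

theorem tallyCmd_spec {U Y β x : ℕ} (w : Instance k n R) (hmn : m ≤ n) (h0 : σ.reg 0 = n)
    (h1 : σ.reg 1 = R) (h2 : σ.reg 2 = m) (h5 : σ.reg 5 = g) (h8 : σ.reg 8 = Y)
    (h31 : σ.reg 31 = U) (h7 : σ.reg 7 = x) (hY : Y ≤ U)
    (hβ : β = if σ.reg 40 ≠ 0 ∧ Y < U then 1 else 0) (hxB : x + m ^ k < B)
    (hw : ∀ x < (k * n) * (k * n), σ.mem x = w.memory x) :
    HX B (tallyCmd k) σ (β * m ^ k + 1) fun σ' => Agree [7, 8, 12, 13] σ σ' ∧ σ'.mem = σ.mem ∧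
      σ'.reg 8 = Y + β ∧ σ'.reg 7 = x + β * w.owned m g := by
  have hβ1 : β ≤ 1 := by rw [hβ]; split_ifs <;> omega
  have hβY : Y + β ≤ U := by rw [hβ]; split_ifs <;> omega
  have hX : 1 ≤ β * m ^ k + 1 := by omega
  have hβm : β * m ^ k ≤ m ^ k := (Nat.mul_le_mul_right _ hβ1).trans (Nat.one_mul _).le
  refine HX.of_lt fun hB hr _ => ?_
  have hUB : U < B := h31 ▸ hr 31 (by norm_num)
  have e12 : ((lit 1 - isZero (var 40)) * isZero (var 8 + lit 1 - var 31)).eval σ = β := by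
    simp only [eval_mul, eval_sub, eval_lit, eval_isZero, eval_var, eval_add, h8, h31, hβ]
    by_cases h40 : σ.reg 40 = 0 <;> by_cases hYU : Y < U
    · simp [h40]
    · simp [h40]
    · simp [h40, hYU, show Y + 1 - U = 0 by omega]
    · simp [h40, hYU, show Y + 1 - U ≠ 0 by omega]
  refine HX.assign_seq hX (by rw [e12]; omega) ?_
  rw [e12]
  have e8 : (var 8 + var 12).eval (σ.set 12 β) = Y + β := by simp [State.set_reg, h8]
  refine HX.assign_seq hX (by rw [e8]; omega) ?_
  rw [e8]
  have e12' : (var 12 * pow (var 2) k).eval ((σ.set 12 β).set 8 (Y + β)) = β * m ^ k := by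
    simp [State.set_reg, h2]
  refine HX.assign_seq hX (by rw [e12']; omega) ?_
  rw [e12', show β * m ^ k + 1 = β * m ^ k * 1 + 1 by ring]
  have hag : Agree [7, 8, 12, 13] σ (((σ.set 12 β).set 8 (Y + β)).set 12 (β * m ^ k)) :=
    (((Agree.refl _ _).set (by decide) _).set (by decide) _).set (by decide) _
  let f : ℕ → ℕ := fun x =>
    if R ∣ wt k (fun i u j v => w.memory (addr k n i u j v)) (groupVertex n m g x) ∧
      ∀ i < k, g / (n / m + 1) ^ i % (n / m + 1) * m ≤ groupVertex n m g x i then 1 else 0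
  have hf : ∀ j, ∑ y ∈ Finset.range j, f y ≤ j := fun j => by
    calc _ ≤ ∑ y ∈ Finset.range j, 1 :=
          Finset.sum_le_sum fun y _ => by simp only [f]; split_ifs <;> omega
      _ = j := by simp
  refine HX.loop (N := β * m ^ k) (fun j σ' => Agree [7, 8, 12, 13] σ σ' ∧ σ'.mem = σ.mem ∧
    σ'.reg 8 = Y + β ∧ σ'.reg 12 = β * m ^ k ∧ σ'.reg 13 = j ∧
    σ'.reg 7 = x + ∑ y ∈ Finset.range j, f y) le_rfl (by simp [State.set_reg]) ?_ ?_ ?_ ?_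
  · intro _
    exact ⟨hag.set (by decide) _, rfl, by simp [State.set_reg], by simp [State.set_reg],
      by simp [State.set_reg], by simp [State.set_reg, h7]⟩
  · rintro j σ' ⟨-, -, -, h12, h13, -⟩
    exact ⟨h13, h12⟩
  · rintro j hj - σ' ⟨hag', hm', h8', h12', h13', h7'⟩
    have ev : (ownedClique k).eval σ' = f j := by
      have h := eval_ownedClique (k := k) (E := fun i u j v => w.memory (addr k n i u j v))
        ((hag' 0 (by norm_num) (by decide)).trans h0) ((hag' 1 (by norm_num) (by decide)).trans h1)
        ((hag' 2 (by norm_num) (by decide)).trans h2) ((hag' 5 (by norm_num) (by decide)).trans h5)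
        ?_
      · rwa [h13'] at h
      · have hm : 0 < m ∨ k = 0 := by
          by_contra! h
          rw [Nat.le_zero.1 h.1, zero_pow h.2] at hj
          omega
        rcases hm with hm | rfl
        · refine Finset.sum_congr rfl fun j hj => Finset.sum_congr rfl fun i hi => ?_
          rw [Finset.mem_range] at hi hj
          have hv : ∀ t, groupVertex n m g (σ'.reg 13) t < n := fun t => by
            have := groupStart_add_le hmn (Nat.lt_succ_iff.1
              (Nat.mod_lt (g / (n / m + 1) ^ t) (Nat.succ_pos (n / m)) :
                g / (n / m + 1) ^ t % (n / m + 1) < n / m + 1))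
            have := Nat.mod_lt (σ'.reg 13 / m ^ t) hm
            unfold groupVertex
            omega
          exact hm' ▸ hw _ (addr_lt (by omega) (hv _) hj (hv _))
        · rfl
    have hv : (var 7 + ownedClique k).eval σ' = x + ∑ y ∈ Finset.range (j + 1), f y := by
      rw [eval_add, eval_var, h7', ev, Finset.sum_range_succ, Nat.add_assoc]
    have := hf (j + 1)
    refine HX.assign le_rfl (by rw [hv]; omega) ?_
    rw [hv]
    exact ⟨by simp [State.set_reg, h13'], (hag'.set (by decide) _).set (by decide) _, hm',
      by simp [State.set_reg, h8'], by simp [State.set_reg, h12'], by simp [State.set_reg],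
      by simp [State.set_reg]⟩
  · rintro σ' ⟨hag', hm', h8', -, -, h7'⟩
    refine ⟨hag', hm', h8', h7'.trans ?_⟩
    congr 1
    interval_cases β
    · simp
    · rw [one_mul, one_mul]
      rfl

end LargeRange

end ACZkC

namespace ACZkC

/-! ### The search over all groups: time, words and error -/

section LargeRange

open ACZkC.Expr ACZkC.Cmd

variable {B k n R m t U S : ℕ} {σ : State}

/-- The probability that the program for the decision problem gives a wrong answer. -/
noncomputable def wrongProb (D : Program) (t : ℕ) (w : Instance k m R) : ENNReal :=
  expect (D.run w.init t) fun s => if s.reg 0 = decision k m R w then 0 else 1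

theorem expect_const_add_le {α : Type*} (p : PMF α) (φ : α → ENNReal) (c : ENNReal) :
    expect p (fun x => φ x + c) ≤ expect p φ + c := by
  simp only [expect, mul_add, ENNReal.tsum_add, ENNReal.tsum_mul_right, PMF.tsum_coe, one_mul, le_refl]

/-- The error bound of the algorithm for large ranges. -/
noncomputable def groupError (D : Program) (t U : ℕ) (w : Instance k n R) (hmn : m ≤ n) : ENNReal :=
  if U < ∑ g ∈ Finset.range ((n / m + 1) ^ k), decision k m R (w.group hmn g) then 1
  else ∑ g ∈ Finset.range ((n / m + 1) ^ k), wrongProb D t (w.group hmn g)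

/-- The variables that are modified by the algorithm for large ranges. -/
def largeVars : List ℕ := [5, 7, 8, 9, 10, 12, 13]

/-- The time for a single group that is not searched. -/
def groupTime (D : Program) (k m t : ℕ) : ℕ :=
  (prepareCmd k D.regBound).size * ((k * m) * (k * m) + 1) + 3 * t + (tallyCmd k).size + 6

/-- If `1 ≤ δ`, an error has already been conceded and nothing is claimed about the result.
Otherwise the group pays `wrongProb` out of its error budget. The time for searches is treated in
the same way: each one uses up one of the `U - Y` prepaid shares. -/
theorem largeCmd_body {D : Program} {g Y x T : ℕ} {δ δ' : ENNReal} (w : Instance k n R)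
    (hmn : m ≤ n) (hm : 0 < m)
    (h0 : σ.reg 0 = n) (h1 : σ.reg 1 = R) (h2 : σ.reg 2 = m) (h5 : σ.reg 5 = g) (h6 : σ.reg 6 = S)
    (h7 : σ.reg 7 = x) (h8 : σ.reg 8 = Y) (h11 : σ.reg 11 = (k * m) * (k * m))
    (h31 : σ.reg 31 = U) (hS : 0 < S) (hgB : (k * n) * (k * n) + g < B) (hY : Y ≤ U)
    (hxB : x + m ^ k < B) (hw : ∀ x < (k * n) * (k * n), σ.mem x = w.memory x)
    (hz : ∀ a, σ.mem ((k * n) * (k * n) + g + a * S) = 0)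
    (hwD : D.WordsBelow (w.group hmn g).init B) (hhD : D.HaltsWithin (w.group hmn g).init t)
    (hδ : 1 ≤ δ ∨ δ' + wrongProb D t (w.group hmn g) ≤ δ) :
    Run B (seq (prepareCmd k D.regBound) (seq (sim D 40 9 6) (tallyCmd k))) σ
      (T + (groupTime D k m t - 6) + (U - Y) * ((tallyCmd k).size * m ^ k)) δ
      fun σ' T' δ'' => ∃ β ≤ 1, Y + β ≤ U ∧ Agree largeVars σ σ' ∧ σ'.reg 5 = g ∧
        σ'.reg 8 = Y + β ∧
        σ'.reg 7 = x + β * w.owned m g ∧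
        T' = T + (U - (Y + β)) * ((tallyCmd k).size * m ^ k) ∧
        (∀ y, (∀ a, y ≠ (k * n) * (k * n) + g + a * S) → σ'.mem y = σ.mem y) ∧
        (1 ≤ δ'' ∨ δ'' = δ' ∧ ¬ 1 ≤ δ ∧
          (Y < U → β = decision k m R (w.group hmn g)) ∧
          (Y = U → β = 0)) := by
  set τ := (tallyCmd k).size * m ^ k
  -- A right answer leaves the budget `δ'` for the remaining groups; a wrong answer is charged as
  -- certain failure.
  let φ : Config → ENNReal := fun d => if 1 ≤ δ then 1 else
    if d.reg 0 = decision k m R (w.group hmn g) then δ' else 1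
  have hφ : expect (D.run (w.group hmn g).init t) φ ≤ δ := by
    by_cases h : 1 ≤ δ
    · refine le_trans (le_of_eq ?_) h
      simp only [φ, if_pos h, expect, mul_one, PMF.tsum_coe]
    · have hδ := hδ.resolve_left h
      refine le_trans ?_ hδ
      rw [add_comm]
      refine le_trans (expect_mono _ fun d => ?_) (expect_const_add_le _ _ _)
      simp only [φ, if_neg h]
      split_ifs
      · simp
      · exact le_self_add
  have hT : T + (groupTime D k m t - 6) + (U - Y) * τ =
      (T + (U - Y) * τ + (tallyCmd k).size) + 3 * t +
        (prepareCmd k D.regBound).size * ((k * m) * (k * m) + 1) := by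
    unfold groupTime
    omega
  rw [hT]
  refine Run.seq (prepareCmd_spec (r := D.regBound) w hmn hm h0 h1 h2 h5 h6 hS h11 hgB hw hz _ _) ?_
  rintro σ₁ T₁ δ₁ ⟨⟨hag₁, h9, hm1, hm2, hreg⟩, rfl, rfl⟩
  have e6 := (hag₁ 6 (by norm_num) (by decide)).trans h6
  refine Run.seq (K₁ := fun σ₂ T₂ δ₂ => ∃ d', d'.Below B ∧
    SimRel D 40 (σ₁.reg 9) (σ₁.reg 6) σ₁ d' σ₂ ∧ T₂ = T + (U - Y) * τ + (tallyCmd k).size ∧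
    δ₂ = φ d') ((Run.sim φ (by omega) (by norm_num) (by norm_num) rfl ?_ hwD hhD ?_).mono le_rfl hφ) ?_
  · exact ⟨hreg, fun a => by rw [h9, e6]; exact hm1 a, fun _ _ => rfl, fun _ _ => rfl⟩
  · intro d' σ' hd' hs'
    exact ⟨d', hd', hs', rfl, rfl⟩
  rintro σ₂ T₂ δ₂ ⟨d', hd', hs', rfl, rfl⟩
  have hag₂ : Agree [9, 10] σ σ₂ := fun r hr hr' => by rw [hs'.frame_reg r hr, hag₁ r hr hr']
  have hfr : ∀ y, (∀ a, y ≠ (k * n) * (k * n) + g + a * S) → σ₂.mem y = σ.mem y := fun y hy => by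
    rw [hs'.frame_mem y (by rwa [h9, e6]), hm2 y hy]
  have h40 : σ₂.reg 40 = d'.reg 0 :=
    hs'.reg 0 (lt_of_lt_of_le two_pos Program.two_le_regBound)
  obtain ⟨β, hβ⟩ : ∃ β, β = if σ₂.reg 40 ≠ 0 ∧ Y < U then 1 else 0 := ⟨_, rfl⟩
  have hβ1 : β ≤ 1 := by rw [hβ]; split_ifs <;> omega
  have hβY : Y + β ≤ U := by rw [hβ]; split_ifs <;> omega
  have hTβ : T + (U - Y) * τ + (tallyCmd k).size =
      (T + (U - (Y + β)) * τ) + (tallyCmd k).size * (β * m ^ k + 1) := by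
    obtain ⟨z, rfl⟩ : ∃ z, U = Y + β + z := ⟨U - (Y + β), by omega⟩
    rw [show Y + β + z - Y = β + z by omega, show Y + β + z - (Y + β) = z by omega]
    simp only [τ]
    ring
  rw [hTβ]
  refine (tallyCmd_spec w hmn ((hag₂ 0 (by norm_num) (by decide)).trans h0)
    ((hag₂ 1 (by norm_num) (by decide)).trans h1) ((hag₂ 2 (by norm_num) (by decide)).trans h2)
    ((hag₂ 5 (by norm_num) (by decide)).trans h5) ((hag₂ 8 (by norm_num) (by decide)).trans h8)
    ((hag₂ 31 (by norm_num) (by decide)).trans h31) ((hag₂ 7 (by norm_num) (by decide)).trans h7)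
    hY hβ hxB (fun y hy => by rw [hfr y fun a => by omega, hw y hy]) _ _).weaken ?_
  rintro σ₃ T₃ δ₃ ⟨⟨hag₃, hm₃, h8₃, h7₃⟩, rfl, rfl⟩
  refine ⟨β, hβ1, hβY, ?_, ?_, h8₃, h7₃, rfl, fun y hy => by rw [hm₃, hfr y hy], ?_⟩
  · intro r hr hr'
    rw [hag₃ r hr fun h => hr' ((by decide : [7, 8, 12, 13] ⊆ largeVars) h),
      hag₂ r hr fun h => hr' ((by decide : [9, 10] ⊆ largeVars) h)]
  · rw [hag₃ 5 (by norm_num) (by decide), hag₂ 5 (by norm_num) (by decide), h5]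
  · simp only [φ]
    split_ifs with h1 h2
    · exact Or.inl le_rfl
    · refine Or.inr ⟨rfl, h1, fun hYU => ?_, fun hYU => ?_⟩
      · rw [hβ, h40, h2, Instance.decision_eq]
        split_ifs <;> simp_all
      · rw [hβ, if_neg (by omega)]
    · exact Or.inl le_rfl

/-- If the correct answers contain at most `U` times "yes" and all calls are correct, the cap never
suppresses a search, and the owned cliques add up to the count. All other events are covered by
`groupError`. -/
theorem largeCmd_spec {D : Program} (w : Instance k n R) (hmn : m ≤ n) (hm : 0 < m)
    (h0 : σ.reg 0 = n) (h1 : σ.reg 1 = R) (h2 : σ.reg 2 = m) (h6 : σ.reg 6 = S)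
    (hS : S = (n / m + 1) ^ k) (h7 : σ.reg 7 = 0) (h8 : σ.reg 8 = 0)
    (h11 : σ.reg 11 = (k * m) * (k * m)) (h14 : σ.reg 14 = S) (h31 : σ.reg 31 = U)
    (hw : ∀ x, σ.mem x = w.memory x) (hSB : (k * n) * (k * n) + S < B) (hxB : S * m ^ k < B)
    (hwD : ∀ v : Instance k m R, D.WordsBelow v.init B)
    (hhD : ∀ v : Instance k m R, D.HaltsWithin v.init t) (T : ℕ) :
    Run B (largeCmd D k) σ
      (T + (S * groupTime D k m t + U * ((tallyCmd k).size * m ^ k) + 3)) (groupError D t U w hmn)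
      fun σ' T' δ' => T ≤ T' ∧ Agree largeVars σ σ' ∧
        (∀ x < (k * n) * (k * n), σ'.mem x = w.memory x) ∧
        (1 ≤ δ' ∨ σ'.reg 7 = counting k n R w) := by
  have hS0 : 0 < S := hS ▸ by positivity
  set τ := (tallyCmd k).size * m ^ k
  rw [show T + (S * groupTime D k m t + U * τ + 3) =
    T + S * groupTime D k m t + U * τ + 2 + 1 by ring]
  -- Besides the partial results, the invariant says that the memories of the runs from `j` on are
  -- untouched, and it keeps the prepaid time for the remaining searches and the error budget of the
  -- remaining groups.
  refine Run.loop (fun j σ' T' δ' => j ≤ S ∧ Agree largeVars σ σ' ∧ σ'.reg 5 = j ∧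
    (∀ x < (k * n) * (k * n), σ'.mem x = w.memory x) ∧
    (∀ a g, j ≤ g → g < S → σ'.mem ((k * n) * (k * n) + g + a * S) = 0) ∧
    σ'.reg 7 ≤ j * m ^ k ∧ ∃ Y, σ'.reg 8 = Y ∧ Y ≤ U ∧
    T' = T + (S - j) * groupTime D k m t + (U - Y) * τ + 2 ∧
    (1 ≤ δ' ∨ σ'.reg 7 = ∑ g ∈ Finset.range j, w.owned m g ∧
      Y = ∑ g ∈ Finset.range j, decision k m R (w.group hmn g) ∧
      ∑ g ∈ Finset.range S, decision k m R (w.group hmn g) ≤ U ∧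
      δ' = ∑ g ∈ Finset.Ico j S, wrongProb D t (w.group hmn g))) h14 ?_ ?_ ?_ ?_
  · intro _
    refine ⟨Nat.zero_le _, (Agree.refl _ _).set (by decide) _, by simp [State.set_reg],
      fun x _ => hw x, fun a g _ _ => ?_, by simp [State.set_reg, h7], 0,
      by simp [State.set_reg, h8], Nat.zero_le _, by simp, ?_⟩
    · rw [State.set_mem, hw]
      exact w.memory_of_le (by omega)
    · unfold groupError
      rw [← hS]
      split_ifs with h
      · exact Or.inl le_rfl
      · exact Or.inr ⟨by simp [State.set_reg, h7], by simp, by omega, by simp⟩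
  · rintro j σ' T' δ' ⟨-, hag, h5, -⟩
    exact ⟨h5, (hag 14 (by norm_num) (by decide)).trans h14⟩
  · rintro j hj - σ' T' δ' ⟨-, hag, h5, hw', hz, hx, Y, hY, hYU, rfl, hgood⟩
    refine ⟨_, rfl, ?_⟩
    have hT : T + (S - j) * groupTime D k m t + (U - Y) * τ =
        (T + (S - (j + 1)) * groupTime D k m t + 6) + (groupTime D k m t - 6) + (U - Y) * τ := by
      obtain ⟨r, rfl⟩ : ∃ r, S = j + 1 + r := ⟨S - (j + 1), by omega⟩
      rw [show j + 1 + r - j = r + 1 by omega, show j + 1 + r - (j + 1) = r by omega, Nat.succ_mul]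
      have : 6 ≤ groupTime D k m t := Nat.le_add_left _ _
      omega
    rw [hT]
    have hlt : σ'.reg 7 + m ^ k ≤ S * m ^ k := by
      have := Nat.mul_le_mul_right (m ^ k) (Nat.succ_le_of_lt hj)
      rw [Nat.succ_mul] at this
      omega
    refine (largeCmd_body w hmn hm ((hag 0 (by norm_num) (by decide)).trans h0)
      ((hag 1 (by norm_num) (by decide)).trans h1) ((hag 2 (by norm_num) (by decide)).trans h2)
      h5 ((hag 6 (by norm_num) (by decide)).trans h6) rfl hY
      ((hag 11 (by norm_num) (by decide)).trans h11)
      ((hag 31 (by norm_num) (by decide)).trans h31) hS0 (by omega) hYU (by omega) hw'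
      (fun a => hz a j le_rfl hj) (hwD _) (hhD _)
      (δ' := ∑ g ∈ Finset.Ico (j + 1) S, wrongProb D t (w.group hmn g)) ?_).weaken ?_
    · refine hgood.imp_right fun h => ?_
      rw [h.2.2.2, Finset.sum_eq_sum_Ico_succ_bot hj, add_comm]
    rintro σ₁ T₁ δ₁ ⟨β, hβ1, hβU, hag₁, h5₁, h8₁, h7₁, rfl, hfr, hgood₁⟩
    have hown : w.owned m j ≤ m ^ k := (w.owned_le hmn j).trans (Instance.counting_le _)
    refine ⟨_, by
      rw [show T + (S - (j + 1)) * groupTime D k m t + 6 + (U - (Y + β)) * τ =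
        (T + (S - (j + 1)) * groupTime D k m t + (U - (Y + β)) * τ + 2) + 4 by ring], h5₁, hj,
      (hag.trans hag₁ (by simp)).set (by decide) _, by simp [State.set_reg], ?_, ?_, ?_, Y + β,
      by simp [State.set_reg, h8₁], hβU, rfl, ?_⟩
    · intro x hx
      rw [State.set_mem, hfr x fun a => by omega, hw' x hx]
    · intro a g hjg hg
      rw [State.set_mem, hfr _ fun a' ha => ?_, hz a g (by omega) hg]
      -- The memories of runs `j` and `g` lie in different residue classes modulo `S`.
      have h1 : (g + a * S) % S = (j + a' * S) % S := by
        rw [show g + a * S = j + a' * S by omega]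
      rw [Nat.add_mul_mod_self_right, Nat.add_mul_mod_self_right, Nat.mod_eq_of_lt hg,
        Nat.mod_eq_of_lt hj] at h1
      omega
    · have : β * w.owned m j ≤ m ^ k :=
        (Nat.mul_le_mul_right _ hβ1).trans ((Nat.one_mul _).le.trans hown)
      rw [State.set_reg, if_neg (by norm_num), h7₁, Nat.succ_mul]
      omega
    · refine hgood₁.imp_right ?_
      rintro ⟨rfl, hn, h1, h2⟩
      obtain ⟨g7, gY, gU, -⟩ := hgood.resolve_left hn
      have hle : ∑ g ∈ Finset.range (j + 1), decision k m R (w.group hmn g) ≤ U :=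
        (Finset.sum_le_sum_of_subset (Finset.range_subset_range.2 hj)).trans gU
      rw [Finset.sum_range_succ, ← gY] at hle
      -- When the cap has been reached, the bound on the total leaves only the answer `0` for this
      -- group, so omitting the search is right.
      have hβ : β = decision k m R (w.group hmn j) := by
        rcases Nat.lt_or_ge Y U with h | h
        · exact h1 h
        · rw [h2 (by omega)]
          omega
      -- A group that is rightly skipped has no zero cliques, hence owns none.
      have hβown : β * w.owned m j = w.owned m j := by
        have := w.owned_le hmn j
        rw [Instance.decision_eq] at hβ
        split_ifs at hβ with hc
        · rw [hβ, show w.owned m j = 0 by omega]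
        · rw [hβ, one_mul]
      exact ⟨by rw [State.set_reg, if_neg (by norm_num), h7₁, g7, hβown, Finset.sum_range_succ],
        by rw [Finset.sum_range_succ, ← gY, hβ], gU, rfl⟩
  · rintro σ' T' δ' ⟨-, hag, -, hw', -, -, Y, -, -, rfl, hgood⟩
    refine ⟨_, rfl, by omega, hag, hw', hgood.imp_right fun h => ?_⟩
    rw [h.1, hS, w.sum_owned hm hmn]

end LargeRange

end ACZkC

namespace ACZkC

/-! ### The counting program -/

section Counting

open ACZkC.Expr ACZkC.Cmd

variable {B κ q Q n R ℓ t : ℕ} {σ : State}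

/-- A loop without iterations. -/
theorem HX.loop_zero {i l : ℕ} {c : Cmd} (h : σ.reg l = 0) (hil : l ≠ i) :
    HX B (Cmd.loop i l c) σ 1 fun σ' => σ' = σ.set i 0 := by
  rw [← Nat.zero_add 1, ← Nat.zero_mul 1]
  refine HX.loop (N := 0) (fun j σ' => σ' = σ.set i 0 ∧ j = 0) le_rfl h (fun _ => ⟨rfl, rfl⟩) ?_ ?_
    fun σ' h => h.1
  · rintro j σ' ⟨rfl, rfl⟩
    exact ⟨by simp [State.set_reg], by simp [State.set_reg, hil, h]⟩
  · rintro j hj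
    omega

/-- A list of assignments. -/
def assigns (l : List (ℕ × Expr)) : Cmd := l.foldr (fun p c => seq (assign p.1 p.2) c) skip

/-- Assignments of values that only depend on the first four variables. -/
theorem assigns_spec {l : List (ℕ × Expr)} (v : ℕ → ℕ)
    (h : ∀ p ∈ l, 4 ≤ p.1 ∧ v p.1 < B ∧
      ∀ σ' : State, (∀ r < 4, σ'.reg r = σ.reg r) → p.2.eval σ' = v p.1) :
    HX B (assigns l) σ 1 fun σ' => σ'.mem = σ.mem ∧
      ∀ r, σ'.reg r = if r ∈ l.map Prod.fst then v r else σ.reg r := by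
  induction l generalizing σ with
  | nil => exact HX.skip ⟨rfl, fun r => by simp⟩
  | cons p l ih =>
    obtain ⟨h4, hB, hv⟩ := h p List.mem_cons_self
    have hv' := hv σ fun _ _ => rfl
    refine HX.assign_seq le_rfl (hv' ▸ hB) ?_
    rw [hv']
    have h0 : ∀ r < 4, (σ.set p.1 (v p.1)).reg r = σ.reg r := fun r hr => by
      rw [State.set_reg, if_neg (by omega)]
    refine (ih fun p' hp' => ?_).weaken ?_
    · obtain ⟨h1, h2, h3⟩ := h p' (List.mem_cons_of_mem _ hp')
      exact ⟨h1, h2, fun σ' hσ' => h3 σ' fun r hr => by rw [hσ' r hr, h0 r hr]⟩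
    · rintro σ' ⟨hm, hr⟩
      refine ⟨hm, fun r => ?_⟩
      rw [hr, State.set_reg, List.map_cons]
      by_cases h1 : r ∈ l.map Prod.fst
      · rw [if_pos h1, if_pos (List.mem_cons_of_mem _ h1)]
      · rw [if_neg h1]
        by_cases h2 : r = p.1
        · rw [if_pos h2, if_pos (by rw [h2]; exact List.mem_cons_self), h2]
        · rw [if_neg h2, if_neg (by simp only [List.mem_cons, h2, h1, or_self, not_false_eq_true])]

/-- Find the parameter `m`, a power of two. -/
def scaleCmd (q Q : ℕ) : Cmd :=
  seq (assign 2 (lit 1))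
  (seq (assign 3 (lit 1))
  (loop 5 0
    -- Register `29` is `1` if doubling `m` keeps `m ^ q ≤ n`, and `0` otherwise; the three updates
    -- are multiplied by this flag instead of branching. Once it is `0` it stays `0`, so further
    -- rounds are harmless.
    (seq (assign 29 (isZero (pow (lit 2 * var 2) q - var 0)))
    (seq (assign 4 (var 4 + lit Q * var 29))
    (seq (assign 3 (var 3 * (lit 1 + var 29 * lit (7 ^ Q - 1))))
    (assign 2 (var 2 * (lit 1 + var 29))))))))

/-- The exponent `ℓ` of the largest power of two with `(2 ^ ℓ) ^ q ≤ n`. -/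
structure IsScale (q n ℓ : ℕ) : Prop where
  le : (2 ^ ℓ) ^ q ≤ n
  lt : n < (2 ^ (ℓ + 1)) ^ q

/-- `7 < 8 = 2 ^ 3`; this keeps the number of Strassen terms within a word. -/
theorem seven_pow_le (hq : 3 * Q ≤ q) (h : (2 ^ ℓ) ^ q ≤ n) : 7 ^ (Q * ℓ) ≤ n := by
  refine le_trans ?_ h
  calc 7 ^ (Q * ℓ) ≤ (2 ^ 3) ^ (Q * ℓ) := Nat.pow_le_pow_left (by norm_num) _
    _ = (2 ^ ℓ) ^ (3 * Q) := by rw [← pow_mul, ← pow_mul]; congr 1; ring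
    _ ≤ _ := Nat.pow_le_pow_right (by positivity) hq

theorem scaleCmd_spec (hq : 3 * Q ≤ q) (hq1 : 1 ≤ q) (hn : 1 ≤ n) (h0 : σ.reg 0 = n)
    (h4 : σ.reg 4 = 0) :
    HX B (scaleCmd q Q) σ (n + 1) fun σ' => Agree [2, 3, 4, 5, 29] σ σ' ∧ σ'.mem = σ.mem ∧
      ∃ ℓ, IsScale q n ℓ ∧ σ'.reg 2 = 2 ^ ℓ ∧ σ'.reg 3 = 7 ^ (Q * ℓ) ∧ σ'.reg 4 = Q * ℓ := by
  refine HX.of_lt fun hB hr _ => ?_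
  have hnB : n < B := h0 ▸ hr 0 (by norm_num)
  refine HX.assign_seq (by omega) (by rw [eval_lit]; omega) ?_
  refine HX.assign_seq (by omega) (by rw [eval_lit]; omega) ?_
  have hag : Agree [2, 3, 4, 5, 29] σ
      ((σ.set 2 ((lit 1).eval σ)).set 3 ((lit 1).eval (σ.set 2 ((lit 1).eval σ)))) :=
    ((Agree.refl _ _).set (by decide) _).set (by decide) _
  rw [show n + 1 = n * 1 + 1 by ring]
  refine HX.loop (N := n) (fun j σ' => Agree [2, 3, 4, 5, 29] σ σ' ∧ σ'.mem = σ.mem ∧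
    σ'.reg 5 = j ∧ ∃ ℓ, (ℓ = j ∨ n < (2 ^ (ℓ + 1)) ^ q) ∧ (2 ^ ℓ) ^ q ≤ n ∧
      σ'.reg 2 = 2 ^ ℓ ∧ σ'.reg 3 = 7 ^ (Q * ℓ) ∧ σ'.reg 4 = Q * ℓ) le_rfl
      (by simp [State.set_reg, h0]) ?_ ?_ ?_ ?_
  · intro _
    exact ⟨hag.set (by decide) _, rfl, by simp [State.set_reg], 0, Or.inl rfl, by simpa using hn,
      by simp [State.set_reg], by simp [State.set_reg], by simp [State.set_reg, h4]⟩
  · rintro j σ' ⟨hag, -, h5, -⟩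
    exact ⟨h5, (hag 0 (by norm_num) (by decide)).trans h0⟩
  · rintro j hj - σ' ⟨hag, hm, h5, ℓ, hℓ, hle, h2, h3, h4⟩
    have e0 := (hag 0 (by norm_num) (by decide)).trans h0
    obtain ⟨c, hc⟩ : ∃ c, c = if (2 ^ (ℓ + 1)) ^ q ≤ n then 1 else 0 := ⟨_, rfl⟩
    have hc1 : c ≤ 1 := by rw [hc]; split_ifs <;> omega
    have hle' : (2 ^ (ℓ + c)) ^ q ≤ n := by
      rw [hc]
      split_ifs with h
      · exact h
      · exact hle
    have h7 : 7 ^ (Q * (ℓ + c)) ≤ n := seven_pow_le hq hle'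
    have v29 : (isZero (pow (lit 2 * var 2) q - var 0)).eval σ' = c := by
      rw [hc]
      simp [h2, e0, Nat.sub_eq_zero_iff_le, pow_succ' 2 ℓ]
    refine HX.assign_seq le_rfl (by rw [v29]; omega) ?_
    rw [v29]
    have v4 : (var 4 + lit Q * var 29).eval (σ'.set 29 c) = Q * (ℓ + c) := by
      simp [State.set_reg, h4, Nat.mul_add]
    have hQ : Q * (ℓ + c) < B :=
      ((Nat.lt_pow_self (by norm_num : 1 < 7)).trans_le h7).trans hnB
    refine HX.assign_seq le_rfl (by rwa [v4]) ?_
    rw [v4]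
    have v3 : (var 3 * (lit 1 + var 29 * lit (7 ^ Q - 1))).eval
        ((σ'.set 29 c).set 4 (Q * (ℓ + c))) = 7 ^ (Q * (ℓ + c)) := by
      have h1 : 1 + (7 ^ Q - 1) = 7 ^ Q := by
        have : 1 ≤ 7 ^ Q := Nat.one_le_pow _ _ (by norm_num)
        omega
      simp only [State.set_reg, eval_mul, eval_add, eval_var, eval_lit]
      interval_cases c
      · simp [h3]
      · simp [h3, h1, Nat.mul_add, pow_add]
    refine HX.assign_seq le_rfl (by rw [v3]; omega) ?_
    rw [v3]
    have v2 : (var 2 * (lit 1 + var 29)).eval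
        (((σ'.set 29 c).set 4 (Q * (ℓ + c))).set 3 (7 ^ (Q * (ℓ + c)))) = 2 ^ (ℓ + c) := by
      simp only [State.set_reg, eval_mul, eval_add, eval_var, eval_lit]
      interval_cases c
      · simp [h2]
      · simp [h2, pow_succ]
    have hlt : 2 ^ (ℓ + c) < B :=
      ((Nat.le_self_pow (by omega) _).trans hle').trans_lt hnB
    refine HX.assign le_rfl (by rwa [v2]) ?_
    rw [v2]
    refine ⟨by simp [State.set_reg, h5], ?_, hm, by simp [State.set_reg], ℓ + c, ?_, hle',
      by simp [State.set_reg], by simp [State.set_reg], by simp [State.set_reg]⟩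
    · exact ((((hag.set (by decide) _).set (by decide) _).set (by decide) _).set
        (by decide) _).set (by decide) _
    · by_cases h : (2 ^ (ℓ + 1)) ^ q ≤ n
      · rw [if_pos h] at hc
        rw [hc]
        rcases hℓ with rfl | hℓ
        · exact Or.inl rfl
        · omega
      · rw [if_neg h] at hc
        rw [hc]
        right
        rw [Nat.add_zero]
        omega
  · rintro σ' ⟨hag, hm, -, ℓ, hℓ, hle, h2, h3, h4⟩
    refine ⟨hag, hm, ℓ, ⟨hle, ?_⟩, h2, h3, h4⟩
    -- If every round has doubled `m`, then `ℓ = n`, and `n < 2 ^ n` settles maximality.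
    rcases hℓ with rfl | h
    · calc ℓ < 2 ^ ℓ := Nat.lt_two_pow_self
        _ ≤ 2 ^ (ℓ + 1) := Nat.pow_le_pow_right two_pos (Nat.le_succ _)
        _ ≤ _ := Nat.le_self_pow (by omega) _
    · exact h

/-- The maximal number of groups that are searched. -/
def budget (κ n m : ℕ) : ℕ := 2 ^ (κ + 3) * n ^ (κ + 1) * (n * n / m ^ (κ + 4))

/-- The parameters of the main loops. -/
def parameter (κ Q n R m p : ℕ) : ℕ → ℕ
  | 6 => (n / m + 1) ^ (κ + 3)
  | 11 => ((κ + 3) * m) * ((κ + 3) * m)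
  -- The lengths `14` and `15` of the two main loops carry complementary indicators: for every `R`
  -- exactly one method is active.
  | 14 => (n / m + 1) ^ (κ + 3) * if m ^ (κ + 5) ≤ R then 1 else 0
  | 15 => n ^ κ * R * R * p * if R < m ^ (κ + 5) then 1 else 0
  | 16 => n ^ (κ + 3) + 1
  | 17 => (n / m ^ Q + 1) * (n / m ^ Q + 1)
  | 18 => (n / m ^ Q + 1) * (n / m ^ Q + 1) * (n / m ^ Q + 1)
  | 23 => m ^ Q * m ^ Q
  | 30 => n / m ^ Q + 1
  | 31 => budget κ n m
  | _ => 0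

/-- The expressions for the parameters. -/
def parameterList (κ Q : ℕ) : List (ℕ × Expr) :=
  let large := isZero (pow (var 2) (κ + 5) - var 1)
  let size := var 0 / pow (var 2) Q + lit 1
  [(6, pow (var 0 / var 2 + lit 1) (κ + 3)),
    (11, (lit (κ + 3) * var 2) * (lit (κ + 3) * var 2)),
    (14, pow (var 0 / var 2 + lit 1) (κ + 3) * large),
    (15, pow (var 0) κ * var 1 * var 1 * var 3 * isZero large),
    (16, pow (var 0) (κ + 3) + lit 1),
    (17, size * size),
    (18, size * size * size),
    (23, pow (var 2) Q * pow (var 2) Q),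
    (30, size),
    (31, pow (lit 2) (κ + 3) * pow (var 0) (κ + 1) * (var 0 * var 0 / pow (var 2) (κ + 4)))]

theorem parameterList_eval {m p : ℕ} (h0 : σ.reg 0 = n) (h1 : σ.reg 1 = R) (h2 : σ.reg 2 = m)
    (h3 : σ.reg 3 = p) : ∀ x ∈ parameterList κ Q, 4 ≤ x.1 ∧ x.1 < 40 ∧
      ∀ σ' : State, (∀ r < 4, σ'.reg r = σ.reg r) → x.2.eval σ' = parameter κ Q n R m p x.1 := by
  simp only [parameterList, List.forall_mem_cons, List.not_mem_nil, false_imp_iff, implies_true,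
    and_true]
  refine ⟨?_, ?_, ?_, ?_, ?_, ?_, ?_, ?_, ?_, ?_⟩
  all_goals
    refine ⟨by norm_num, by norm_num, fun σ' h => ?_⟩
    have e0 := (h 0 (by norm_num)).trans h0
    have e1 := (h 1 (by norm_num)).trans h1
    have e2 := (h 2 (by norm_num)).trans h2
    have e3 := (h 3 (by norm_num)).trans h3
    simp [parameter, budget, e0, e1, e2, e3, Nat.sub_eq_zero_iff_le]

/-- The program for the counting problem. -/
def countCmd (D : Program) (κ q Q : ℕ) : Cmd :=
  seq (scaleCmd q Q)
  (seq (assigns (parameterList κ Q))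
  (seq (largeCmd D (κ + 3))
  (seq (smallCmd κ Q)
  (assign 0 (var 7)))))

end Counting

end ACZkC

namespace ACZkC

/-! ### Bounds for the parameters and the two cases of the program -/

section Counting

open ACZkC.Expr ACZkC.Cmd

variable {B κ q Q n R ℓ t : ℕ} {σ : State}

theorem IsScale.pow_le (h : IsScale q n ℓ) {a : ℕ} (ha : a ≤ q) : (2 ^ ℓ) ^ a ≤ n :=
  (Nat.pow_le_pow_right (by positivity) ha).trans h.le

theorem IsScale.base_le (h : IsScale q n ℓ) (hq : 1 ≤ q) : 2 ^ ℓ ≤ n := by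
  simpa using h.pow_le hq

theorem mul_div_add_one_le {m : ℕ} (h : m ≤ n) : (n / m + 1) * m ≤ 2 * n := by
  have := Nat.div_mul_le_self n m
  rw [Nat.succ_mul]
  omega

/-- A bound for the words of the counting program. -/
def wordBound (κ n : ℕ) : ℕ := (2 * (κ + 3) * n) ^ (κ + 5)

theorem pow_le_wordBound {x a : ℕ} (hn : 1 ≤ n) (hx : x ≤ 2 * (κ + 3) * n) (ha : a ≤ κ + 5) :
    x ^ a ≤ wordBound κ n :=
  (Nat.pow_le_pow_left hx a).trans (Nat.pow_le_pow_right (by positivity) ha)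

theorem groups_mul_le {m : ℕ} (hn : 1 ≤ n) (hm : m ≤ n) :
    (n / m + 1) ^ (κ + 3) * m ^ (κ + 3) ≤ wordBound κ n := by
  rw [← mul_pow]
  exact pow_le_wordBound hn ((mul_div_add_one_le hm).trans (by nlinarith)) (by omega)

theorem budget_le {m : ℕ} (hn : 1 ≤ n) : budget κ n m ≤ wordBound κ n := by
  calc budget κ n m ≤ 2 ^ (κ + 3) * n ^ (κ + 1) * (n * n) :=
        Nat.mul_le_mul_left _ (Nat.div_le_self _ _)
    _ = (2 * n) ^ (κ + 3) := by ring
    _ ≤ _ := pow_le_wordBound hn (by nlinarith) (by omega)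

theorem groups_le {m : ℕ} (hn : 1 ≤ n) (hm0 : 0 < m) (hm : m ≤ n) :
    (n / m + 1) ^ (κ + 3) ≤ wordBound κ n :=
  (Nat.le_mul_of_pos_right _ (by positivity)).trans (groups_mul_le hn hm)

/-- The critical parameter is `n ^ κ * R * R * 7 ^ L`. It occurs only for small `R`, where `R * R ≤
n`, and `7 ^ L ≤ n` as well. -/
theorem parameter_lt (hn : 1 ≤ n) (hℓ : IsScale q n ℓ) (hQ : 3 * Q ≤ q) (hq : 2 * κ + 10 ≤ q)
    (hB : 2 * wordBound κ n < B) (x : ℕ) :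
    parameter κ Q n R (2 ^ ℓ) (7 ^ (Q * ℓ)) x < B := by
  have hmn := hℓ.base_le (by omega)
  have hw : 1 ≤ wordBound κ n := Nat.one_le_pow _ _ (by positivity)
  have hM : n / (2 ^ ℓ) ^ Q + 1 ≤ 2 * (κ + 3) * n := by
    have := Nat.div_le_self n ((2 ^ ℓ) ^ Q)
    nlinarith
  have hS := groups_le (κ := κ) hn (by positivity : 0 < 2 ^ ℓ) hmn
  suffices h : parameter κ Q n R (2 ^ ℓ) (7 ^ (Q * ℓ)) x ≤ 2 * wordBound κ n by omega
  unfold parameter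
  split
  · omega
  · have := pow_le_wordBound (κ := κ) (x := (κ + 3) * 2 ^ ℓ) (a := 2) hn (by nlinarith) (by omega)
    rw [pow_two] at this
    omega
  · split_ifs
    · omega
    · omega
  · split_ifs with hR
    · have h2 : R * R ≤ n := by
        calc R * R ≤ (2 ^ ℓ) ^ (κ + 5) * (2 ^ ℓ) ^ (κ + 5) := Nat.mul_le_mul hR.le hR.le
          _ = (2 ^ ℓ) ^ (2 * κ + 10) := by rw [← pow_add]; congr 1; ring
          _ ≤ n := hℓ.pow_le hq
      have h3 := seven_pow_le hQ hℓ.le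
      have h4 := pow_le_wordBound (κ := κ) (x := n) (a := κ + 2) hn (by nlinarith) (by omega)
      calc n ^ κ * R * R * 7 ^ (Q * ℓ) * 1 = n ^ κ * (R * R) * 7 ^ (Q * ℓ) := by ring
        _ ≤ n ^ κ * n * n := Nat.mul_le_mul (Nat.mul_le_mul_left _ h2) h3
        _ = n ^ (κ + 2) := by ring
        _ ≤ _ := by omega
    · omega
  · have := pow_le_wordBound (κ := κ) (x := n) (a := κ + 3) hn (by nlinarith) (by omega)
    omega
  · have := pow_le_wordBound (a := 2) hn hM (by omega)
    rw [pow_two] at this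
    omega
  · have := pow_le_wordBound (a := 3) hn hM (by omega)
    rw [pow_succ, pow_two] at this
    omega
  · have h1 : (2 ^ ℓ) ^ Q * (2 ^ ℓ) ^ Q ≤ n := by
      rw [← pow_add]
      exact hℓ.pow_le (by omega)
    have := pow_le_wordBound (κ := κ) (x := n) (a := 1) hn (by nlinarith) (by omega)
    rw [pow_one] at this
    omega
  · have := pow_le_wordBound (a := 1) hn hM (by omega)
    rw [pow_one] at this
    omega
  · have := budget_le (κ := κ) (m := 2 ^ ℓ) hn
    omega
  · omega

/-- The state when the main loops start. -/
structure Ready (κ Q n R ℓ : ℕ) (μ : ℕ → ℕ) (σ : State) : Prop where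
  r0 : σ.reg 0 = n
  r1 : σ.reg 1 = R
  r2 : σ.reg 2 = 2 ^ ℓ
  r3 : σ.reg 3 = 7 ^ (Q * ℓ)
  r4 : σ.reg 4 = Q * ℓ
  r7 : σ.reg 7 = 0
  r8 : σ.reg 8 = 0
  mem : σ.mem = μ
  par : ∀ x ∈ [6, 11, 14, 15, 16, 17, 18, 23, 30, 31],
    σ.reg x = parameter κ Q n R (2 ^ ℓ) (7 ^ (Q * ℓ)) x

variable {T : ℕ} {δ : ENNReal} {K : State → ℕ → ENNReal → Prop} {D : Program}

/-- The time for the computation of the parameters. -/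
def setupTime (κ q Q n : ℕ) : ℕ :=
  (scaleCmd q Q).size * (n + 1) + (assigns (parameterList κ Q)).size

theorem countCmd_setup (hn : 1 ≤ n) (hQ : 3 * Q ≤ q) (hq : 2 * κ + 10 ≤ q)
    (hB : 2 * wordBound κ n < B) (h0 : σ.reg 0 = n) (h1 : σ.reg 1 = R)
    (hr : ∀ r < 40, 2 ≤ r → σ.reg r = 0)
    (h : ∀ ℓ σ', IsScale q n ℓ → Ready κ Q n R ℓ σ.mem σ' →
      Run B (seq (largeCmd D (κ + 3)) (seq (smallCmd κ Q) (assign 0 (var 7)))) σ' T δ K) :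
    Run B (countCmd D κ q Q) σ (T + setupTime κ q Q n) δ K := by
  have hT : T + setupTime κ q Q n = T + (assigns (parameterList κ Q)).size * 1 +
      (scaleCmd q Q).size * (n + 1) := by
    unfold setupTime
    omega
  rw [hT]
  refine Run.seq (scaleCmd_spec hQ (by omega) hn h0 (hr 4 (by norm_num) (by norm_num)) _ _) ?_
  rintro σ₁ T₁ δ₁ ⟨⟨hag, hm, ℓ, hℓ, h2, h3, h4⟩, rfl, rfl⟩
  have e0 := (hag 0 (by norm_num) (by decide)).trans h0
  have e1 := (hag 1 (by norm_num) (by decide)).trans h1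
  refine Run.seq (assigns_spec (parameter κ Q n R (2 ^ ℓ) (7 ^ (Q * ℓ))) (fun x hx => ?_) _ _) ?_
  · obtain ⟨a, -, b⟩ := parameterList_eval (κ := κ) (Q := Q) e0 e1 h2 h3 x hx
    exact ⟨a, parameter_lt hn hℓ hQ hq hB _, b⟩
  rintro σ₂ T₂ δ₂ ⟨⟨hm₂, hr₂⟩, rfl, rfl⟩
  have hlist : (parameterList κ Q).map Prod.fst = [6, 11, 14, 15, 16, 17, 18, 23, 30, 31] := rfl
  rw [hlist] at hr₂
  refine h ℓ σ₂ hℓ ⟨?_, ?_, ?_, ?_, ?_, ?_, ?_, hm₂.trans hm, fun x hx => ?_⟩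
  · rw [hr₂, if_neg (by decide), e0]
  · rw [hr₂, if_neg (by decide), e1]
  · rw [hr₂, if_neg (by decide), h2]
  · rw [hr₂, if_neg (by decide), h3]
  · rw [hr₂, if_neg (by decide), h4]
  · rw [hr₂, if_neg (by decide), hag 7 (by norm_num) (by decide), hr 7 (by norm_num) (by norm_num)]
  · rw [hr₂, if_neg (by decide), hag 8 (by norm_num) (by decide), hr 8 (by norm_num) (by norm_num)]
  · rw [hr₂, if_pos hx]

/-- The time for large ranges. -/
def largeTime (D : Program) (κ Q n m t : ℕ) : ℕ :=
  (n / m + 1) ^ (κ + 3) * groupTime D (κ + 3) m t +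
    budget κ n m * ((tallyCmd (κ + 3)).size * m ^ (κ + 3)) + 3 + (smallCmd κ Q).size + 2

/-- The time for small ranges. -/
def smallTime (D : Program) (κ Q n R ℓ : ℕ) : ℕ :=
  (largeCmd D (κ + 3)).size + (smallCmd κ Q).size * (n ^ κ * R * R * 7 ^ (Q * ℓ) *
    ((n / 2 ^ (Q * ℓ) + 1) * (n / 2 ^ (Q * ℓ) + 1) * (2 ^ (Q * ℓ) * 2 ^ (Q * ℓ) * (Q * ℓ + 1) + 1)
      + 1 + (n / 2 ^ (Q * ℓ) + 1) * (n / 2 ^ (Q * ℓ) + 1) * (n / 2 ^ (Q * ℓ) + 1)) + 1) + 2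

theorem countCmd_small (w : Instance (κ + 3) n R) (hR0 : 0 < R) (hR : R < (2 ^ ℓ) ^ (κ + 5))
    (h : Ready κ Q n R ℓ w.memory σ)
    (hK : ∀ σ', σ'.reg 0 = counting (κ + 3) n R w → K σ' T δ) :
    Run B (seq (largeCmd D (κ + 3)) (seq (smallCmd κ Q) (assign 0 (var 7)))) σ
      (T + smallTime D κ Q n R ℓ) δ K := by
  have hz : (2 ^ ℓ) ^ Q = 2 ^ (Q * ℓ) := by rw [← pow_mul, Nat.mul_comm]
  have hT := fun X => show T + ((largeCmd D (κ + 3)).size + (smallCmd κ Q).size * X + 2) =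
    T + 2 + (smallCmd κ Q).size * X + (largeCmd D (κ + 3)).size * 1 by omega
  unfold smallTime
  rw [hT]
  have h14 : σ.reg 14 = 0 := by
    rw [h.par 14 (by decide)]
    simp [parameter, hR]
  refine Run.seq (HX.loop_zero h14 (by norm_num) _ _) ?_
  rintro σ₁ T₁ δ₁ ⟨rfl, rfl, rfl⟩
  have hpar : ∀ x ∈ [6, 11, 14, 15, 16, 17, 18, 23, 30, 31],
      (σ.set 5 0).reg x = parameter κ Q n R (2 ^ ℓ) (7 ^ (Q * ℓ)) x := fun x hx => by
    rw [State.set_reg, if_neg (by rintro rfl; revert hx; decide), h.par x hx]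
  have hs : SmallRange κ Q n R (2 ^ ℓ) (Q * ℓ) (n / 2 ^ (Q * ℓ) + 1) (n ^ (κ + 3) + 1) w.memory
      (σ.set 5 0) := by
    refine ⟨h.r0, h.r1, h.r2, h.r3, h.r4, hpar 16 (by decide), ?_, ?_, ?_, ?_, ?_, hz,
      fun x _ => by rw [State.set_mem, h.mem]⟩
    · rw [hpar 17 (by decide), parameter, hz]
    · rw [hpar 18 (by decide), parameter, hz]
    · rw [hpar 23 (by decide), parameter, hz]
    · rw [hpar 30 (by decide), parameter, hz]
    · rw [State.set_reg, if_neg (by norm_num), h.r7]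
      omega
  refine Run.seq (smallCmd_spec w hR0 ?_ hs ?_ _ _) ?_
  · have := Nat.lt_div_mul_add (a := n) (b := 2 ^ (Q * ℓ)) (by positivity)
    rw [Nat.mul_comm, Nat.succ_mul]
    omega
  · rw [hpar 15 (by decide)]
    simp [parameter, hR]
  rintro σ₂ T₂ δ₂ ⟨⟨hs₂, hc⟩, rfl, rfl⟩
  -- Both sides are below the modulus `n ^ (κ + 3) + 1`, so the congruence is an equality.
  have h7 : σ₂.reg 7 = counting (κ + 3) n R w := by
    have h7lt := hs₂.r7
    have hcl := w.counting_le
    rw [State.set_reg, if_neg (by norm_num), h.r7, Nat.cast_zero, zero_add,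
      ZMod.natCast_eq_natCast_iff'] at hc
    rwa [Nat.mod_eq_of_lt h7lt, Nat.mod_eq_of_lt (by omega)] at hc
  refine Run.of_lt fun _ hr _ => Run.assign (hr 7 (by norm_num)) (hK _ ?_)
  simp [State.set_reg, h7]

theorem countCmd_large (w : Instance (κ + 3) n R) (hn : 1 ≤ n) (hmn : 2 ^ ℓ ≤ n)
    (hR : (2 ^ ℓ) ^ (κ + 5) ≤ R) (hB : 2 * wordBound κ n < B)
    (h : Ready κ Q n R ℓ w.memory σ)
    (hwD : ∀ v : Instance (κ + 3) (2 ^ ℓ) R, D.WordsBelow v.init B)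
    (hhD : ∀ v : Instance (κ + 3) (2 ^ ℓ) R, D.HaltsWithin v.init t)
    (hK : ∀ σ' T' δ', T ≤ T' → 1 ≤ δ' ∨ σ'.reg 0 = counting (κ + 3) n R w → K σ' T' δ') :
    Run B (seq (largeCmd D (κ + 3)) (seq (smallCmd κ Q) (assign 0 (var 7)))) σ
      (T + largeTime D κ Q n (2 ^ ℓ) t) (groupError D t (budget κ n (2 ^ ℓ)) w hmn) K := by
  have hw1 : 1 ≤ wordBound κ n := Nat.one_le_pow _ _ (by positivity)
  have hSw := groups_le (κ := κ) hn (by positivity : 0 < 2 ^ ℓ) hmn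
  have hSm := groups_mul_le (κ := κ) hn hmn
  have hT : T + largeTime D κ Q n (2 ^ ℓ) t = T + 2 + (smallCmd κ Q).size +
      ((n / 2 ^ ℓ + 1) ^ (κ + 3) * groupTime D (κ + 3) (2 ^ ℓ) t +
    budget κ n (2 ^ ℓ) * ((tallyCmd (κ + 3)).size * (2 ^ ℓ) ^ (κ + 3)) + 3) := by
    unfold largeTime
    omega
  rw [hT]
  refine Run.seq (largeCmd_spec w hmn (by positivity) h.r0 h.r1 h.r2 (h.par 6 (by decide)) rfl h.r7
    h.r8 (h.par 11 (by decide)) ?_ (h.par 31 (by decide)) (fun x => by rw [h.mem]) ?_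
    (by simp only [parameter]; omega) hwD hhD _) ?_
  · rw [h.par 14 (by decide)]
    simp [parameter, hR]
  · have := pow_le_wordBound (κ := κ) (x := (κ + 3) * n) (a := 2) hn (by nlinarith) (by omega)
    rw [pow_two] at this
    simp only [parameter]
    omega
  rintro σ₁ T₁ δ₁ ⟨hT₁, hag, hm, hgood⟩
  obtain ⟨T₁, rfl⟩ := Nat.exists_eq_add_of_le' hT₁
  have h15 : σ₁.reg 15 = 0 := by
    rw [hag 15 (by norm_num) (by decide), h.par 15 (by decide)]
    simp [parameter, hR]
  rw [show T₁ + (T + 2 + (smallCmd κ Q).size) = T₁ + T + 2 + (smallCmd κ Q).size * 1 by omega]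
  refine Run.seq (HX.loop_zero h15 (by norm_num) _ _) ?_
  rintro σ₂ T₂ δ₂ ⟨rfl, rfl, rfl⟩
  refine Run.of_lt fun _ hr _ => Run.assign (hr 7 (by norm_num)) (hK _ _ _ (by omega) ?_)
  exact hgood.imp_right fun h => by simp [State.set_reg, h]

/-- From commands to programs. -/
theorem Run.ok {c : Cmd} {a : ℕ} (w : Instance (κ + 3) n R) (hB : 2 ≤ B) (hl : c.lits ≤ B)
    (hn : n < B) (hR : R < B) (hw : ∀ a, w.memory a < B)
    (h : Run B c ⟨w.init.reg, w.init.mem⟩ T δ fun σ' _ δ' => 1 ≤ δ' ∨ σ'.reg 0 = a) :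
    Ok (c.code (max 40 c.bound) 0) (B ^ 2 ^ c.depth) (fun s => s.reg 0 = a) T δ w.init := by
  have hBW : B ≤ B ^ 2 ^ c.depth := Nat.le_self_pow (by positivity) B
  have hreg : ∀ r, w.init.reg r < B := fun r => by
    change (if r = 0 then n else if r = 1 then R else 0) < B
    split_ifs <;> omega
  refine h (max 40 c.bound) _ _ 0 _ ⟨hB, le_max_left _ _⟩ (le_max_right _ _) hl le_rfl ?_ ?_ _ rfl
    ⟨fun _ _ => rfl, rfl, fun r _ => hreg r, fun r => (hreg r).trans_le hBW, hw⟩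
  · intro i _
    simp
  · intro σ' T' δ' hK s' hp hs'
    refine Ok.of_halted (by omega) (hs'.below hBW) ?_
    rw [or_comm]
    exact hK.imp_right fun h => by rw [hs'.reg 0 (by omega), h]

end Counting

end ACZkC

namespace ACZkC

/-! ### The error probability -/

section Error

variable {k κ n R m t : ℕ}

theorem toOuterMeasure_eq_expect {α : Type*} (p : PMF α) (S : Set α) [DecidablePred (· ∈ S)] :
    p.toOuterMeasure S = expect p fun x => if x ∈ S then 1 else 0 := by
  rw [PMF.toOuterMeasure_apply, expect]
  refine tsum_congr fun x => ?_
  by_cases h : x ∈ S <;> simp [h]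

theorem expect_const {α : Type*} (p : PMF α) (c : ENNReal) : expect p (fun _ => c) = c := by
  rw [expect, ENNReal.tsum_mul_right, PMF.tsum_coe, one_mul]

theorem expect_add {α : Type*} (p : PMF α) (φ ψ : α → ENNReal) :
    expect p (fun x => φ x + ψ x) = expect p φ + expect p ψ := by
  simp only [expect, mul_add, ENNReal.tsum_add]

theorem expect_sum {α ι : Type*} (p : PMF α) (s : Finset ι) (φ : ι → α → ENNReal) :
    expect p (fun x => ∑ i ∈ s, φ i x) = ∑ i ∈ s, expect p (φ i) := by
  classical
  induction s using Finset.induction_on with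
  | empty => simp [expect]
  | insert i s hi ih => simp only [Finset.sum_insert hi, expect_add, ih]

open scoped Classical in
theorem successProb_add [NeZero R] (P : Program) (answer : Instance k n R → ℕ) (t : ℕ) :
    successProb P k n R answer t + expect (PMF.uniformOfFintype (Instance k n R)) (fun w =>
      (P.run w.init t).toOuterMeasure {s | ¬ s.reg 0 = answer w}) = 1 := by
  rw [successProb, toOuterMeasure_eq_expect, expect_bind, ← expect_add]
  refine Eq.trans ?_ (expect_const (PMF.uniformOfFintype (Instance k n R)) 1)
  refine congrArg _ (funext fun w => ?_)
  rw [expect_map, toOuterMeasure_eq_expect, ← expect_add]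
  refine Eq.trans ?_ (expect_const (P.run w.init t) 1)
  refine congrArg _ (funext fun s => ?_)
  by_cases h : s.reg 0 = answer w <;> simp [h]

theorem ofReal_le_successProb [NeZero R] {P : Program} {answer : Instance k n R → ℕ} {p : ℝ}
    (hp : 0 ≤ p) (h : expect (PMF.uniformOfFintype (Instance k n R)) (fun w =>
      (P.run w.init t).toOuterMeasure {s | ¬ s.reg 0 = answer w}) ≤ ENNReal.ofReal p) :
    ENNReal.ofReal (1 - p) ≤ successProb P k n R answer t := by
  rw [ENNReal.ofReal_sub _ hp, ENNReal.ofReal_one, tsub_le_iff_right, ← successProb_add P answer t]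
  gcongr

theorem expect_wrongProb_le [NeZero R] {D : Program} {p : ℝ}
    (h : ENNReal.ofReal (1 - p) ≤ successProb D k m R (decision k m R) t) :
    expect (PMF.uniformOfFintype (Instance k m R)) (wrongProb D t) ≤ ENNReal.ofReal p := by
  classical
  have h1 := successProb_add D (decision k m R) t
  have h2 : (fun w : Instance k m R => (D.run w.init t).toOuterMeasure
      {s | ¬ s.reg 0 = decision k m R w}) = wrongProb D t := by
    funext w
    rw [toOuterMeasure_eq_expect, wrongProb]
    refine congrArg _ (funext fun s => ?_)
    by_cases h : s.reg 0 = decision k m R w <;> simp [h]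
  rw [h2] at h1
  have hfin : successProb D k m R (decision k m R) t ≠ ⊤ := fun hT => by simp [hT] at h1
  refine (ENNReal.add_le_add_iff_left hfin).1 ?_
  rw [h1, ← ENNReal.ofReal_one, ← sub_add_cancel 1 p]
  exact (ENNReal.ofReal_add_le).trans (by gcongr)

/-- Either more than `U` groups contain zero cliques, which forces many zero cliques in `w`, or `D`
errs on some group. Each group is a uniform instance and adds at most `p`. -/
theorem expect_groupError_le [NeZero R] {D : Program} {p : ℝ} {U : ℕ} (hmn : m ≤ n)
    (h : ENNReal.ofReal (1 - p) ≤ successProb D k m R (decision k m R) t) :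
    expect (PMF.uniformOfFintype (Instance k n R)) (fun w => groupError D t U w hmn) ≤
      expect (PMF.uniformOfFintype (Instance k n R))
        (fun w => if U < 2 ^ k * counting k n R w then 1 else 0) +
      ((n / m + 1) ^ k : ℕ) * ENNReal.ofReal p := by
  have h1 : ∀ w : Instance k n R, groupError D t U w hmn ≤
      (if U < 2 ^ k * counting k n R w then 1 else 0) +
        ∑ g ∈ Finset.range ((n / m + 1) ^ k), wrongProb D t (w.group hmn g) := by
    intro w
    unfold groupError
    split_ifs with h1 h2
    · exact le_self_add
    · exact absurd (h1.trans_le (w.sum_decision_le hmn)) h2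
    · exact le_add_self
    · exact le_add_self
  refine (expect_mono _ h1).trans ?_
  rw [expect_add, expect_sum]
  gcongr
  rw [← nsmul_eq_mul, ← Finset.card_range ((n / m + 1) ^ k), ← Finset.sum_const, Finset.card_range]
  refine Finset.sum_le_sum fun g _ => ?_
  refine le_trans (le_of_eq ?_) (expect_wrongProb_le h)
  exact expect_sub _ _ (wrongProb D t)

/-- `(1 + 1 / R) ^ (n ^ 2) ≤ exp (n ^ 2 / R)`, and `R ≥ m ^ (a + 1)` with `m ≥ 8` gives `n ^ 2 / R ≤
(r + 1) / 8 ≤ r / 4`. As `exp (r / 4) ≤ 2 ^ (r / 2)`, the quotient is at most `2 ^ (-r / 2)`, and `r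
≥ n`. -/
theorem one_add_inv_pow_le {n m R a r : ℕ} (hn : 1 ≤ n) (hm : 8 ≤ m) (hmn : m ^ a ≤ n)
    (hR : m ^ (a + 1) ≤ R) (hr : r = n * n / m ^ a) :
    ((R + 1 : ℝ) / R) ^ n ^ 2 / 2 ^ r ≤ (1 / 2 : ℝ) ^ (((n : ℝ) - 1) / 2) := by
  have hR0 : 0 < R := lt_of_lt_of_le (by positivity) hR
  have hRr : (0 : ℝ) < R := by exact_mod_cast hR0
  have hmr : (8 : ℝ) ≤ m := by exact_mod_cast hm
  have hnr : (1 : ℝ) ≤ n := by exact_mod_cast hn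
  have hrn : n ≤ r := by
    rw [hr, Nat.le_div_iff_mul_le (by positivity)]
    exact Nat.mul_le_mul_left _ hmn
  have hrnr : (n : ℝ) ≤ r := by exact_mod_cast hrn
  have hr2 : (n : ℝ) * n / m ^ a ≤ r + 1 := by
    rw [hr]
    have := (Nat.lt_floor_add_one ((n * n : ℕ) / (m ^ a : ℕ) : ℝ)).le
    rw [Nat.floor_div_eq_div] at this
    push_cast at this ⊢
    exact this
  have hx : (n : ℝ) ^ 2 * (1 / R) ≤ r / 4 := by
    have h1 : (n : ℝ) ^ 2 * (1 / R) ≤ (n * n / m ^ a) / m := by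
      rw [mul_one_div, div_div, pow_two, ← pow_succ]
      gcongr
      exact_mod_cast hR
    have h2 : (n * n / m ^ a) / (m : ℝ) ≤ (r + 1) / 8 := by gcongr
    linarith
  have hexp : ((R + 1 : ℝ) / R) ^ n ^ 2 ≤ (2 : ℝ) ^ ((r : ℝ) / 2) := by
    calc ((R + 1 : ℝ) / R) ^ n ^ 2 = (1 / R + 1) ^ n ^ 2 := by
          rw [add_div, div_self hRr.ne', add_comm]
      _ ≤ Real.exp (1 / R) ^ n ^ 2 := by
          gcongr
          exact Real.add_one_le_exp _
      _ = Real.exp ((n : ℝ) ^ 2 * (1 / R)) := by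
          rw [← Real.exp_nat_mul]
          push_cast
          rfl
      _ ≤ Real.exp (r / 4) := Real.exp_le_exp.2 hx
      _ ≤ (2 : ℝ) ^ ((r : ℝ) / 2) := by
          rw [Real.rpow_def_of_pos two_pos]
          refine Real.exp_le_exp.2 ?_
          have := Real.log_two_gt_d9
          nlinarith
  calc _ ≤ (2 : ℝ) ^ ((r : ℝ) / 2) / 2 ^ r := by gcongr
    _ = (1 / 2 : ℝ) ^ ((r : ℝ) / 2) := by
        rw [← Real.rpow_natCast, ← Real.rpow_sub two_pos, one_div, Real.inv_rpow two_pos.le,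
          ← Real.rpow_neg two_pos.le]
        congr 1
        ring
    _ ≤ _ := Real.rpow_le_rpow_of_exponent_ge (by norm_num) (by norm_num) (by linarith)

theorem div_le_of_mul_le {a c N R r s : ℕ} {x : ℝ} (hc : 0 < c) (hR : 0 < R)
    (h : a * (2 ^ r * R ^ s) ≤ N * (c * (R + 1) ^ s))
    (hx : ((R + 1 : ℝ) / R) ^ s / 2 ^ r ≤ x) : (a / c : ℝ) ≤ N * x := by
  have hRr : (0 : ℝ) < R := by exact_mod_cast hR
  have hcr : (0 : ℝ) < c := by exact_mod_cast hc
  have hr : (a : ℝ) * (2 ^ r * R ^ s) ≤ N * (c * (R + 1) ^ s) := by exact_mod_cast h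
  refine le_trans ?_ (mul_le_mul_of_nonneg_left hx (Nat.cast_nonneg N))
  rw [div_pow, div_div, ← mul_div_assoc, div_le_div_iff₀ hcr (by positivity)]
  calc _ = (a : ℝ) * (2 ^ r * R ^ s) := by ring
    _ ≤ _ := hr
    _ = _ := by ring

/-- The number of zero cliques is rarely large. -/
theorem expect_counting_gt_le [NeZero R] (hn : 1 ≤ n) (hm : 8 ≤ m) (hmn : m ^ (κ + 4) ≤ n)
    (hR : m ^ (κ + 5) ≤ R) :
    expect (PMF.uniformOfFintype (Instance (κ + 3) n R)) (fun w =>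
      if budget κ n m < 2 ^ (κ + 3) * counting (κ + 3) n R w then 1 else 0) ≤
      ENNReal.ofReal ((n : ℝ) ^ (κ + 3) * ((1 / 2 : ℝ) ^ (((n : ℝ) - 1) / 2))) := by
  have hN := card_counting_gt (n := n) (R := R) (k := κ + 3) (r := n * n / m ^ (κ + 4))
    (b := n ^ (κ + 1) * (n * n / m ^ (κ + 4)))
    (by omega) (by rw [← mul_assoc, ← pow_add, Nat.add_comm 2]) hn
  have hc : ∀ w : Instance (κ + 3) n R, budget κ n m < 2 ^ (κ + 3) * counting (κ + 3) n R w ↔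
      n ^ (κ + 1) * (n * n / m ^ (κ + 4)) < counting (κ + 3) n R w := fun w => by
    rw [budget, mul_assoc, Nat.mul_lt_mul_left (by positivity)]
  have hc0 : 0 < Fintype.card (Instance (κ + 3) n R) := Fintype.card_pos
  have h := div_le_of_mul_le hc0 (Nat.pos_of_ne_zero (NeZero.ne R)) hN
    (one_add_inv_pow_le hn hm hmn hR rfl)
  rw [Nat.cast_pow] at h
  refine le_trans (le_of_eq ?_) (ENNReal.ofReal_le_ofReal h)
  rw [expect_uniform]
  simp only [hc]
  rw [Finset.sum_boole, ENNReal.ofReal_div_of_pos (by exact_mod_cast hc0), ENNReal.ofReal_natCast,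
    ENNReal.ofReal_natCast, ENNReal.div_eq_inv_mul]

end Error

end ACZkC

namespace ACZkC

/-! ### The running time -/

section Time

variable {κ q Q n R ℓ t : ℕ} {D : Program}

/-- `7 ^ 6 * 2 ≤ 8 ^ 6`: six levels of Strassen's algorithm save a factor `2`, so `6 * e * ℓ` levels
save `m ^ e`. -/
theorem seven_pow_mul_le {e : ℕ} (hQ : Q = 6 * e) : 7 ^ (Q * ℓ) * (2 ^ ℓ) ^ e ≤ (2 ^ (Q * ℓ)) ^ 3 := by
  have h1 : 7 ^ (Q * ℓ) * (2 ^ ℓ) ^ e = (7 ^ 6 * 2) ^ (e * ℓ) := by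
    rw [mul_pow, ← pow_mul, ← pow_mul, hQ]
    congr 2 <;> ring
  have h2 : (2 ^ (Q * ℓ)) ^ 3 = (8 ^ 6) ^ (e * ℓ) := by
    rw [show 8 = 2 ^ 3 by norm_num, ← pow_mul, ← pow_mul, ← pow_mul, hQ]
    congr 1
    ring
  rw [h1, h2]
  exact Nat.pow_le_pow_left (by norm_num) _

/-- The constant in the running time for small ranges. -/
def smallConst (D : Program) (κ Q : ℕ) : ℕ :=
  (largeCmd D (κ + 3)).size + (smallCmd κ Q).size * 18 + 2

/-- Two costs count, with `z = m ^ Q` and `M * z ≤ 2 * n`. Forming the linear forms takes `O(n ^ 2 *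
z)` per term, and `R ^ 2 * 7 ^ L * z * m ≤ n` because of the choice of `q`. Multiplying the blocks
takes `M ^ 3` per term; here the savings `m ^ (2 * κ + 11)` of Strassen's algorithm absorb `R ^ 2 *
m`. -/
theorem smallTime_mul_le (hn : 1 ≤ n) (hQ : Q = 6 * (2 * κ + 11)) (hq : 4 * Q + 2 * κ + 11 ≤ q)
    (hℓ : IsScale q n ℓ) (hR : R ≤ (2 ^ ℓ) ^ (κ + 5)) :
    smallTime D κ Q n R ℓ * 2 ^ ℓ ≤ smallConst D κ Q * n ^ (κ + 3) := by
  have hmn : 2 ^ ℓ ≤ n := hℓ.base_le (by omega)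
  have hm0 : 0 < 2 ^ ℓ := by positivity
  have hz0 : 0 < 2 ^ (Q * ℓ) := by positivity
  have hzm : 2 ^ (Q * ℓ) = (2 ^ ℓ) ^ Q := by rw [← pow_mul, Nat.mul_comm]
  have hzn : 2 ^ (Q * ℓ) ≤ n := hzm ▸ hℓ.pow_le (by omega)
  have hL : Q * ℓ + 1 ≤ 2 ^ (Q * ℓ) := Nat.lt_two_pow_self
  have h7 : 7 ^ (Q * ℓ) ≤ (2 ^ ℓ) ^ (3 * Q) := by
    calc 7 ^ (Q * ℓ) ≤ (2 ^ 3) ^ (Q * ℓ) := Nat.pow_le_pow_left (by norm_num) _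
      _ = (2 ^ ℓ) ^ (3 * Q) := by rw [← pow_mul, ← pow_mul]; congr 1; ring
  have h78 := seven_pow_mul_le (ℓ := ℓ) hQ
  have hRR : R * R ≤ (2 ^ ℓ) ^ (2 * κ + 10) := by
    calc R * R ≤ (2 ^ ℓ) ^ (κ + 5) * (2 ^ ℓ) ^ (κ + 5) := Nat.mul_le_mul hR hR
      _ = _ := by rw [← pow_add]; congr 1; ring
  have hMz := mul_div_add_one_le hzn
  have hmk : 2 ^ ℓ ≤ n ^ (κ + 3) := hmn.trans (Nat.le_self_pow (by omega) n)
  have hbig : (2 ^ ℓ) ^ (2 * κ + 10) * (2 ^ ℓ) ^ (3 * Q) * (2 ^ ℓ) ^ Q * 2 ^ ℓ ≤ n := by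
    calc _ = (2 ^ ℓ) ^ (4 * Q + 2 * κ + 11) := by
          rw [← pow_add, ← pow_add, ← pow_succ]
          congr 1
          ring
      _ ≤ n := hℓ.pow_le hq
  unfold smallTime smallConst
  rw [← hzm] at hbig
  generalize n / 2 ^ (Q * ℓ) + 1 = M at *
  generalize (2 ^ ℓ) ^ (3 * Q) = P at *
  generalize 2 ^ (Q * ℓ) = z at *
  generalize 7 ^ (Q * ℓ) = p at *
  generalize Q * ℓ = L at *
  have e1 : (2 ^ ℓ) ^ (2 * κ + 11) = (2 ^ ℓ) ^ (2 * κ + 10) * 2 ^ ℓ := pow_succ _ _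
  rw [e1] at h78
  generalize (2 ^ ℓ) ^ (2 * κ + 10) = r at *
  generalize 2 ^ ℓ = m at *
  have hM2 : M * M * (z * z) ≤ 4 * (n * n) := by
    calc M * M * (z * z) = (M * z) * (M * z) := by ring
      _ ≤ (2 * n) * (2 * n) := Nat.mul_le_mul hMz hMz
      _ = _ := by ring
  have hfirst : M * M * (z * z * (L + 1) + 1) + 1 ≤ 9 * (n * n * z) := by
    have h1 : M * M * (z * z * (L + 1)) ≤ 4 * (n * n * z) := by
      calc M * M * (z * z * (L + 1)) = M * M * (z * z) * (L + 1) := by ring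
        _ ≤ 4 * (n * n) * z := Nat.mul_le_mul hM2 hL
        _ = _ := by ring
    have h2 : M * M ≤ 4 * (n * n * z) := by
      calc M * M ≤ M * M * (z * z) := Nat.le_mul_of_pos_right _ (by positivity)
        _ ≤ 4 * (n * n) := hM2
        _ ≤ 4 * (n * n) * z := Nat.le_mul_of_pos_right _ hz0
        _ = _ := by ring
    have h3 : 1 ≤ n * n * z := Nat.mul_pos (Nat.mul_pos hn hn) hz0
    calc _ = M * M * (z * z * (L + 1)) + M * M + 1 := by ring
      _ ≤ _ := by omega
  have hA : n ^ κ * R * R * p * (9 * (n * n * z)) * m ≤ 9 * n ^ (κ + 3) := by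
    calc _ = 9 * (n ^ κ * (n * n) * (R * R * p * z * m)) := by ring
      _ ≤ 9 * (n ^ κ * (n * n) * (r * P * z * m)) := by gcongr
      _ ≤ 9 * (n ^ κ * (n * n) * n) := by gcongr
      _ = _ := by ring
  have hB : n ^ κ * R * R * p * (M * M * M) * m ≤ 8 * n ^ (κ + 3) := by
    calc _ = n ^ κ * ((R * R) * p * m) * M ^ 3 := by ring
      _ ≤ n ^ κ * (r * p * m) * M ^ 3 := by gcongr
      _ = n ^ κ * (p * (r * m)) * M ^ 3 := by ring
      _ ≤ n ^ κ * z ^ 3 * M ^ 3 := by gcongr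
      _ = n ^ κ * (M * z) ^ 3 := by ring
      _ ≤ n ^ κ * (2 * n) ^ 3 := by gcongr
      _ = _ := by ring
  have hX : (n ^ κ * R * R * p * (M * M * (z * z * (L + 1) + 1) + 1 + M * M * M) + 1) * m ≤
      18 * n ^ (κ + 3) := by
    calc _ = n ^ κ * R * R * p * (M * M * (z * z * (L + 1) + 1) + 1) * m +
          n ^ κ * R * R * p * (M * M * M) * m + m := by ring
      _ ≤ n ^ κ * R * R * p * (9 * (n * n * z)) * m + 8 * n ^ (κ + 3) + n ^ (κ + 3) := by gcongr
      _ ≤ _ := by omega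
  generalize n ^ κ * R * R * p * (M * M * (z * z * (L + 1) + 1) + 1 + M * M * M) + 1 = X at *
  calc _ = (largeCmd D (κ + 3)).size * m + (smallCmd κ Q).size * (X * m) + 2 * m := by ring
    _ ≤ (largeCmd D (κ + 3)).size * n ^ (κ + 3) + (smallCmd κ Q).size * (18 * n ^ (κ + 3)) +
        2 * n ^ (κ + 3) := by gcongr
    _ = _ := by ring

/-- The constant in the running time for the computation of the parameters. -/
def setupConst (κ q Q : ℕ) : ℕ :=
  2 * (scaleCmd q Q).size + (assigns (parameterList κ Q)).size

theorem setupTime_mul_le {m : ℕ} (hn : 1 ≤ n) (hmn : m ≤ n) :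
    setupTime κ q Q n * m ≤ setupConst κ q Q * n ^ (κ + 3) := by
  have h1 : m ≤ n ^ (κ + 3) := hmn.trans (Nat.le_self_pow (by omega) n)
  have h2 : (n + 1) * m ≤ 2 * n ^ (κ + 3) := by
    calc (n + 1) * m ≤ (2 * n) * n := Nat.mul_le_mul (by omega) hmn
      _ = 2 * n ^ 2 := by ring
      _ ≤ _ := Nat.mul_le_mul_left _ (Nat.pow_le_pow_right hn (by omega))
  unfold setupTime setupConst
  calc _ = (scaleCmd q Q).size * ((n + 1) * m) + (assigns (parameterList κ Q)).size * m := by ring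
    _ ≤ (scaleCmd q Q).size * (2 * n ^ (κ + 3)) +
        (assigns (parameterList κ Q)).size * n ^ (κ + 3) := by gcongr
    _ = _ := by ring

/-- The cap contains the quotient by `m ^ (k + 1)`, one power more than a search costs; this is the
saving. -/
theorem budget_mul_le {m : ℕ} : budget κ n m * m ^ (κ + 3) * m ≤ 2 ^ (κ + 3) * n ^ (κ + 3) := by
  calc _ = 2 ^ (κ + 3) * n ^ (κ + 1) * (n * n / m ^ (κ + 4) * m ^ (κ + 4)) := by
        unfold budget
        ring
    _ ≤ 2 ^ (κ + 3) * n ^ (κ + 1) * (n * n) := Nat.mul_le_mul_left _ (Nat.div_mul_le_self _ _)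
    _ = _ := by ring

/-- The constant in the running time for a group. -/
def groupConst (D : Program) (κ : ℕ) : ℕ :=
  (prepareCmd (κ + 3) D.regBound).size * ((κ + 3) * (κ + 3) + 1) + (tallyCmd (κ + 3)).size + 6

theorem groupTime_le {m : ℕ} (hm : 1 ≤ m) :
    groupTime D (κ + 3) m t ≤ groupConst D κ * m ^ 2 + 3 * t := by
  have h1 : 1 ≤ m ^ 2 := Nat.one_le_pow _ _ hm
  unfold groupTime groupConst
  generalize (prepareCmd (κ + 3) D.regBound).size = a
  generalize (tallyCmd (κ + 3)).size = c
  calc _ ≤ a * (((κ + 3) * m) * ((κ + 3) * m) + m ^ 2) + 3 * t + c * m ^ 2 + 6 * m ^ 2 := by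
        have := Nat.mul_le_mul_left c h1
        have := Nat.mul_le_mul_left a (Nat.add_le_add_left h1 (((κ + 3) * m) * ((κ + 3) * m)))
        omega
    _ = _ := by ring

/-- The constant in the running time for large ranges. -/
noncomputable def largeConst (D : Program) (κ Q : ℕ) (C : ℝ) : ℝ :=
  2 ^ (κ + 3) * (groupConst D κ + 3 * C) + 2 ^ (κ + 3) * (tallyCmd (κ + 3)).size +
    (5 + (smallCmd κ Q).size)

theorem largeConst_nonneg {C : ℝ} (hC : 0 ≤ C) : 0 ≤ largeConst D κ Q C := by
  unfold largeConst
  positivity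

/-- Calls of `D` save `m ^ e`, everything else saves a factor `m`; `e ≤ 1` makes the former the
weaker saving. -/
theorem largeTime_le {m : ℕ} {C e : ℝ} (he : e ≤ 1) (hm : 1 ≤ m) (hmn : m ≤ n)
    (ht : (t : ℝ) ≤ C * (m : ℝ) ^ ((κ + 3 : ℕ) - e)) :
    (largeTime D κ Q n m t : ℝ) ≤
      largeConst D κ Q C * ((n : ℝ) ^ (κ + 3) * (m : ℝ) ^ (-e)) := by
  have hmr : (1 : ℝ) ≤ m := by exact_mod_cast hm
  have hm0 : (0 : ℝ) < m := by linarith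
  have hnr : (m : ℝ) ≤ n := by exact_mod_cast hmn
  have hinv : (m : ℝ)⁻¹ ≤ (m : ℝ) ^ (-e) := by
    rw [← Real.rpow_neg_one]
    exact Real.rpow_le_rpow_of_exponent_le hmr (by linarith)
  have hgroup : ((n / m + 1 : ℕ) ^ (κ + 3) * groupTime D (κ + 3) m t : ℝ) ≤
      2 ^ (κ + 3) * (groupConst D κ + 3 * C) * ((n : ℝ) ^ (κ + 3) * (m : ℝ) ^ (-e)) := by
    have h1 : ((n / m + 1 : ℕ) : ℝ) ^ (κ + 3) * (m : ℝ) ^ (κ + 3) ≤ (2 * n) ^ (κ + 3) := by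
      rw [← mul_pow]
      exact pow_le_pow_left₀ (by positivity) (by exact_mod_cast mul_div_add_one_le hmn) _
    have h2 : (groupTime D (κ + 3) m t : ℝ) ≤ groupConst D κ * (m : ℝ) ^ 2 + 3 * t := by
      exact_mod_cast groupTime_le hm
    -- Copying the input of a call takes time `m ^ 2`, which is dominated since `κ + 3 - e ≥ 2`.
    have h3 : (m : ℝ) ^ 2 ≤ (m : ℝ) ^ ((κ + 3 : ℕ) - e) := by
      rw [← Real.rpow_natCast]
      refine Real.rpow_le_rpow_of_exponent_le hmr ?_
      push_cast
      have : (0 : ℝ) ≤ κ := Nat.cast_nonneg κ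
      linarith
    have h4 : (groupTime D (κ + 3) m t : ℝ) ≤
        (groupConst D κ + 3 * C) * ((m : ℝ) ^ (κ + 3) * (m : ℝ) ^ (-e)) := by
      rw [← Real.rpow_natCast (m : ℝ) (κ + 3), ← Real.rpow_add hm0, ← sub_eq_add_neg]
      have h0 : (0 : ℝ) ≤ groupConst D κ := Nat.cast_nonneg _
      nlinarith [mul_le_mul_of_nonneg_left h3 h0]
    -- The sign of `C` is not known; nonnegativity follows because the expression bounds a running
    -- time.
    have hK : 0 ≤ (groupConst D κ + 3 * C) * (m : ℝ) ^ (-e) := by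
      have h5 : 0 ≤ (groupConst D κ + 3 * C) * ((m : ℝ) ^ (κ + 3) * (m : ℝ) ^ (-e)) :=
        (Nat.cast_nonneg _).trans h4
      have h6 : 0 < (m : ℝ) ^ (κ + 3) := by positivity
      rw [mul_left_comm] at h5
      exact nonneg_of_mul_nonneg_right h5 h6
    calc _ ≤ ((n / m + 1 : ℕ) : ℝ) ^ (κ + 3) *
          ((groupConst D κ + 3 * C) * ((m : ℝ) ^ (κ + 3) * (m : ℝ) ^ (-e))) := by gcongr
      _ = ((n / m + 1 : ℕ) : ℝ) ^ (κ + 3) * (m : ℝ) ^ (κ + 3) *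
          ((groupConst D κ + 3 * C) * (m : ℝ) ^ (-e)) := by ring
      _ ≤ (2 * n) ^ (κ + 3) * ((groupConst D κ + 3 * C) * (m : ℝ) ^ (-e)) := by gcongr
      _ = _ := by ring
  have hbud : (budget κ n m * ((tallyCmd (κ + 3)).size * m ^ (κ + 3)) : ℝ) ≤
      2 ^ (κ + 3) * (tallyCmd (κ + 3)).size * ((n : ℝ) ^ (κ + 3) * (m : ℝ) ^ (-e)) := by
    have h1 : (budget κ n m * m ^ (κ + 3) * m : ℝ) ≤ 2 ^ (κ + 3) * n ^ (κ + 3) := by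
      exact_mod_cast budget_mul_le (κ := κ) (n := n) (m := m)
    have h2 : (budget κ n m * m ^ (κ + 3) : ℝ) ≤ 2 ^ (κ + 3) * n ^ (κ + 3) * (m : ℝ) ^ (-e) := by
      rw [← le_div_iff₀ hm0, div_eq_mul_inv] at h1
      exact h1.trans (by gcongr)
    calc _ = (tallyCmd (κ + 3)).size * (budget κ n m * m ^ (κ + 3) : ℝ) := by ring
      _ ≤ (tallyCmd (κ + 3)).size * (2 ^ (κ + 3) * n ^ (κ + 3) * (m : ℝ) ^ (-e)) := by gcongr
      _ = _ := by ring
  have hone : (1 : ℝ) ≤ (n : ℝ) ^ (κ + 3) * (m : ℝ) ^ (-e) := by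
    calc (1 : ℝ) = m * (m : ℝ)⁻¹ := (mul_inv_cancel₀ hm0.ne').symm
      _ ≤ (n : ℝ) ^ (κ + 3) * (m : ℝ) ^ (-e) := by
          gcongr
          exact hnr.trans (le_self_pow₀ (hmr.trans hnr) (by omega))
  have hc : (5 + (smallCmd κ Q).size : ℝ) ≤
      (5 + (smallCmd κ Q).size) * ((n : ℝ) ^ (κ + 3) * (m : ℝ) ^ (-e)) :=
    le_mul_of_one_le_right (by positivity) hone
  unfold largeTime largeConst
  push_cast
  push_cast at hgroup
  linarith

end Time

end ACZkC

namespace ACZkC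

/-! ### Asymptotics -/

section Asymptotics

variable {κ q Q n R ℓ t : ℕ} {D : Program}

/-- `f n = -log_n (g n)` is the exact exponent, and it tends to infinity because `g` is below every
inverse power. -/
theorem exists_rate {g : ℕ → ℝ} (hg : ∀ᶠ n in atTop, 0 < g n)
    (h : ∀ K : ℕ, ∀ᶠ n : ℕ in atTop, g n ≤ (n : ℝ) ^ (-(K : ℝ))) :
    ∃ f : ℕ → ℝ, Tendsto f atTop atTop ∧ ∀ᶠ n : ℕ in atTop, g n ≤ (n : ℝ) ^ (-f n) := by
  refine ⟨fun n => -Real.logb n (g n), tendsto_atTop.2 fun x => ?_, ?_⟩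
  · filter_upwards [hg, h ⌈x⌉₊, eventually_ge_atTop 2] with n h0 h1 h2
    have hn : (1 : ℝ) < n := by exact_mod_cast h2
    have := (Real.logb_le_iff_le_rpow hn h0).2 h1
    linarith [Nat.le_ceil x]
  · filter_upwards [hg, eventually_ge_atTop 2] with n h0 h2
    have hn : (1 : ℝ) < n := by exact_mod_cast h2
    rw [neg_neg, Real.rpow_logb (by linarith) hn.ne' h0]

/-- The parameter `m` is `2 ^ scale q n`. -/
def scale (q n : ℕ) : ℕ := Nat.log 2 n / q

theorem isScale_scale (hq : 1 ≤ q) (hn : 1 ≤ n) : IsScale q n (scale q n) := by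
  refine ⟨?_, ?_⟩
  · rw [← pow_mul]
    exact (Nat.pow_le_pow_right two_pos (Nat.div_mul_le_self _ _)).trans
      (Nat.pow_log_le_self 2 (by omega))
  · rw [← pow_mul]
    refine (Nat.lt_pow_succ_log_self one_lt_two n).trans_le (Nat.pow_le_pow_right two_pos ?_)
    have := Nat.lt_div_mul_add (a := Nat.log 2 n) (b := q) hq
    unfold scale
    rw [Nat.succ_mul]
    omega

/-- Identifies the exponent found by the program with `scale q n`, on which the analysis is based.
-/
theorem IsScale.unique {ℓ' : ℕ} (h : IsScale q n ℓ) (h' : IsScale q n ℓ') : ℓ = ℓ' := by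
  have aux : ∀ {a b}, IsScale q n a → IsScale q n b → a ≤ b := by
    intro a b ha hb
    by_contra! hab
    have h1 : (2 ^ (b + 1)) ^ q ≤ (2 ^ a) ^ q :=
      Nat.pow_le_pow_left (Nat.pow_le_pow_right two_pos hab) q
    have := ha.le
    have := hb.lt
    omega
  exact le_antisymm (aux h h') (aux h' h)

theorem tendsto_two_pow_scale (hq : 1 ≤ q) : Tendsto (fun n => 2 ^ scale q n) atTop atTop := by
  refine tendsto_atTop.2 fun b => ?_
  filter_upwards [eventually_ge_atTop ((2 * b) ^ q), eventually_ge_atTop 1] with n hn h1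
  by_contra! h
  have h2 := (isScale_scale hq h1).lt
  have h3 : (2 ^ (scale q n + 1)) ^ q ≤ (2 * b) ^ q := by
    refine Nat.pow_le_pow_left ?_ q
    rw [pow_succ]
    omega
  omega

/-- `n` is polynomial in `m`. Hence the ranges allowed for `n` are allowed for `m`, and a
superpolynomially small error in `m` is one in `n`. -/
theorem IsScale.lt_pow (h : IsScale q n ℓ) (hℓ : 2 ≤ 2 ^ ℓ) : n < (2 ^ ℓ) ^ (2 * q) := by
  refine h.lt.trans_le ?_
  rw [pow_mul]
  refine Nat.pow_le_pow_left ?_ q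
  rw [pow_succ, pow_two]
  exact Nat.mul_le_mul_left _ hℓ

/-- From `n < (2 * m) ^ q`: a saving of `m ^ e` is a saving of `n ^ (e / q)` up to the constant `2 ^
e ≤ 2`. -/
theorem IsScale.rpow_neg_le {e : ℝ} (h : IsScale q n ℓ) (hq : 1 ≤ q) (hn : 1 ≤ n) (he0 : 0 ≤ e)
    (he : e ≤ 1) : ((2 ^ ℓ : ℕ) : ℝ) ^ (-e) ≤ 2 * (n : ℝ) ^ (-(e / q)) := by
  have hq0 : (0 : ℝ) < q := by exact_mod_cast hq
  have hn0 : (0 : ℝ) < n := by exact_mod_cast hn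
  have hm0 : (0 : ℝ) < ((2 ^ ℓ : ℕ) : ℝ) := by positivity
  have h1 : (n : ℝ) ≤ (2 * ((2 ^ ℓ : ℕ) : ℝ)) ^ q := by
    have := h.lt.le
    rw [pow_succ'] at this
    exact_mod_cast this
  have h2 : (n : ℝ) ^ (e / q) ≤ 2 * ((2 ^ ℓ : ℕ) : ℝ) ^ e := by
    calc (n : ℝ) ^ (e / q) ≤ ((2 * ((2 ^ ℓ : ℕ) : ℝ)) ^ q) ^ (e / q) :=
          Real.rpow_le_rpow hn0.le h1 (by positivity)
      _ = (2 * ((2 ^ ℓ : ℕ) : ℝ)) ^ e := by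
          rw [← Real.rpow_natCast, ← Real.rpow_mul (by positivity), mul_div_cancel₀ _ hq0.ne']
      _ = 2 ^ e * ((2 ^ ℓ : ℕ) : ℝ) ^ e := Real.mul_rpow two_pos.le hm0.le
      _ ≤ 2 * ((2 ^ ℓ : ℕ) : ℝ) ^ e := by
          gcongr
          calc (2 : ℝ) ^ e ≤ 2 ^ (1 : ℝ) := Real.rpow_le_rpow_of_exponent_le one_le_two he
            _ = 2 := Real.rpow_one 2
  rw [Real.rpow_neg hm0.le, Real.rpow_neg hn0.le, ← div_eq_mul_inv, le_div_iff₀ (by positivity),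
    inv_mul_le_iff₀ (by positivity), mul_comm _ (2 : ℝ)]
  exact h2

theorem cast_le_of_mul_le {x a m k : ℕ} {e : ℝ} (he : e ≤ 1) (hm : 1 ≤ m)
    (h : x * m ≤ a * n ^ k) : (x : ℝ) ≤ a * ((n : ℝ) ^ k * (m : ℝ) ^ (-e)) := by
  have hmr : (1 : ℝ) ≤ m := by exact_mod_cast hm
  have hinv : (m : ℝ)⁻¹ ≤ (m : ℝ) ^ (-e) := by
    rw [← Real.rpow_neg_one]
    exact Real.rpow_le_rpow_of_exponent_le hmr (by linarith)
  have h' : (x : ℝ) * m ≤ a * (n : ℝ) ^ k := by exact_mod_cast h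
  rw [← le_div_iff₀ (by linarith), div_eq_mul_inv, mul_assoc] at h'
  exact h'.trans (by gcongr)

theorem IsScale.add_le {x y a b c e : ℝ} {k : ℕ} (h : IsScale q n ℓ) (hq : 1 ≤ q) (hn : 1 ≤ n)
    (he0 : 0 ≤ e) (he : e ≤ 1) (hc : 0 ≤ c) (hab : a + b ≤ c)
    (hx : x ≤ a * ((n : ℝ) ^ k * ((2 ^ ℓ : ℕ) : ℝ) ^ (-e)))
    (hy : y ≤ b * ((n : ℝ) ^ k * ((2 ^ ℓ : ℕ) : ℝ) ^ (-e))) :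
    x + y ≤ c * 2 * (n : ℝ) ^ ((k : ℝ) - e / q) := by
  have hn0 : (0 : ℝ) < n := by exact_mod_cast hn
  have h1 := h.rpow_neg_le hq hn he0 he
  have hm0 : (0 : ℝ) < ((2 ^ ℓ : ℕ) : ℝ) := by positivity
  generalize ((2 ^ ℓ : ℕ) : ℝ) = m at *
  have hY : (n : ℝ) ^ k * m ^ (-e) ≤ 2 * (n : ℝ) ^ ((k : ℝ) - e / q) := by
    rw [sub_eq_add_neg, Real.rpow_add hn0, Real.rpow_natCast, mul_left_comm]
    gcongr
  have hY0 : 0 ≤ (n : ℝ) ^ k * m ^ (-e) := by positivity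
  calc x + y ≤ (a + b) * ((n : ℝ) ^ k * m ^ (-e)) := by rw [add_mul]; exact add_le_add hx hy
    _ ≤ c * ((n : ℝ) ^ k * m ^ (-e)) := mul_le_mul_of_nonneg_right hab hY0
    _ ≤ c * (2 * (n : ℝ) ^ ((k : ℝ) - e / q)) := mul_le_mul_of_nonneg_left hY hc
    _ = _ := by ring

/-- The bound for the error probability. -/
noncomputable def errorBound (κ q : ℕ) (f : ℕ → ℝ) (n : ℕ) : ℝ :=
  (n : ℝ) ^ (κ + 3) * (1 / 2 : ℝ) ^ (((n : ℝ) - 1) / 2) +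
    (2 * n) ^ (κ + 3) * ((2 ^ scale q n : ℕ) : ℝ) ^ (-f (2 ^ scale q n))

theorem errorBound_pos (f : ℕ → ℝ) (hn : 1 ≤ n) : 0 < errorBound κ q f n := by
  have : (0 : ℝ) < n := by exact_mod_cast hn
  unfold errorBound
  positivity

/-- Each summand is at most half of the target. The first decays exponentially. In the second, `f m
≥ 2 * q * (K + 2 * (κ + 3) + 1)` eventually and `n ≤ m ^ (2 * q)`; the factor `(2 * n) ^ (κ + 3) ≤ n
^ (2 * (κ + 3))` is cancelled and a factor `1 / n ≤ 1 / 2` is left. -/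
theorem errorBound_le {f : ℕ → ℝ} (hf : Tendsto f atTop atTop) (hq : 1 ≤ q) (K : ℕ) :
    ∀ᶠ n : ℕ in atTop, errorBound κ q f n ≤ (n : ℝ) ^ (-(K : ℝ)) := by
  set r : ℝ := (1 / 2 : ℝ) ^ (1 / 2 : ℝ) with hr
  have hr0 : 0 < r := by positivity
  have hr1 : r < 1 := Real.rpow_lt_one (by norm_num) (by norm_num) (by norm_num)
  have hlim := tendsto_pow_const_mul_const_pow_of_abs_lt_one (κ + 3 + K)
    (r := r) (by rwa [abs_of_pos hr0])
  have ht := tendsto_two_pow_scale hq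
  filter_upwards [hlim.eventually (gt_mem_nhds (show (0 : ℝ) < r / 2 by positivity)),
    ht.eventually (hf.eventually_ge_atTop (2 * q * (K + 2 * (κ + 3) + 1 : ℕ))),
    ht.eventually (eventually_ge_atTop 2), eventually_ge_atTop 2] with n h1 h2 h3 h4
  have hn2 : (2 : ℝ) ≤ n := by exact_mod_cast h4
  have hn0 : (0 : ℝ) < n := by linarith
  rw [Real.rpow_neg hn0.le, Real.rpow_natCast]
  have hA : (n : ℝ) ^ (κ + 3) * (1 / 2 : ℝ) ^ (((n : ℝ) - 1) / 2) ≤ ((n : ℝ) ^ K)⁻¹ / 2 := by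
    have e1 : (1 / 2 : ℝ) ^ (((n : ℝ) - 1) / 2) = r ^ n / r := by
      rw [hr, ← Real.rpow_natCast, ← Real.rpow_mul (by norm_num), ← Real.rpow_sub (by norm_num)]
      congr 1
      ring
    rw [e1, ← mul_div_assoc, div_le_iff₀ hr0, show ((n : ℝ) ^ K)⁻¹ / 2 * r = r / 2 / (n : ℝ) ^ K by
      ring, le_div_iff₀ (by positivity)]
    refine le_trans (le_of_eq ?_) h1.le
    rw [pow_add _ (κ + 3)]
    ring
  have hB : (2 * n : ℝ) ^ (κ + 3) * ((2 ^ scale q n : ℕ) : ℝ) ^ (-f (2 ^ scale q n)) ≤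
      ((n : ℝ) ^ K)⁻¹ / 2 := by
    set m := 2 ^ scale q n
    have hm1 : (1 : ℝ) ≤ (m : ℝ) := by exact_mod_cast (by omega : 1 ≤ m)
    have hnm : (n : ℝ) ≤ (m : ℝ) ^ (2 * q) := by
      exact_mod_cast ((isScale_scale hq (by omega)).lt_pow h3).le
    have e1 : (m : ℝ) ^ (-f m) ≤ ((n : ℝ) ^ (K + 2 * (κ + 3) + 1))⁻¹ := by
      calc (m : ℝ) ^ (-f m) ≤ (m : ℝ) ^ (-((2 * q * (K + 2 * (κ + 3) + 1) : ℕ) : ℝ)) := by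
            refine Real.rpow_le_rpow_of_exponent_le hm1 (neg_le_neg ?_)
            exact_mod_cast h2
        _ = (((m : ℝ) ^ (2 * q)) ^ (K + 2 * (κ + 3) + 1))⁻¹ := by
            rw [Real.rpow_neg (by linarith), Real.rpow_natCast, pow_mul]
        _ ≤ _ := by gcongr
    calc (2 * n : ℝ) ^ (κ + 3) * (m : ℝ) ^ (-f m) ≤
          (n * n : ℝ) ^ (κ + 3) * ((n : ℝ) ^ (K + 2 * (κ + 3) + 1))⁻¹ := by gcongr
      _ = ((n : ℝ) ^ K)⁻¹ * (n : ℝ)⁻¹ := by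
          rw [← pow_two, ← pow_mul, pow_succ, pow_add]
          field_simp
      _ ≤ ((n : ℝ) ^ K)⁻¹ * 2⁻¹ := by gcongr
      _ = _ := by rw [div_eq_mul_inv]
  calc _ ≤ ((n : ℝ) ^ K)⁻¹ / 2 + ((n : ℝ) ^ K)⁻¹ / 2 := add_le_add hA hB
    _ = _ := add_halves _

end Asymptotics

end ACZkC

namespace ACZkC

/-! ### The reduction -/

section Reduction

variable {κ q Q n R ℓ t B : ℕ} {D : Program}

/-- The program for the counting problem. -/
def countProgram (D : Program) (κ q Q : ℕ) : Program :=
  (countCmd D κ q Q).code (max 40 (countCmd D κ q Q).bound) 0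

/-- The words of the counting program are below `B` to this power. -/
def wordExponent (D : Program) (κ q Q : ℕ) : ℕ := 2 ^ (countCmd D κ q Q).depth

theorem countProgram_small [NeZero R] (w : Instance (κ + 3) n R) (hn : 1 ≤ n) (hQ : 3 * Q ≤ q)
    (hq : 2 * κ + 10 ≤ q) (hB : 2 * wordBound κ n < B) (hl : (countCmd D κ q Q).lits ≤ B)
    (hnB : n < B) (hRB : R < B) (hℓ : IsScale q n ℓ) (hR : R < (2 ^ ℓ) ^ (κ + 5)) :
    Ok (countProgram D κ q Q) (B ^ wordExponent D κ q Q)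
      (fun s => s.reg 0 = counting (κ + 3) n R w)
      (smallTime D κ Q n R ℓ + setupTime κ q Q n) 0 w.init := by
  have hw1 : 1 ≤ wordBound κ n := Nat.one_le_pow _ _ (by positivity)
  refine Run.ok w (by omega) hl hnB hRB (fun a => (w.memory_lt a).trans hRB) ?_
  refine countCmd_setup (T := smallTime D κ Q n R ℓ) hn hQ hq hB rfl rfl (fun r _ hr => ?_)
    fun ℓ' σ' hℓ' h => ?_
  · change (if r = 0 then n else if r = 1 then R else 0) = 0
    rw [if_neg (by omega), if_neg (by omega)]
  · obtain rfl := hℓ.unique hℓ'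
    rw [← Nat.zero_add (smallTime D κ Q n R ℓ)]
    exact countCmd_small w (Nat.pos_of_ne_zero (NeZero.ne R)) hR h fun σ' h' => Or.inr h'

theorem countProgram_large [NeZero R] (w : Instance (κ + 3) n R) (hn : 1 ≤ n) (hQ : 3 * Q ≤ q)
    (hq : 2 * κ + 10 ≤ q) (hB : 2 * wordBound κ n < B) (hl : (countCmd D κ q Q).lits ≤ B)
    (hnB : n < B) (hRB : R < B) (hℓ : IsScale q n ℓ) (hmn : 2 ^ ℓ ≤ n)
    (hR : (2 ^ ℓ) ^ (κ + 5) ≤ R)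
    (hwD : ∀ v : Instance (κ + 3) (2 ^ ℓ) R, D.WordsBelow v.init B)
    (hhD : ∀ v : Instance (κ + 3) (2 ^ ℓ) R, D.HaltsWithin v.init t) :
    Ok (countProgram D κ q Q) (B ^ wordExponent D κ q Q)
      (fun s => s.reg 0 = counting (κ + 3) n R w)
      (largeTime D κ Q n (2 ^ ℓ) t + setupTime κ q Q n)
      (groupError D t (budget κ n (2 ^ ℓ)) w hmn) w.init := by
  have hw1 : 1 ≤ wordBound κ n := Nat.one_le_pow _ _ (by positivity)
  refine Run.ok w (by omega) hl hnB hRB (fun a => (w.memory_lt a).trans hRB) ?_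
  refine countCmd_setup (T := largeTime D κ Q n (2 ^ ℓ) t) hn hQ hq hB rfl rfl (fun r _ hr => ?_)
    fun ℓ' σ' hℓ' h => ?_
  · change (if r = 0 then n else if r = 1 then R else 0) = 0
    rw [if_neg (by omega), if_neg (by omega)]
  · obtain rfl := hℓ.unique hℓ'
    rw [← Nat.zero_add (largeTime D κ Q n (2 ^ ℓ) t)]
    exact countCmd_large (T := 0) w hn hmn hR hB h hwD hhD fun σ' T' δ' _ h' => h'

theorem Program.WordsBelow.mono {P : Program} {s : Config} {W W' : ℕ} (h : P.WordsBelow s W)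
    (hW : W ≤ W') : P.WordsBelow s W' := fun t s' hs' a =>
  ⟨(h t s' hs' a).1.trans_le hW, (h t s' hs' a).2.trans_le hW⟩

/-- The exponent of the polynomial bound for the values of the variables. -/
def valueExponent (κ c b : ℕ) : ℕ := 2 * (κ + 5) + 2 + c + b

theorem valueExponent_bounds {c b l : ℕ} (hn : 2 * (κ + 3) ≤ n) (hl : l ≤ n) (hR : R ≤ n ^ c) :
    2 * wordBound κ n < n ^ valueExponent κ c b ∧ l ≤ n ^ valueExponent κ c b ∧
      n < n ^ valueExponent κ c b ∧ R < n ^ valueExponent κ c b ∧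
      n ^ b ≤ n ^ valueExponent κ c b := by
  have h1 : 1 < n := by omega
  have hlt : ∀ a, a < valueExponent κ c b → n ^ a < n ^ valueExponent κ c b := fun a ha =>
    Nat.pow_lt_pow_right h1 ha
  have hn1 : n < n ^ valueExponent κ c b := by
    simpa using hlt 1 (by unfold valueExponent; omega)
  refine ⟨?_, by omega, hn1, hR.trans_lt (hlt c (by unfold valueExponent; omega)),
    (hlt b (by unfold valueExponent; omega)).le⟩
  calc 2 * wordBound κ n ≤ n * (n * n) ^ (κ + 5) := by
        exact Nat.mul_le_mul (by omega) (Nat.pow_le_pow_left (Nat.mul_le_mul_right n hn) _)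
    _ = n ^ (2 * (κ + 5) + 1) := by ring
    _ < _ := hlt _ (by unfold valueExponent; omega)

theorem exists_common_bound {x y z : ℝ} (hx : 0 ≤ x) (hy : 0 ≤ y) (hz : 0 ≤ z) :
    ∃ c : ℝ, 0 ≤ c ∧ x + z ≤ c ∧ y + z ≤ c :=
  ⟨x + y + z, by positivity, by linarith, by linarith⟩

theorem solvesOnAverage_countProgram {ε ε₀ : ℝ} (hε : ε₀ ≤ ε) (h0 : 0 < ε₀) (h1 : ε₀ ≤ 1)
    (hQ : Q = 6 * (2 * κ + 11)) (hq : q = 4 * Q + 2 * κ + 11)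
    (hD : SolvesOnAverage (κ + 3) (decision (κ + 3)) D ε) :
    SolvesOnAverage (κ + 3) (counting (κ + 3)) (countProgram D κ q Q) (ε₀ / q) := by
  intro c
  -- The calls have size `m` and the same range `R ≤ n ^ c ≤ m ^ (2 * q * c)`.
  obtain ⟨C, b, f, hf, hev⟩ := hD (2 * q * c)
  have hq1 : 1 ≤ q := by omega
  obtain ⟨g, hg, hge⟩ := exists_rate (g := errorBound κ q f)
    ((eventually_ge_atTop 1).mono fun n hn => errorBound_pos f hn) (errorBound_le hf hq1)
  have ht := tendsto_two_pow_scale hq1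
  have hc₁ : 0 ≤ largeConst D κ Q |C| := largeConst_nonneg (abs_nonneg C)
  have hc₂ : (0 : ℝ) ≤ smallConst D κ Q := Nat.cast_nonneg _
  have hc₃ : (0 : ℝ) ≤ setupConst κ q Q := Nat.cast_nonneg _
  obtain ⟨c₀, hc₀, hc₁₃, hc₂₃⟩ : ∃ c₀ : ℝ, 0 ≤ c₀ ∧ largeConst D κ Q |C| + setupConst κ q Q ≤ c₀ ∧
      smallConst D κ Q + setupConst κ q Q ≤ c₀ :=
    exists_common_bound hc₁ hc₂ hc₃
  refine ⟨c₀ * 2,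
    valueExponent κ c b * wordExponent D κ q Q, g, hg, ?_⟩
  filter_upwards [ht.eventually hev, ht.eventually (eventually_ge_atTop 8), hge,
    eventually_ge_atTop (2 * (κ + 3)), eventually_ge_atTop (countCmd D κ q Q).lits]
    with n hDn hm8 hgn hn2 hnl
  intro R _ hR
  have hn : 1 ≤ n := by omega
  have hℓ := isScale_scale hq1 hn
  have hmn := hℓ.base_le hq1
  have hm1 : 1 ≤ 2 ^ scale q n := Nat.one_le_two_pow
  obtain ⟨hB, hlB, hnB, hRB, hbB⟩ := valueExponent_bounds (κ := κ) (b := b) hn2 hnl hR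
  have hmr : (1 : ℝ) ≤ (2 ^ scale q n : ℕ) := by exact_mod_cast hm1
  have hsetup := cast_le_of_mul_le h1 hm1
    (setupTime_mul_le (κ := κ) (q := q) (Q := Q) hn hmn)
  -- Common to both cases: correctness of each run up to `err w` and a bound for the mean of `err`
  -- give the last three requirements of the definition.
  have hprob : ∀ (T : ℕ) (err : Instance (κ + 3) n R → ENNReal),
      expect (PMF.uniformOfFintype _) err ≤ ENNReal.ofReal (errorBound κ q f n) →
      (∀ w : Instance (κ + 3) n R, Ok (countProgram D κ q Q)
        ((n ^ valueExponent κ c b) ^ wordExponent D κ q Q)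
        (fun s => s.reg 0 = counting (κ + 3) n R w) T (err w) w.init) →
      (∀ w : Instance (κ + 3) n R, (countProgram D κ q Q).HaltsWithin w.init T ∧
        (countProgram D κ q Q).WordsBelow w.init
          (n ^ (valueExponent κ c b * wordExponent D κ q Q))) ∧
      ENNReal.ofReal (1 - (n : ℝ) ^ (-g n)) ≤
        successProb (countProgram D κ q Q) (κ + 3) n R (counting (κ + 3) n R) T := by
    intro T err herr hok
    refine ⟨fun w => ⟨(hok w).2.1, ?_⟩, ?_⟩
    · rw [pow_mul]
      exact (hok w).1
    · refine (ENNReal.ofReal_le_ofReal (sub_le_sub_left hgn 1)).trans ?_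
      exact ofReal_le_successProb (errorBound_pos f hn).le
        ((expect_mono _ fun w => (hok w).2.2).trans herr)
  -- The case depends only on `n` and `R`, so the time bound may be chosen separately in each case.
  rcases lt_or_ge R ((2 ^ scale q n) ^ (κ + 5)) with hRm | hRm
  · refine ⟨smallTime D κ Q n R (scale q n) + setupTime κ q Q n, ?_, ?_⟩
    · rw [Nat.cast_add]
      exact hℓ.add_le hq1 hn h0.le h1 hc₀ hc₂₃ (cast_le_of_mul_le h1 hm1
        (smallTime_mul_le (D := D) hn hQ (by omega) hℓ hRm.le)) hsetup
    · exact hprob _ (fun _ => 0) (by simp [expect]) fun w =>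
        countProgram_small w hn (by omega) (by omega) hB hlB hnB hRB hℓ hRm
  · have hRc : R ≤ (2 ^ scale q n) ^ (2 * q * c) := by
      rw [pow_mul]
      exact hR.trans (Nat.pow_le_pow_left (hℓ.lt_pow (by omega)).le c)
    obtain ⟨t, htC, hhw, hs⟩ := hDn R hRc
    refine ⟨largeTime D κ Q n (2 ^ scale q n) t + setupTime κ q Q n, ?_, ?_⟩
    · rw [Nat.cast_add]
      refine hℓ.add_le hq1 hn h0.le h1 hc₀ hc₁₃
        (largeTime_le h1 hm1 hmn (htC.trans ?_)) hsetup
      exact mul_le_mul (le_abs_self C) (Real.rpow_le_rpow_of_exponent_le hmr (by linarith))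
        (by positivity) (abs_nonneg C)
    · refine hprob _ _ ?_ fun w => countProgram_large w hn (by omega) (by omega) hB hlB hnB hRB hℓ
        hmn hRm (fun v => (hhw v).2.mono ((Nat.pow_le_pow_left hmn b).trans hbB))
        (fun v => (hhw v).1)
      refine (expect_groupError_le hmn hs).trans ?_
      refine (add_le_add_left (expect_counting_gt_le hn hm8 (hℓ.pow_le (by omega)) hRm) _).trans ?_
      unfold errorBound
      rw [ENNReal.ofReal_add (by positivity) (by positivity)]
      gcongr
      rw [ENNReal.ofReal_mul (by positivity)]
      gcongr
      rw [← ENNReal.ofReal_natCast]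
      refine ENNReal.ofReal_le_ofReal ?_
      have : (n / 2 ^ scale q n + 1) ^ (κ + 3) ≤ (2 * n) ^ (κ + 3) := by
        refine Nat.pow_le_pow_left ?_ _
        have := Nat.div_le_self n (2 ^ scale q n)
        omega
      exact_mod_cast this

end Reduction

end ACZkC

theorem mainTheorem9 (k : ℕ) (hk : 3 ≤ k) (ε : ℝ) (hε : 0 < ε) (D : ACZkC.Program)
    (hD : ACZkC.SolvesOnAverage k (ACZkC.decision k) D ε) :
    ∃ ε' : ℝ, 0 < ε' ∧ ∃ A : ACZkC.Program,
      ACZkC.SolvesOnAverage k (ACZkC.counting k) A ε' := by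
  obtain ⟨κ, rfl⟩ := Nat.exists_eq_add_of_le' hk
  -- Some parts of the algorithm save only one factor `m`, so the exponent is capped at `1`;
  -- dividing by `q` converts powers of `m` into powers of `n`.
  have h0 : 0 < min ε 1 := lt_min hε one_pos
  exact ⟨min ε 1 / (4 * (6 * (2 * κ + 11)) + 2 * κ + 11 : ℕ), by positivity, _,
    ACZkC.solvesOnAverage_countProgram (min_le_left _ _) h0 (min_le_right _ _) rfl rfl hD⟩
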